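/- Write $w(x)=1+|x|$, and for $1\le p\le\infty$, $r\in\mathbb R$ let $L^p_r(\mathbb R)=\{f : w^r f\in L^p(\mathbb R)\}$ with norm $\|f\|_{L^p_r}=\|w^r f\|_{L^p}$ (functions equal almost everywhere are identified). Let $\chi:[0,\infty)\to\mathbb C$ be smooth with $\chi=1$ on $[0,1]$ and $\chi=0$ on $[2,\infty)$. For $k\in\mathbb C\setminus[0,\infty)$ and real $x\neq0$ put $$G_k(x)=\frac1{2\pi}\int_0^\infty\frac{e^{ix\xi}}{\xi-k}\,d\xi,\qquad l(k)=\frac1{2\pi}\int_0^\infty\frac{\chi(\xi)}{\xi-k}\,d\xi,$$ the first integral being the improper one, $\lim_{N\to\infty}\int_0^N$. For $\lambda>0$ put $G_{\lambda\pm0i}(x)=\lim_{\varepsilon\searrow0}G_{\lambda\pm i\varepsilon}(x)$ and $l(\lambda\pm0i)=\lim_{\varepsilon\searrow0}l(\lambda\pm i\varepsilon)$. For $k\in(\mathbb C\setminus[0,\infty))\cup(\mathbb R^+\pm0i)$ let $G^0_k(x)=G_k(x)-l(k)$, and for $k=0$ (also written $0\pm0i$) let $$G^0_0(x)=\lim_{N\to\infty}\frac1{2\pi}\int_0^N\frac{e^{ix\xi}-\chi(\xi)}{\xi}\,d\xi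 .$$ For a potential $u$ let $T^0_k\varphi=G^0_k*(u\varphi)$. Write $|k|=\lambda$ when $k=\lambda\pm0i$. **Theorem.** Let $s>s_1>\frac12$, let $u\in L^2_s(\mathbb R)$ be real-valued, and suppose that $$\operatorname{Im}\int_1^2\frac{\chi(\xi)}{\xi}\,d\xi\neq0 .$$ Then there is $k_0>0$ such that for all $k\in(\mathbb C\setminus[0,\infty))\cup(\mathbb R^+\pm0i)\cup\{0\}$ with $|k|<k_0$ and all $\lambda$ with $0\le\lambda<k_0$, and for each choice of sign, the following holds. The integrals and limits defining $G^0_k(x)$ for $x\ne0$ exist, and the convolution $G^0_k*(u\varphi)$ converges absolutely at every point for all $\varphi\in L^\infty_{-(s-s_1)}(\mathbb R)$. The equations $$m^0_1(k)=1+T^0_k\,m^0_1(k),\qquad m^0_e(\lambda\pm0i)=e^{i\lambda x}+T^0_{\lambda\pm0i}\,m^0_e(\lambda\pm0i)$$ have unique solutions $m^0_1(k)$ and $m^0_e(\lambda\pm0i)$ in $L^\infty_{-(s-s_1)}(\mathbb R)$. Furthermore, there are $C>0$ and $\epsilon\in(0,1)$ such that for all such $k$ and $\lambda$ $$\|m^0_1(k)-m^0_1(0)\|_{L^\infty_{-(s-s_1)}}\le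 C|k|^\epsilon,\qquad \|m^0_e(\lambda\pm0i)-m^0_1(0)\|_{L^\infty_{-(s-s_1)}}\le C\lambda^\epsilon .$$ -/

import Mathlib

open MeasureTheory Filter Topology
open scoped ENNReal

namespace BO

noncomputable section

/-- The weight `w(x) = 1 + |x|`. -/
def weight (x : ℝ) : ℝ := 1 + |x|

/-- The norm `‖f‖_{L^p_r} = ‖w^r f‖_p`, with values in `[0, ∞]`. -/
def weightedNorm {E : Type*} [NormedAddCommGroup E] [NormedSpace ℝ E]
    (p : ℝ≥0∞) (r : ℝ) (f : ℝ → E) : ℝ≥0∞ :=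
  eLpNorm (fun x => (weight x ^ r) • f x) p volume

/-- `f ∈ L^p_r(ℝ)`, that is `w^r f ∈ L^p(ℝ)`. Elements are identified when equal almost
everywhere. -/
def MemWeightedLp {E : Type*} [NormedAddCommGroup E] [NormedSpace ℝ E]
    (p : ℝ≥0∞) (r : ℝ) (f : ℝ → E) : Prop :=
  MemLp (fun x => (weight x ^ r) • f x) p volume

/-- The improper integral `∫_0^∞ f = lim_{N → ∞} ∫_0^N f`. -/
def improperIntegral (f : ℝ → ℂ) : ℂ :=
  limUnder atTop (fun N : ℝ => ∫ ξ in (0 : ℝ)..N, f ξ)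

/-- The improper integral `∫_0^∞ f` exists. -/
def ImproperlyIntegrable (f : ℝ → ℂ) : Prop :=
  (∀ N : ℝ, 0 ≤ N → IntervalIntegrable f volume 0 N) ∧
    ∃ z : ℂ, Tendsto (fun N : ℝ => ∫ ξ in (0 : ℝ)..N, f ξ) atTop (𝓝 z)

/-- `χ` is a smooth complex-valued cutoff on `[0, ∞)`, equal to `1` on `[0, 1]` and to `0` on
`[2, ∞)`. Its values at negative arguments are never used. -/
structure IsCutoff (χ : ℝ → ℂ) : Prop where
  smooth : ContDiffOn ℝ ((⊤ : ℕ∞) : WithTop ℕ∞) χ (Set.Ici 0)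
  eq_one : ∀ ξ : ℝ, 0 ≤ ξ → ξ ≤ 1 → χ ξ = 1
  eq_zero : ∀ ξ : ℝ, 2 ≤ ξ → χ ξ = 0

/-- The two sides of the cut `(0, ∞)`. -/
inductive Side
  | above
  | below

/-- The sign in `λ ± 0i`. -/
def Side.sign : Side → ℝ
  | .above => 1
  | .below => -1

/-- The parameter set `(ℂ ∖ [0, ∞)) ∪ (ℝ⁺ ± 0i) ∪ {0}`. -/
inductive SpectralPoint
  /-- a point of `ℂ ∖ [0, ∞)` -/
  | off (k : ℂ) (hk : ∀ t : ℝ, 0 ≤ t → k ≠ (t : ℂ))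
  /-- the point `λ + 0i` or `λ - 0i` with `λ > 0` -/
  | cut (σ : Side) (lam : ℝ) (hlam : 0 < lam)
  /-- the point `0` -/
  | zero

/-- The complex number underlying a parameter. -/
def SpectralPoint.val : SpectralPoint → ℂ
  | .off k _ => k
  | .cut _ lam _ => (lam : ℂ)
  | .zero => 0

/-- The point `λ ± 0i` for `λ ≥ 0`; for `λ = 0` both are the point `0`. -/
def SpectralPoint.ofSide (σ : Side) (lam : ℝ) : SpectralPoint :=
  if h : 0 < lam then .cut σ lam h else .zero

/-- The complex number `λ ± iε`. -/
def approach (σ : Side) (lam ε : ℝ) : ℂ := (lam : ℂ) + (σ.sign * ε : ℝ) * Complex.I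

/-- The integrand of `G_k(x)`. -/
def kernelIntegrand (k : ℂ) (x ξ : ℝ) : ℂ :=
  Complex.exp (Complex.I * x * ξ) / ((ξ : ℂ) - k)

/-- `G_k(x) = (2π)⁻¹ ∫_0^∞ e^{ixξ} / (ξ - k) dξ` for `k ∈ ℂ ∖ [0, ∞)`. -/
def kernel (k : ℂ) (x : ℝ) : ℂ :=
  (1 / (2 * Real.pi) : ℂ) * improperIntegral (kernelIntegrand k x)

/-- `l(k) = (2π)⁻¹ ∫_0^∞ χ(ξ) / (ξ - k) dξ` for `k ∈ ℂ ∖ [0, ∞)`. -/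
def logTerm (χ : ℝ → ℂ) (k : ℂ) : ℂ :=
  (1 / (2 * Real.pi) : ℂ) * ∫ ξ in Set.Ioi (0 : ℝ), χ ξ / ((ξ : ℂ) - k)

/-- The integrand of `G_0^0(x)`. -/
def kernelZeroIntegrand (χ : ℝ → ℂ) (x ξ : ℝ) : ℂ :=
  (Complex.exp (Complex.I * x * ξ) - χ ξ) / (ξ : ℂ)

/-- `G_k` for `k` in the slit plane or on one of the two sides of the cut, where
`G_{λ±0i}(x) = lim_{ε ↘ 0} G_{λ±iε}(x)`, and the same for `l`; then
`G_k^0(x) = G_k(x) - l(k)`, while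
`G_0^0(x) = (2π)⁻¹ ∫_0^∞ (e^{ixξ} - χ(ξ)) / ξ dξ`. -/
def modKernel (χ : ℝ → ℂ) : SpectralPoint → ℝ → ℂ
  | .off k _, x => kernel k x - logTerm χ k
  | .cut σ lam _, x =>
      limUnder (𝓝[>] (0 : ℝ)) (fun ε => kernel (approach σ lam ε) x) -
        limUnder (𝓝[>] (0 : ℝ)) (fun ε => logTerm χ (approach σ lam ε))
  | .zero, x => (1 / (2 * Real.pi) : ℂ) * improperIntegral (kernelZeroIntegrand χ x)

/-- For `k ∈ ℂ ∖ [0, ∞)`, the integrals defining `G_k(x)` and `l(k)` exist. -/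
def OffConverges (χ : ℝ → ℂ) (k : ℂ) (x : ℝ) : Prop :=
  ImproperlyIntegrable (kernelIntegrand k x) ∧
    IntegrableOn (fun ξ : ℝ => χ ξ / ((ξ : ℂ) - k)) (Set.Ioi 0)

/-- All integrals and limits in the definition of `G_κ^0(x)` exist. -/
def ModKernelConverges (χ : ℝ → ℂ) : SpectralPoint → ℝ → Prop
  | .off k _, x => OffConverges χ k x
  | .cut σ lam _, x =>
      (∀ ε : ℝ, 0 < ε → OffConverges χ (approach σ lam ε) x) ∧
      (∃ z : ℂ, Tendsto (fun ε => kernel (approach σ lam ε) x) (𝓝[>] (0 : ℝ)) (𝓝 z)) ∧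
      (∃ z : ℂ, Tendsto (fun ε => logTerm χ (approach σ lam ε)) (𝓝[>] (0 : ℝ)) (𝓝 z))
  | .zero, x => ImproperlyIntegrable (kernelZeroIntegrand χ x)

/-- `T_κ^0 φ = G_κ^0 * (u φ)`. -/
def modT (χ : ℝ → ℂ) (u : ℝ → ℝ) (κ : SpectralPoint) (φ : ℝ → ℂ) (x : ℝ) : ℂ :=
  ∫ y, modKernel χ κ (x - y) * ((u y : ℂ) * φ y)

/-- `m ∈ L^∞_r(ℝ)` solves `m = 1 + T_κ^0 m`. -/
def IsModM1 (χ : ℝ → ℂ) (u : ℝ → ℝ) (r : ℝ) (κ : SpectralPoint) (m : ℝ → ℂ) : Prop :=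
  MemWeightedLp ∞ r m ∧ ∀ᵐ x : ℝ, m x = 1 + modT χ u κ m x

/-- `m ∈ L^∞_r(ℝ)` solves `m = e(λ) + T_{λ±0i}^0 m`, where `e(λ)(x) = e^{iλx}`. -/
def IsModMe (χ : ℝ → ℂ) (u : ℝ → ℝ) (r : ℝ) (σ : Side) (lam : ℝ) (m : ℝ → ℂ) : Prop :=
  MemWeightedLp ∞ r m ∧
    ∀ᵐ x : ℝ, m x = Complex.exp (Complex.I * lam * x) +
      modT χ u (SpectralPoint.ofSide σ lam) m x

end

end BO

/-! Put $v=w^{s_1}u$. With $g=w^{s_1}um$ the equation $m=h+G^0_k*(um)$ becomes $g=vh+A_kg$ on $L^2$,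
where $A_kg=v\cdot(G^0_k*(w^{-s_1}g))$; conversely $m$ is recovered from $um$ by the equation
itself. Three facts about $A_k$ suffice: it is compact, $\|A_k-A_0\|=O(|k|^\eta)$, and $1-A_0$ is
injective. The Fredholm alternative and a Neumann series then give solvability, uniqueness and the
Hölder bounds (`exists_perturbation_bound`, `exists_modSol_bounds`).

Kernel bounds. For $x>0$ the integral defining $G_k(x)$ is an exponential integral evaluated at
$-xk$; for $x<0$ conjugation applies. Its logarithm splits as $\log x+\log(-k)$, and $l(k)$ contains
exactly the same $-\log(-k)$, so $G^0_k$ stays finite as $k\to0$. The remaining error is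
$O(|k|^\eta(|x|^\eta+|x|^{-\eta}))$ for every $0<\eta<1$ (`modKernel_off_sub_zero`,
`norm_expLogDefect_le`, `exists_modKernel_bounds`). Such kernels map $L^2_r$, $r>\frac12+\eta$, to
functions of growth $w^\eta$, and weak continuity of point evaluations gives compactness
(`exists_convOperator`).

Injectivity at $k=0$ (`eq_zero_of_eq_mul_conv`). Here $2\pi G^0_0=K-c$ with $K$ = `zeroKernel`,
$K(-x)=\overline{K(x)}$, and $c=\int_1^2\chi/\xi$. Let $f=u\,(G^0_0*f)$. (1) Since $u$ is real,
$\int\bar f\,(G^0_0*f)=\int u|G^0_0*f|^2$ is real; so is $\int\bar f\,(K*f)$. Hence $c\,|\int f|^2$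
is real, and $\operatorname{Im}c\ne0$ forces $\int f=0$. (2) Mean zero replaces the logarithmic
growth of $K*f$ by decay, and iterating the equation puts $f$ in $L^2_r$ for some $r>\frac32$. (3)
Pairing the equation with $xf$ in the same way gives $\iint\overline{f(x)}(x-y)K(x-y)f(y)=0$. Up to
an affine function of $x$, $ixK(x)$ is $\int_0^\infty e^{ix\xi}\xi^{-2}d\xi$, suitably regularised,
so for mean zero $f$ the form equals $-i\int_0^\infty|\hat f|^2\xi^{-2}d\xi$. Thus $\hat f=0$ on
$(0,\infty)$. (4) $K$ is built from positive frequencies and a constant, so $K*f=0$ and $f=0$. -/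

namespace BO

/-! ### The exponential integral on the slit plane -/

/-- The entire function `w ↦ ∫_0^1 (e^{iwt} - 1) / t dt`. -/
noncomputable def einInt (w : ℂ) : ℂ :=
  ∫ t in (0 : ℝ)..1, (Complex.exp (Complex.I * w * t) - 1) / (t : ℂ)

/-- A primitive of `e^{iw} / w` on the slit plane. -/
noncomputable def expLog (w : ℂ) : ℂ := Complex.log w + einInt w

/-- The limit of `expLog` at `+∞`. -/
noncomputable def expLogLim : ℂ := limUnder atTop (fun N : ℝ => expLog N)

lemma norm_exp_I_mul (w : ℂ) : ‖Complex.exp (Complex.I * w)‖ = Real.exp (-w.im) := by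
  simp [Complex.norm_exp]

lemma norm_exp_I_mul_sub_one_le (w : ℂ) :
    ‖Complex.exp (Complex.I * w) - 1‖ ≤ ‖w‖ * Real.exp ‖w‖ := by
  have h := Complex.norm_exp_sub_sum_le_norm_mul_exp (Complex.I * w) 1
  simpa using h

lemma measurable_einInt_integrand (w : ℂ) :
    Measurable fun t : ℝ => (Complex.exp (Complex.I * w * t) - 1) / (t : ℂ) := by
  fun_prop

lemma norm_einInt_integrand_le (w : ℂ) (t : ℝ) (ht0 : 0 ≤ t) (ht1 : t ≤ 1) :
    ‖(Complex.exp (Complex.I * w * t) - 1) / (t : ℂ)‖ ≤ ‖w‖ * Real.exp ‖w‖ := by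
  rcases ht0.eq_or_lt with rfl | ht
  · simp; positivity
  rw [norm_div, Complex.norm_real, Real.norm_of_nonneg ht0, div_le_iff₀ ht]
  have h := norm_exp_I_mul_sub_one_le (w * t)
  rw [← mul_assoc] at h
  refine h.trans ?_
  rw [norm_mul, Complex.norm_real, Real.norm_of_nonneg ht0]
  have : Real.exp (‖w‖ * t) ≤ Real.exp ‖w‖ :=
    Real.exp_le_exp.2 (mul_le_of_le_one_right (norm_nonneg _) ht1)
  nlinarith [mul_nonneg (norm_nonneg w) ht0]

lemma intervalIntegrable_einInt_integrand (w : ℂ) :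
    IntervalIntegrable (fun t : ℝ => (Complex.exp (Complex.I * w * t) - 1) / (t : ℂ))
      volume 0 1 := by
  rw [intervalIntegrable_iff_integrableOn_Ioc_of_le zero_le_one]
  refine Measure.integrableOn_of_bounded (M := ‖w‖ * Real.exp ‖w‖) (by simp)
    (measurable_einInt_integrand w).aestronglyMeasurable ?_
  filter_upwards [ae_restrict_mem measurableSet_Ioc] with t ht
  exact norm_einInt_integrand_le w t ht.1.le ht.2

lemma norm_einInt_le (w : ℂ) : ‖einInt w‖ ≤ ‖w‖ * Real.exp ‖w‖ := by
  have := intervalIntegral.norm_integral_le_of_norm_le_const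
    (f := fun t : ℝ => (Complex.exp (Complex.I * w * t) - 1) / (t : ℂ)) (a := 0) (b := 1)
    (C := ‖w‖ * Real.exp ‖w‖) (fun t ht => by
      rw [Set.uIoc_of_le zero_le_one] at ht
      exact norm_einInt_integrand_le w t ht.1.le ht.2)
  simpa [einInt] using this

/-- Differentiating in $w$ cancels the factor $1/t$, so the derivative of the integrand is bounded
near $w$ and integrates explicitly over $[0,1]$. -/
lemma hasDerivAt_einInt {w : ℂ} (hw : w ≠ 0) :
    HasDerivAt einInt ((Complex.exp (Complex.I * w) - 1) / w) w := by
  have key := intervalIntegral.hasDerivAt_integral_of_dominated_loc_of_deriv_le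
    (μ := volume) (a := (0 : ℝ)) (b := 1) (x₀ := w) (s := Metric.ball w 1)
    (F := fun (v : ℂ) (t : ℝ) => (Complex.exp (Complex.I * v * t) - 1) / (t : ℂ))
    (F' := fun (v : ℂ) (t : ℝ) => Complex.I * Complex.exp (Complex.I * v * t))
    (bound := fun _ => Real.exp (‖w‖ + 1)) (Metric.ball_mem_nhds _ one_pos)
    (Eventually.of_forall fun v => (measurable_einInt_integrand v).aestronglyMeasurable)
    (intervalIntegrable_einInt_integrand w)
    (by apply Continuous.aestronglyMeasurable; fun_prop)
    (Eventually.of_forall fun t ht v hv => by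
      rw [Set.uIoc_of_le zero_le_one] at ht
      rw [norm_mul, Complex.norm_I, one_mul, Complex.norm_exp]
      refine Real.exp_le_exp.2 ((Complex.re_le_norm _).trans ?_)
      rw [norm_mul, norm_mul, Complex.norm_I, one_mul, Complex.norm_real,
        Real.norm_of_nonneg ht.1.le]
      have h1 : ‖v‖ ≤ ‖w‖ + 1 := by
        have := norm_le_norm_add_norm_sub' v w
        rw [Metric.mem_ball, dist_eq_norm] at hv
        linarith
      exact (mul_le_of_le_one_right (norm_nonneg _) ht.2).trans h1)
    (by simp)
    (Eventually.of_forall fun t ht v hv => by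
      rw [Set.uIoc_of_le zero_le_one] at ht
      have ht0 : (t : ℂ) ≠ 0 := by exact_mod_cast ht.1.ne'
      have h1 : HasDerivAt (fun v : ℂ => Complex.I * v * t) (Complex.I * t) v := by
        simpa using ((hasDerivAt_id v).const_mul Complex.I).mul_const (t : ℂ)
      have := (h1.cexp.sub_const 1).div_const (t : ℂ)
      exact this.congr_deriv (by field_simp))
  refine key.2.congr_deriv ?_
  rw [intervalIntegral.integral_const_mul, integral_exp_mul_complex (by simp [hw])]
  have := Complex.I_ne_zero
  field_simp
  simp

lemma hasDerivAt_expLog {w : ℂ} (hw : w ∈ Complex.slitPlane) :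
    HasDerivAt expLog (Complex.exp (Complex.I * w) / w) w := by
  have h0 := Complex.slitPlane_ne_zero hw
  have := (Complex.hasDerivAt_log hw).add (hasDerivAt_einInt h0)
  refine this.congr_deriv ?_
  field_simp
  ring

/-- `expLog` minus the first term of its asymptotic expansion. -/
noncomputable def expLogRem (w : ℂ) : ℂ :=
  expLog w - Complex.exp (Complex.I * w) / (Complex.I * w)

/-- One integration by parts: the derivative improves from size $|w|^{-1}$ to $|w|^{-2}$, which is
absolutely integrable along horizontal rays. -/
lemma hasDerivAt_expLogRem {w : ℂ} (hw : w ∈ Complex.slitPlane) :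
    HasDerivAt expLogRem (Complex.exp (Complex.I * w) / (Complex.I * w ^ 2)) w := by
  have h0 := Complex.slitPlane_ne_zero hw
  have h1 : HasDerivAt (fun v : ℂ => Complex.I * v) Complex.I w := by
    simpa using (hasDerivAt_id w).const_mul Complex.I
  have hI := Complex.I_ne_zero
  have := (hasDerivAt_expLog hw).sub (h1.cexp.div h1 (mul_ne_zero hI h0))
  refine this.congr_deriv ?_
  field_simp
  ring

lemma ofReal_mem_slitPlane_of_pos {t : ℝ} (ht : 0 < t) : (t : ℂ) ∈ Complex.slitPlane := by
  simpa using ht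

lemma add_ofReal_mem_slitPlane {w : ℂ} (hw : w ∈ Complex.slitPlane) {t : ℝ} (ht : 0 ≤ t) :
    w + t ∈ Complex.slitPlane := by
  rw [Complex.mem_slitPlane_iff] at hw ⊢
  rcases hw with h | h
  · left; simp; linarith
  · right; simpa using h

lemma tendsto_exp_div_atTop (w : ℂ) :
    Tendsto (fun N : ℝ => Complex.exp (Complex.I * (w + N)) / (Complex.I * (w + N)))
      atTop (𝓝 0) := by
  rw [tendsto_zero_iff_norm_tendsto_zero]
  have h1 : Tendsto (fun N : ℝ => Real.exp (-w.im) / (N - ‖w‖)) atTop (𝓝 0) :=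
    tendsto_const_nhds.div_atTop (tendsto_atTop_add_const_right _ _ tendsto_id)
  refine squeeze_zero' (Eventually.of_forall fun _ => norm_nonneg _) ?_ h1
  filter_upwards [eventually_gt_atTop ‖w‖] with N hN
  rw [norm_div, norm_exp_I_mul, norm_mul, Complex.norm_I, one_mul]
  simp only [Complex.add_im, Complex.ofReal_im, add_zero]
  have : N - ‖w‖ ≤ ‖w + N‖ := by
    have := norm_sub_le (w + N) w
    rw [add_sub_cancel_left, Complex.norm_real, Real.norm_eq_abs] at this
    have := le_abs_self N
    linarith
  have : 0 < N - ‖w‖ := by linarith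
  gcongr

/-- `expLogRem` has an integrable derivative on $(1,\infty)$ and the subtracted term tends to zero.
This makes `expLogLim` a genuine limit and not a default value. -/
lemma tendsto_expLog_ofReal : Tendsto (fun N : ℝ => expLog N) atTop (𝓝 expLogLim) := by
  have hderiv : ∀ t ∈ Set.Ioi (1 : ℝ), HasDerivAt (fun N : ℝ => expLogRem N)
      (Complex.exp (Complex.I * t) / (Complex.I * (t : ℂ) ^ 2)) t := fun t ht =>
    (hasDerivAt_expLogRem (ofReal_mem_slitPlane_of_pos (one_pos.trans ht))).comp_ofReal
  have hint : IntegrableOn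
      (fun t : ℝ => Complex.exp (Complex.I * t) / (Complex.I * (t : ℂ) ^ 2)) (Set.Ioi 1) := by
    have h2 := integrableOn_Ioi_rpow_of_lt (a := -2) (by norm_num) one_pos
    refine Integrable.mono' h2 (by apply Measurable.aestronglyMeasurable; fun_prop) ?_
    filter_upwards [ae_restrict_mem measurableSet_Ioi] with t ht
    have ht0 : (0 : ℝ) < t := one_pos.trans ht
    rw [norm_div, norm_exp_I_mul]
    simp [Real.rpow_neg ht0.le]
  have h := tendsto_limUnder_of_hasDerivAt_of_integrableOn_Ioi hderiv hint
  have h0 := tendsto_exp_div_atTop 0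
  have h3 := h.add h0
  refine tendsto_nhds_limUnder ⟨_, h3.congr fun N => ?_⟩
  simp [expLogRem]

lemma norm_expLog_sub_le {a b : ℂ} {M : ℝ}
    (hs : ∀ v ∈ segment ℝ a b, v ∈ Complex.slitPlane ∧
      ‖Complex.exp (Complex.I * v) / v‖ ≤ M) :
    ‖expLog b - expLog a‖ ≤ M * ‖b - a‖ :=
  (convex_segment a b).norm_image_sub_le_of_norm_hasDerivWithin_le
    (fun v hv => (hasDerivAt_expLog (hs v hv).1).hasDerivWithinAt)
    (fun v hv => (hs v hv).2) (left_mem_segment ℝ a b) (right_mem_segment ℝ a b)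

/-- The limit is the same along every horizontal ray: the segment from $N$ to $w+N$ has length
$\|w\|$, and $e^{iv}/v$ is at most $e^{\|w\|}/(N-\|w\|)$ on it. -/
lemma tendsto_expLog_add (w : ℂ) :
    Tendsto (fun N : ℝ => expLog (w + N)) atTop (𝓝 expLogLim) := by
  have h1 : Tendsto (fun N : ℝ => expLog (w + N) - expLog N) atTop (𝓝 0) := by
    have h1 : Tendsto (fun N : ℝ => Real.exp ‖w‖ / (N - ‖w‖) * ‖w‖) atTop (𝓝 0) := by
      simpa [sub_eq_add_neg] using (tendsto_const_nhds.div_atTop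
        (tendsto_atTop_add_const_right _ (-‖w‖) tendsto_id)).mul_const ‖w‖
    rw [tendsto_zero_iff_norm_tendsto_zero]
    refine squeeze_zero' (Eventually.of_forall fun _ => norm_nonneg _) ?_ h1
    filter_upwards [eventually_gt_atTop ‖w‖] with N hN
    have := norm_expLog_sub_le (a := N) (b := w + N) (M := Real.exp ‖w‖ / (N - ‖w‖)) ?_
    · simpa using this
    intro v hv
    rw [segment_eq_image'] at hv
    obtain ⟨θ, ⟨h0, h1⟩, rfl⟩ := hv
    have e : (N : ℂ) + θ • (w + N - N) = θ * w + N := by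
      simp [Complex.real_smul]; ring
    simp only [e]
    have hθ : ‖(θ : ℂ) * w‖ ≤ ‖w‖ := by
      rw [norm_mul, Complex.norm_real, Real.norm_of_nonneg h0]
      exact mul_le_of_le_one_left (norm_nonneg _) h1
    have hre := (Complex.abs_re_le_norm ((θ : ℂ) * w)).trans hθ
    have him := (Complex.abs_im_le_norm ((θ : ℂ) * w)).trans hθ
    constructor
    · left
      rw [Complex.add_re, Complex.ofReal_re]
      linarith [abs_le.1 hre]
    · rw [norm_div, norm_exp_I_mul]
      have h3 : N - ‖w‖ ≤ ‖(θ : ℂ) * w + N‖ := by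
        refine le_trans ?_ (Complex.re_le_norm _)
        rw [Complex.add_re, Complex.ofReal_re]
        linarith [abs_le.1 hre]
      have : 0 < N - ‖w‖ := by linarith
      have h4 : -((θ : ℂ) * w + N).im ≤ ‖w‖ := by
        rw [Complex.add_im, Complex.ofReal_im]
        linarith [abs_le.1 him]
      gcongr
  simpa using h1.add tendsto_expLog_ofReal

/-- Integrate the derivative of `expLogRem` along the ray $w+t$. Since
$|w+t|^2\ge1+(t+\operatorname{Re}w)^2$, the integral costs at most $\pi e^{-\operatorname{Im}w}$,
and the boundary term at most $e^{-\operatorname{Im}w}$. -/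
lemma norm_expLogLim_sub_expLog_le_of_one_le_abs_im {w : ℂ} (hw : 1 ≤ |w.im|) :
    ‖expLogLim - expLog w‖ ≤ 5 * Real.exp (-w.im) := by
  have him : w.im ≠ 0 := by
    rintro h; rw [h, abs_zero] at hw; linarith
  have hmem : w ∈ Complex.slitPlane := Or.inr him
  have hb : ∀ t : ℝ, ‖Complex.exp (Complex.I * (w + t)) / (Complex.I * (w + t) ^ 2)‖ ≤
      Real.exp (-w.im) * (1 + (t + w.re) ^ 2)⁻¹ := by
    intro t
    rw [norm_div, norm_exp_I_mul, norm_mul, Complex.norm_I, one_mul, norm_pow,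
      Complex.sq_norm, Complex.normSq_apply, div_eq_mul_inv]
    simp only [Complex.add_im, Complex.ofReal_im, add_zero, Complex.add_re, Complex.ofReal_re]
    have : 1 ≤ w.im * w.im := by
      rw [← abs_mul_abs_self]; nlinarith
    have h2 : 1 + (t + w.re) ^ 2 ≤ (w.re + t) * (w.re + t) + w.im * w.im := by nlinarith
    gcongr
  have hcauchy : Integrable (fun t : ℝ => (1 + (t + w.re) ^ 2)⁻¹) :=
    integrable_inv_one_add_sq.comp_add_right w.re
  have hint : Integrable (fun t : ℝ =>
      Complex.exp (Complex.I * (w + t)) / (Complex.I * (w + t) ^ 2)) :=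
    Integrable.mono' (hcauchy.const_mul _) (by apply Measurable.aestronglyMeasurable; fun_prop)
      (Eventually.of_forall hb)
  have hderiv : ∀ t ∈ Set.Ici (0 : ℝ), HasDerivAt (fun N : ℝ => expLogRem (w + N))
      (Complex.exp (Complex.I * (w + t)) / (Complex.I * (w + t) ^ 2)) t := by
    intro t ht
    have := (hasDerivAt_expLogRem (add_ofReal_mem_slitPlane hmem ht)).comp_const_add w t
    exact this.comp_ofReal
  have hlim : Tendsto (fun N : ℝ => expLogRem (w + N)) atTop (𝓝 expLogLim) := by
    simpa [expLogRem] using (tendsto_expLog_add w).sub (tendsto_exp_div_atTop w)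
  have h := integral_Ioi_of_hasDerivAt_of_tendsto' hderiv hint.integrableOn hlim
  have h2 : ‖∫ t in Set.Ioi (0 : ℝ),
      Complex.exp (Complex.I * (w + t)) / (Complex.I * (w + t) ^ 2)‖ ≤
      Real.exp (-w.im) * Real.pi := by
    refine (norm_integral_le_integral_norm _).trans ?_
    refine (setIntegral_le_integral hint.norm (Eventually.of_forall fun _ => norm_nonneg _)).trans ?_
    refine (integral_mono hint.norm (hcauchy.const_mul _) hb).trans ?_
    rw [integral_const_mul, integral_add_right_eq_self (fun t : ℝ => (1 + t ^ 2)⁻¹),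
      integral_univ_inv_one_add_sq]
  rw [h] at h2
  have h3 : expLogLim - expLog w = (expLogLim - expLogRem (w + (0 : ℝ))) -
      Complex.exp (Complex.I * w) / (Complex.I * w) := by
    simp only [expLogRem, Complex.ofReal_zero, add_zero]; ring
  have h4 : ‖Complex.exp (Complex.I * w) / (Complex.I * w)‖ ≤ Real.exp (-w.im) := by
    rw [norm_div, norm_exp_I_mul, norm_mul, Complex.norm_I, one_mul]
    exact div_le_self (Real.exp_pos _).le (hw.trans (Complex.abs_im_le_norm w))
  rw [h3]
  refine (norm_sub_le _ _).trans ((add_le_add h2 h4).trans ?_)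
  nlinarith [Real.pi_lt_four, Real.exp_pos (-w.im)]

/-- A point close to the real axis, possibly next to the cut, is first moved vertically by one unit
away from the axis. The path stays in the slit plane and in $\|v\|\ge1$, so the move costs at most
$e\cdot e^{-\operatorname{Im}w}$ and leads to the region $|\operatorname{Im}|\ge1$. -/
lemma norm_expLogLim_sub_expLog_le {w : ℂ} (hw : w ∈ Complex.slitPlane) (h1 : 1 ≤ ‖w‖) :
    ‖expLogLim - expLog w‖ ≤ 6 * Real.exp 1 * Real.exp (-w.im) := by
  obtain ⟨σ, hσ, hσw⟩ : ∃ σ : ℝ, |σ| = 1 ∧ 0 ≤ σ * w.im := by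
    rcases le_total 0 w.im with h | h
    · exact ⟨1, by simp, by simpa⟩
    · exact ⟨-1, by simp, by linarith⟩
  have hσ2 : σ * σ = 1 := by rw [← abs_mul_abs_self, hσ, one_mul]
  have habs : ∀ θ : ℝ, 0 ≤ θ → |w.im + θ * σ| = |w.im| + θ := by
    intro θ hθ
    have e : w.im + θ * σ = σ * (σ * w.im + θ) := by linear_combination (-w.im) * hσ2
    rw [e, abs_mul, hσ, one_mul, abs_of_nonneg (by positivity)]
    have : σ * w.im = |w.im| := by
      rw [← abs_of_nonneg hσw, abs_mul, hσ, one_mul]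
    rw [this]
  have hfar := norm_expLogLim_sub_expLog_le_of_one_le_abs_im (w := w + σ * Complex.I) (by
    have := habs 1 zero_le_one
    simp only [one_mul] at this
    simp [this])
  have hseg := norm_expLog_sub_le (a := w) (b := w + σ * Complex.I)
      (M := Real.exp 1 * Real.exp (-w.im)) (by
    intro v hv
    rw [segment_eq_image'] at hv
    obtain ⟨θ, ⟨h0, h1'⟩, rfl⟩ := hv
    have e : w + θ • (w + σ * Complex.I - w) = w + (θ * σ : ℝ) * Complex.I := by
      simp [Complex.real_smul]; ring
    simp only [e]
    have hre : (w + (θ * σ : ℝ) * Complex.I).re = w.re := by simp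
    have him : (w + (θ * σ : ℝ) * Complex.I).im = w.im + θ * σ := by simp
    have hab := habs θ h0
    constructor
    · rw [Complex.mem_slitPlane_iff] at hw ⊢
      rw [hre, him]
      rcases hw with h | h
      · exact Or.inl h
      · right
        rw [← abs_pos, hab]
        have := abs_pos.2 h
        linarith
    · have hn : ‖w‖ ≤ ‖w + (θ * σ : ℝ) * Complex.I‖ := by
        rw [← sq_le_sq₀ (norm_nonneg _) (norm_nonneg _), Complex.sq_norm, Complex.sq_norm,
          Complex.normSq_apply, Complex.normSq_apply, hre, him, ← abs_mul_abs_self w.im,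
          ← abs_mul_abs_self (w.im + θ * σ), hab]
        nlinarith [abs_nonneg w.im]
      rw [norm_div, norm_exp_I_mul, him]
      refine (div_le_self (Real.exp_pos _).le (h1.trans hn)).trans ?_
      rw [← Real.exp_add]
      refine Real.exp_le_exp.2 ?_
      have : |θ * σ| ≤ 1 := by rw [abs_mul, hσ, mul_one, abs_of_nonneg h0]; exact h1'
      linarith [abs_le.1 this])
  have hn1 : ‖w + σ * Complex.I - w‖ = 1 := by
    rw [add_sub_cancel_left, norm_mul, Complex.norm_I, Complex.norm_real, Real.norm_eq_abs, hσ,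
      mul_one]
  rw [hn1, mul_one] at hseg
  have hexp : Real.exp (-(w + σ * Complex.I).im) ≤ Real.exp 1 * Real.exp (-w.im) := by
    rw [← Real.exp_add]
    refine Real.exp_le_exp.2 ?_
    have h := (abs_le.1 hσ.le).1
    simp
    linarith
  calc ‖expLogLim - expLog w‖
      = ‖(expLogLim - expLog (w + σ * Complex.I)) + (expLog (w + σ * Complex.I) - expLog w)‖ := by
        congr 1; ring
    _ ≤ _ := norm_add_le _ _
    _ ≤ 5 * (Real.exp 1 * Real.exp (-w.im)) + Real.exp 1 * Real.exp (-w.im) := by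
        gcongr
        exact hfar.trans (by gcongr)
    _ = _ := by ring

lemma norm_log_le (w : ℂ) : ‖Complex.log w‖ ≤ |Real.log ‖w‖| + Real.pi := by
  have h := Complex.norm_le_abs_re_add_abs_im (Complex.log w)
  rw [Complex.log_re, Complex.log_im] at h
  linarith [Complex.abs_arg_le_pi w]

/-- The difference between `∫_0^∞ e^{iξ} / (ξ + w) dξ` and its logarithmic singularity at `0`. -/
noncomputable def expLogDefect (w : ℂ) : ℂ :=
  Complex.exp (-(Complex.I * w)) * (expLogLim - expLog w) + Complex.log w - expLogLim

/-- For small $w$ the logarithms cancel up to $O(|w|(1+|\log|w||))$. For large $w$ the factors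
$e^{\pm\operatorname{Im}w}$ cancel and only a logarithm remains. Both are dominated by $|w|^\eta$,
uniformly up to the cut. -/
lemma norm_expLogDefect_le {η : ℝ} (h0 : 0 < η) (h1 : η < 1) :
    ∃ C : ℝ, 0 < C ∧ ∀ w ∈ Complex.slitPlane, ‖expLogDefect w‖ ≤ C * ‖w‖ ^ η := by
  set c := ‖expLogLim‖ with hc
  have hc0 : 0 ≤ c := norm_nonneg _
  set e := Real.exp 1 with he
  have he0 : 0 < e := Real.exp_pos 1
  have h1' : 0 < 1 - η := by linarith
  -- The first bracket serves $\|w\|\le1$, the second $\|w\|\ge1$.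
  refine ⟨(e * (c + Real.pi) + e * (1 / (1 - η)) + e * e) + (6 * e + 1 / η + Real.pi + c),
    by positivity, fun w hw => ?_⟩
  set t := ‖w‖ with ht
  have hw0 : w ≠ 0 := Complex.slitPlane_ne_zero hw
  have ht0 : 0 < t := norm_pos_iff.2 hw0
  have htη : 0 < t ^ η := Real.rpow_pos_of_pos ht0 _
  have hlog := norm_log_le w
  have hexpn : ‖Complex.exp (-(Complex.I * w))‖ = Real.exp w.im := by simp [Complex.norm_exp]
  rcases le_total t 1 with h | h
  · have hsub : ‖Complex.exp (-(Complex.I * w)) - 1‖ ≤ t * e := by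
      have := norm_exp_I_mul_sub_one_le (-w)
      rw [norm_neg, mul_neg] at this
      refine this.trans ?_
      have : Real.exp ‖w‖ ≤ e := Real.exp_le_exp.2 h
      gcongr
    have hein : ‖einInt w‖ ≤ t * e := by
      refine (norm_einInt_le w).trans ?_
      have : Real.exp ‖w‖ ≤ e := Real.exp_le_exp.2 h
      gcongr
    have hexp : ‖Complex.exp (-(Complex.I * w))‖ ≤ e := by
      rw [hexpn]
      exact Real.exp_le_exp.2 ((Complex.im_le_norm w).trans h)
    have htt : t ≤ t ^ η := by
      simpa using Real.rpow_le_rpow_of_exponent_ge ht0 h h1.le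
    have htl : t * |Real.log t| ≤ t ^ η * (1 / (1 - η)) := by
      have h2 := (Real.abs_log_mul_self_rpow_lt t (1 - η) ht0 h h1').le
      rw [abs_mul, abs_of_pos (Real.rpow_pos_of_pos ht0 _)] at h2
      have h3 : t = t ^ η * t ^ (1 - η) := by
        rw [← Real.rpow_add ht0]; simp
      calc t * |Real.log t| = t ^ η * (|Real.log t| * t ^ (1 - η)) := by
            nth_rewrite 1 [h3]; ring
        _ ≤ _ := by gcongr
    -- Each of the two products has a factor vanishing to first order at $w=0$.
    have e1 : expLogDefect w = (Complex.exp (-(Complex.I * w)) - 1) * (expLogLim - Complex.log w)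
        - Complex.exp (-(Complex.I * w)) * einInt w := by
      simp only [expLogDefect, expLog]; ring
    rw [e1]
    calc _ ≤ _ := norm_sub_le _ _
      _ ≤ (t * e) * (c + (|Real.log t| + Real.pi)) + e * (t * e) := by
        rw [norm_mul, norm_mul]
        have : ‖expLogLim - Complex.log w‖ ≤ c + (|Real.log t| + Real.pi) :=
          (norm_sub_le _ _).trans (by gcongr)
        gcongr
      _ = t * (e * (c + Real.pi) + e * e) + e * (t * |Real.log t|) := by ring
      _ ≤ t ^ η * (e * (c + Real.pi) + e * e) + e * (t ^ η * (1 / (1 - η))) := by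
        have := Real.pi_pos
        gcongr
      _ = (e * (c + Real.pi) + e * (1 / (1 - η)) + e * e) * t ^ η := by ring
      _ ≤ _ := by
        refine mul_le_mul_of_nonneg_right ?_ htη.le
        have : 0 ≤ 6 * e + 1 / η + Real.pi + c := by positivity
        linarith
  · have hbig := norm_expLogLim_sub_expLog_le hw h
    have h2 : ‖Complex.exp (-(Complex.I * w)) * (expLogLim - expLog w)‖ ≤ 6 * e := by
      rw [norm_mul, hexpn]
      calc _ ≤ Real.exp w.im * (6 * Real.exp 1 * Real.exp (-w.im)) := by gcongr
        _ = 6 * e * (Real.exp w.im * Real.exp (-w.im)) := by ring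
        _ = 6 * e := by rw [← Real.exp_add]; simp
    have h3 : |Real.log t| ≤ t ^ η / η := by
      rw [abs_of_nonneg (Real.log_nonneg h)]
      exact Real.log_le_rpow_div ht0.le h0
    have h4 : 1 ≤ t ^ η := Real.one_le_rpow h h0.le
    calc _ ≤ _ := norm_sub_le _ _
      _ ≤ (6 * e + (t ^ η / η + Real.pi)) + c := by
        gcongr
        exact (norm_add_le _ _).trans (add_le_add h2 (hlog.trans (by gcongr)))
      _ = t ^ η * (1 / η) + 1 * (6 * e + Real.pi + c) := by ring
      _ ≤ t ^ η * (1 / η) + t ^ η * (6 * e + Real.pi + c) := by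
        have := Real.pi_pos
        gcongr
      _ = (6 * e + 1 / η + Real.pi + c) * t ^ η := by ring
      _ ≤ _ := by
        refine mul_le_mul_of_nonneg_right ?_ htη.le
        have := Real.pi_pos
        have : 0 ≤ e * (c + Real.pi) + e * (1 / (1 - η)) + e * e := by positivity
        linarith

/-! ### Explicit formulas for the kernel and the logarithmic term off the cut -/

/-- `∫_0^∞ e^{ixξ} / (ξ - k) dξ` for `x > 0`. -/
noncomputable def halfKernel (k : ℂ) (x : ℝ) : ℂ :=
  Complex.exp (Complex.I * (x * k)) * (expLogLim - expLog (-(x * k)))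

/-- `∫_0^∞ e^{ixξ} / (ξ - k) dξ` for `x ≠ 0`. -/
noncomputable def fullKernel (k : ℂ) (x : ℝ) : ℂ :=
  if 0 < x then halfKernel k x
  else (starRingEnd ℂ) (halfKernel ((starRingEnd ℂ) k) (-x))

lemma neg_mem_slitPlane {k : ℂ} (hk : ∀ t : ℝ, 0 ≤ t → k ≠ (t : ℂ)) :
    -k ∈ Complex.slitPlane := by
  rw [Complex.mem_slitPlane_iff, Complex.neg_re, Complex.neg_im]
  by_contra! h
  exact hk k.re (by linarith) (Complex.ext (by simp) (by simpa using h.2))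

lemma neg_ofReal_mul_mem_slitPlane {k : ℂ} (hk : -k ∈ Complex.slitPlane) {x : ℝ} (hx : 0 < x) :
    -((x : ℂ) * k) ∈ Complex.slitPlane := by
  rw [Complex.mem_slitPlane_iff] at hk ⊢
  simp only [Complex.neg_re, Complex.neg_im, Complex.re_ofReal_mul, Complex.im_ofReal_mul] at hk ⊢
  rcases hk with h | h
  · left; nlinarith
  · right; simpa [hx.ne'] using h

lemma conj_ne_ofReal {k : ℂ} (hk : ∀ t : ℝ, 0 ≤ t → k ≠ (t : ℂ)) :
    ∀ t : ℝ, 0 ≤ t → (starRingEnd ℂ) k ≠ (t : ℂ) := by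
  intro t ht h
  exact hk t ht (by rw [← Complex.conj_conj k, h, Complex.conj_ofReal])

lemma continuousOn_kernelIntegrand {k : ℂ} (hk : ∀ t : ℝ, 0 ≤ t → k ≠ (t : ℂ)) (x : ℝ) :
    ContinuousOn (kernelIntegrand k x) (Set.Ici 0) := by
  unfold kernelIntegrand
  refine ContinuousOn.div (by fun_prop) (by fun_prop) fun ξ hξ => ?_
  exact sub_ne_zero.2 (hk ξ hξ).symm

lemma intervalIntegrable_kernelIntegrand {k : ℂ} (hk : ∀ t : ℝ, 0 ≤ t → k ≠ (t : ℂ)) (x : ℝ)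
    {N : ℝ} (hN : 0 ≤ N) : IntervalIntegrable (kernelIntegrand k x) volume 0 N :=
  ((continuousOn_kernelIntegrand hk x).mono (by
    rw [Set.uIcc_of_le hN]; exact Set.Icc_subset_Ici_self)).intervalIntegrable

/-- The substitution $w=x(\xi-k)$ makes $e^{ixk}\,$`expLog`$(x(\xi-k))$ a primitive of the
integrand. The ray starting at $-xk$ never meets the cut. -/
lemma tendsto_integral_kernelIntegrand_of_pos {k : ℂ} (hk : ∀ t : ℝ, 0 ≤ t → k ≠ (t : ℂ))
    {x : ℝ} (hx : 0 < x) :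
    Tendsto (fun N : ℝ => ∫ ξ in (0 : ℝ)..N, kernelIntegrand k x ξ) atTop
      (𝓝 (halfKernel k x)) := by
  have hmem := neg_ofReal_mul_mem_slitPlane (neg_mem_slitPlane hk) hx
  have hFTC : ∀ N : ℝ, 0 ≤ N → ∫ ξ in (0 : ℝ)..N, kernelIntegrand k x ξ =
      Complex.exp (Complex.I * (x * k)) * (expLog (-(x * k) + (x * N : ℝ)) - expLog (-(x * k))) := by
    intro N hN
    have hd : ∀ ξ ∈ Set.uIcc 0 N, HasDerivAt (fun ξ : ℝ =>
        Complex.exp (Complex.I * (x * k)) * expLog (-(x * k) + (x * ξ : ℝ)))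
        (kernelIntegrand k x ξ) ξ := by
      intro ξ hξ
      rw [Set.uIcc_of_le hN] at hξ
      have hw := add_ofReal_mem_slitPlane hmem (mul_nonneg hx.le hξ.1)
      have h1 : HasDerivAt (fun ξ : ℝ => -(x * k) + ((x * ξ : ℝ) : ℂ)) (x : ℂ) ξ := by
        have := ((hasDerivAt_id ξ).const_mul x).ofReal_comp
        simpa using this.const_add (-(x * k))
      have h2 := (((hasDerivAt_expLog hw).comp ξ h1).const_mul
        (Complex.exp (Complex.I * (x * k))))
      refine h2.congr_deriv ?_
      have h0 := Complex.slitPlane_ne_zero hw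
      have hx0 : (x : ℂ) ≠ 0 := by exact_mod_cast hx.ne'
      have hξk : (ξ : ℂ) - k ≠ 0 := sub_ne_zero.2 (hk ξ hξ.1).symm
      have e1 : -(x * k) + ((x * ξ : ℝ) : ℂ) = x * (ξ - k) := by push_cast; ring
      rw [kernelIntegrand, e1, div_mul_eq_mul_div, ← mul_div_assoc, ← mul_assoc,
        ← Complex.exp_add, mul_comm (Complex.exp _) (x : ℂ), mul_div_mul_left _ _ hx0]
      congr 2
      ring
    rw [intervalIntegral.integral_eq_sub_of_hasDerivAt hd
      (intervalIntegrable_kernelIntegrand hk x hN)]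
    simp [mul_sub]
  have hlim : Tendsto (fun N : ℝ => expLog (-(x * k) + (x * N : ℝ))) atTop (𝓝 expLogLim) :=
    (tendsto_expLog_add (-(x * k))).comp (tendsto_id.const_mul_atTop hx)
  refine Tendsto.congr' ?_ ((hlim.sub_const (expLog (-(x * k)))).const_mul _)
  filter_upwards [eventually_ge_atTop 0] with N hN
  exact (hFTC N hN).symm

lemma tendsto_integral_kernelIntegrand {k : ℂ} (hk : ∀ t : ℝ, 0 ≤ t → k ≠ (t : ℂ))
    {x : ℝ} (hx : x ≠ 0) :
    Tendsto (fun N : ℝ => ∫ ξ in (0 : ℝ)..N, kernelIntegrand k x ξ) atTop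
      (𝓝 (fullKernel k x)) := by
  rcases lt_or_gt_of_ne hx with h | h
  · rw [fullKernel, if_neg h.le.not_gt]
    have h1 := tendsto_integral_kernelIntegrand_of_pos (conj_ne_ofReal hk) (neg_pos.2 h)
    have h2 := (Complex.continuous_conj.tendsto _).comp h1
    refine h2.congr fun N => ?_
    rw [Function.comp, ← intervalIntegral.intervalIntegral_conj]
    congr 1
    ext ξ
    simp [kernelIntegrand, ← Complex.exp_conj]
  · rw [fullKernel, if_pos h]
    exact tendsto_integral_kernelIntegrand_of_pos hk h

lemma kernel_eq {k : ℂ} (hk : ∀ t : ℝ, 0 ≤ t → k ≠ (t : ℂ)) {x : ℝ} (hx : x ≠ 0) :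
    kernel k x = (1 / (2 * Real.pi) : ℂ) * fullKernel k x := by
  rw [kernel, improperIntegral, (tendsto_integral_kernelIntegrand hk hx).limUnder_eq]

/-- The part of `2π l(k)` that does not see the singularity. -/
noncomputable def logTail (χ : ℝ → ℂ) (k : ℂ) : ℂ := ∫ ξ in (1 : ℝ)..2, χ ξ / ((ξ : ℂ) - k)

lemma integrableOn_cutoff_div {χ : ℝ → ℂ} (hχ : IsCutoff χ) {k : ℂ}
    (hk : ∀ t : ℝ, 0 ≤ t → k ≠ (t : ℂ)) :
    IntegrableOn (fun ξ : ℝ => χ ξ / ((ξ : ℂ) - k)) (Set.Ioi 0) := by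
  have h1 : IntegrableOn (fun ξ : ℝ => χ ξ / ((ξ : ℂ) - k)) (Set.Icc 0 2) := by
    refine ContinuousOn.integrableOn_Icc ?_
    refine ContinuousOn.div (hχ.smooth.continuousOn.mono Set.Icc_subset_Ici_self) (by fun_prop)
      fun ξ hξ => sub_ne_zero.2 (hk ξ hξ.1).symm
  have h2 : IntegrableOn (fun ξ : ℝ => χ ξ / ((ξ : ℂ) - k)) (Set.Ioi 2) := by
    refine integrableOn_zero.congr_fun (fun ξ hξ => ?_) measurableSet_Ioi
    simp [hχ.eq_zero ξ (le_of_lt hξ)]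
  refine (h1.union h2).mono_set fun ξ hξ => ?_
  rcases le_or_gt ξ 2 with h | h
  · exact Or.inl ⟨le_of_lt hξ, h⟩
  · exact Or.inr h

/-- On $[0,1]$ the cutoff is $1$ and $\log(\xi-k)$ is a primitive; the rest of the support lies in
$[1,2]$, away from small $k$. -/
lemma logTerm_eq {χ : ℝ → ℂ} (hχ : IsCutoff χ) {k : ℂ} (hk : ∀ t : ℝ, 0 ≤ t → k ≠ (t : ℂ)) :
    logTerm χ k = (1 / (2 * Real.pi) : ℂ) *
      (Complex.log (1 - k) - Complex.log (-k) + logTail χ k) := by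
  rw [logTerm, logTail]
  congr 1
  have hint := integrableOn_cutoff_div hχ hk
  have hii : ∀ a b : ℝ, 0 ≤ a → a ≤ b →
      IntervalIntegrable (fun ξ : ℝ => χ ξ / ((ξ : ℂ) - k)) volume a b := by
    intro a b ha hab
    rw [intervalIntegrable_iff_integrableOn_Ioc_of_le hab]
    exact hint.mono_set fun ξ hξ => lt_of_le_of_lt ha hξ.1
  have h0 : ∫ ξ in Set.Ioi (0 : ℝ), χ ξ / ((ξ : ℂ) - k) =
      ∫ ξ in (0 : ℝ)..2, χ ξ / ((ξ : ℂ) - k) := by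
    rw [intervalIntegral.integral_of_le zero_le_two]
    refine setIntegral_eq_of_subset_of_forall_sdiff_eq_zero measurableSet_Ioi
      Set.Ioc_subset_Ioi_self fun ξ hξ => ?_
    have : 2 ≤ ξ := by
      by_contra! h
      exact hξ.2 ⟨hξ.1, h.le⟩
    simp [hχ.eq_zero ξ this]
  rw [h0, ← intervalIntegral.integral_add_adjacent_intervals (hii 0 1 le_rfl zero_le_one)
    (hii 1 2 zero_le_one one_le_two)]
  congr 1
  have hd : ∀ ξ ∈ Set.uIcc (0 : ℝ) 1, HasDerivAt (fun ξ : ℝ => Complex.log (-k + ξ))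
      (χ ξ / ((ξ : ℂ) - k)) ξ := by
    intro ξ hξ
    rw [Set.uIcc_of_le zero_le_one] at hξ
    have hw := add_ofReal_mem_slitPlane (neg_mem_slitPlane hk) hξ.1
    have h1 : HasDerivAt (fun ξ : ℝ => -k + (ξ : ℂ)) 1 ξ := by
      simpa using (hasDerivAt_id ξ).ofReal_comp.const_add (-k)
    refine (h1.clog_real hw).congr_deriv ?_
    rw [hχ.eq_one ξ hξ.1 hξ.2]
    congr 1
    ring
  rw [intervalIntegral.integral_eq_sub_of_hasDerivAt hd (hii 0 1 le_rfl zero_le_one)]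
  congr 2 <;> push_cast <;> ring

lemma norm_logTail_sub_le {χ : ℝ → ℂ} (hχ : IsCutoff χ) :
    ∃ B : ℝ, 0 ≤ B ∧ ∀ k k' : ℂ, ‖k‖ ≤ 1 / 2 → ‖k'‖ ≤ 1 / 2 →
      ‖logTail χ k - logTail χ k'‖ ≤ B * ‖k - k'‖ := by
  have hcont : ContinuousOn χ (Set.Icc 1 2) :=
    hχ.smooth.continuousOn.mono fun ξ hξ => le_trans zero_le_one hξ.1
  obtain ⟨B, hB⟩ := isCompact_Icc.exists_bound_of_continuousOn hcont
  have hB0 : 0 ≤ B := (norm_nonneg _).trans (hB 1 ⟨le_rfl, one_le_two⟩)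
  have hlow : ∀ k : ℂ, ‖k‖ ≤ 1 / 2 → ∀ ξ : ℝ, 1 ≤ ξ → 1 / 2 ≤ ‖(ξ : ℂ) - k‖ := by
    intro k hk ξ hξ
    have := norm_sub_norm_le (ξ : ℂ) k
    rw [Complex.norm_real, Real.norm_of_nonneg (by linarith)] at this
    linarith
  have hne : ∀ k : ℂ, ‖k‖ ≤ 1 / 2 → ∀ ξ : ℝ, 1 ≤ ξ → (ξ : ℂ) - k ≠ 0 := by
    intro k hk ξ hξ
    rw [← norm_pos_iff]
    linarith [hlow k hk ξ hξ]
  have hii : ∀ k : ℂ, ‖k‖ ≤ 1 / 2 →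
      IntervalIntegrable (fun ξ : ℝ => χ ξ / ((ξ : ℂ) - k)) volume 1 2 := by
    intro k hk
    refine ContinuousOn.intervalIntegrable ?_
    rw [Set.uIcc_of_le one_le_two]
    exact hcont.div (by fun_prop) fun ξ hξ => hne k hk ξ hξ.1
  -- $4$ is the inverse of the lower bound $\frac12\cdot\frac12$ for the product of the two
  -- denominators.
  refine ⟨4 * B, by positivity, fun k k' hk hk' => ?_⟩
  rw [logTail, logTail, ← intervalIntegral.integral_sub (hii k hk) (hii k' hk')]
  refine (intervalIntegral.norm_integral_le_of_norm_le_const (C := 4 * B * ‖k - k'‖) ?_).trans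
    (by norm_num)
  intro ξ hξ
  rw [Set.uIoc_of_le one_le_two] at hξ
  have e : χ ξ / ((ξ : ℂ) - k) - χ ξ / ((ξ : ℂ) - k') =
      χ ξ * (k - k') / (((ξ : ℂ) - k) * ((ξ : ℂ) - k')) := by
    have h1 := hne k hk ξ hξ.1.le
    have h2 := hne k' hk' ξ hξ.1.le
    field_simp
    ring
  rw [e, norm_div, norm_mul, norm_mul, div_le_iff₀ (mul_pos
    (by linarith [hlow k hk ξ hξ.1.le]) (by linarith [hlow k' hk' ξ hξ.1.le]))]
  have h3 : (1 / 2 : ℝ) * (1 / 2) ≤ ‖(ξ : ℂ) - k‖ * ‖(ξ : ℂ) - k'‖ :=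
    mul_le_mul (hlow k hk ξ hξ.1.le) (hlow k' hk' ξ hξ.1.le) (by norm_num) (norm_nonneg _)
  have h4 : ‖χ ξ‖ * ‖k - k'‖ ≤ B * ‖k - k'‖ := by
    gcongr
    exact hB ξ ⟨hξ.1.le, hξ.2⟩
  have h5 : 0 ≤ B * ‖k - k'‖ := by positivity
  nlinarith

/-! ### The kernel at zero energy -/

/-- `∫_0^∞ (e^{ixξ} - 1_{ξ < 1}) / ξ dξ` for `x ≠ 0`. -/
noncomputable def zeroKernel (x : ℝ) : ℂ :=
  (if 0 < x then expLogLim else (starRingEnd ℂ) expLogLim) - (Real.log x : ℂ)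

lemma measurable_zeroKernel : Measurable zeroKernel := by
  unfold zeroKernel
  refine Measurable.sub (Measurable.ite measurableSet_Ioi measurable_const measurable_const) ?_
  fun_prop

lemma einInt_ofReal_mul (x : ℝ) {N : ℝ} (hN : 0 < N) :
    ∫ ξ in (0 : ℝ)..N, (Complex.exp (Complex.I * x * ξ) - 1) / (ξ : ℂ) = einInt (x * N) := by
  have h := intervalIntegral.smul_integral_comp_mul_left (a := 0) (b := 1)
    (f := fun ξ : ℝ => (Complex.exp (Complex.I * x * ξ) - 1) / (ξ : ℂ)) (c := N)
  rw [mul_zero, mul_one] at h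
  rw [← h, einInt, ← intervalIntegral.integral_smul]
  refine intervalIntegral.integral_congr fun t _ => ?_
  have hN' : (N : ℂ) ≠ 0 := by exact_mod_cast hN.ne'
  simp only [Complex.real_smul, Complex.ofReal_mul]
  rw [← mul_div_assoc, mul_div_mul_left _ _ hN']
  congr 3
  ring

lemma einInt_neg_ofReal (t : ℝ) : einInt (-(t : ℂ)) = (starRingEnd ℂ) (einInt t) := by
  rw [einInt, einInt, ← intervalIntegral.intervalIntegral_conj]
  congr 1
  ext s
  simp [← Complex.exp_conj]

/-- For $x>0$ the expression is `expLog`$(xN)-\log x$; negative $x$ follows by conjugation. -/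
lemma tendsto_einInt_add_log {x : ℝ} (hx : x ≠ 0) :
    Tendsto (fun N : ℝ => einInt (x * N) + (Real.log N : ℂ)) atTop (𝓝 (zeroKernel x)) := by
  have key : ∀ x : ℝ, 0 < x →
      Tendsto (fun N : ℝ => einInt (x * N) + (Real.log N : ℂ)) atTop
        (𝓝 (expLogLim - (Real.log x : ℂ))) := by
    intro x hx
    have h1 : Tendsto (fun N : ℝ => expLog ((x * N : ℝ) : ℂ)) atTop (𝓝 expLogLim) :=
      tendsto_expLog_ofReal.comp (tendsto_id.const_mul_atTop hx)
    refine (h1.sub_const (Real.log x : ℂ)).congr' ?_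
    filter_upwards [eventually_gt_atTop 0] with N hN
    rw [expLog, ← Complex.ofReal_log (mul_pos hx hN).le, Real.log_mul hx.ne' hN.ne']
    push_cast
    ring
  rcases lt_or_gt_of_ne hx with h | h
  · have h1 := (Complex.continuous_conj.tendsto _).comp (key (-x) (neg_pos.2 h))
    rw [zeroKernel, if_neg h.le.not_gt]
    rw [map_sub, Complex.conj_ofReal, Real.log_neg_eq_log] at h1
    refine h1.congr fun N => ?_
    rw [Function.comp, map_add, Complex.conj_ofReal, ← Complex.ofReal_mul, ← einInt_neg_ofReal]
    congr 2
    push_cast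
    ring
  · rw [zeroKernel, if_pos h]
    exact key x h

/-- Uniformity in $N$ makes this a dominating function for the limit $N\to\infty$ under a
convolution. If $xN\ge1$ the tail estimate for `expLog` applies; if $xN\le1$ then $0\le\log
N\le-\log x$. -/
lemma norm_einInt_add_log_le :
    ∃ C : ℝ, 0 < C ∧ ∀ x : ℝ, x ≠ 0 → ∀ N : ℝ, 1 ≤ N →
      ‖einInt (x * N) + (Real.log N : ℂ)‖ ≤ C + |Real.log x| := by
  refine ⟨‖expLogLim‖ + 6 * Real.exp 1, by positivity, fun x hx N hN => ?_⟩
  have hN0 : 0 < N := by linarith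
  have key : ∀ x : ℝ, 0 < x → ‖einInt (x * N) + (Real.log N : ℂ)‖ ≤
      ‖expLogLim‖ + 6 * Real.exp 1 + |Real.log x| := by
    intro x hx
    have hxN := mul_pos hx hN0
    have hnorm : ‖(x : ℂ) * N‖ = x * N := by
      rw [← Complex.ofReal_mul, Complex.norm_real, Real.norm_of_nonneg hxN.le]
    rcases le_total 1 (x * N) with h | h
    · have h1 := norm_expLogLim_sub_expLog_le (w := x * N) (by
        rw [← Complex.ofReal_mul]; exact ofReal_mem_slitPlane_of_pos hxN) (by rwa [hnorm])
      have h2 : einInt (x * N) + (Real.log N : ℂ) =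
          expLogLim - (expLogLim - expLog (x * N)) - (Real.log x : ℂ) := by
        rw [expLog, ← Complex.ofReal_mul, ← Complex.ofReal_log hxN.le,
          Real.log_mul hx.ne' hN0.ne']
        push_cast
        ring
      rw [h2]
      refine (norm_sub_le _ _).trans ?_
      rw [Complex.norm_real, Real.norm_eq_abs]
      gcongr
      refine (norm_sub_le _ _).trans ?_
      gcongr
      simpa using h1
    · refine (norm_add_le _ _).trans ?_
      rw [Complex.norm_real, Real.norm_eq_abs]
      have h3 : |Real.log N| ≤ |Real.log x| := by
        rw [abs_of_nonneg (Real.log_nonneg hN)]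
        have := Real.log_nonpos hxN.le h
        rw [Real.log_mul hx.ne' hN0.ne'] at this
        linarith [neg_le_abs (Real.log x)]
      have h4 : ‖einInt (x * N)‖ ≤ 6 * Real.exp 1 := by
        refine (norm_einInt_le _).trans ?_
        rw [hnorm]
        calc x * N * Real.exp (x * N) ≤ 1 * Real.exp 1 := by gcongr
          _ ≤ _ := by linarith [Real.exp_pos 1]
      linarith [norm_nonneg expLogLim]
  rcases lt_or_gt_of_ne hx with h | h
  · have := key (-x) (neg_pos.2 h)
    rw [Real.log_neg_eq_log] at this
    refine le_of_eq_of_le ?_ this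
    rw [← Complex.norm_conj, map_add, Complex.conj_ofReal, ← Complex.ofReal_mul,
      ← einInt_neg_ofReal]
    congr 3
    push_cast
    ring
  · exact key x h

lemma intervalIntegrable_exp_sub_one_div (x : ℝ) (N : ℝ) :
    IntervalIntegrable (fun ξ : ℝ => (Complex.exp (Complex.I * x * ξ) - 1) / (ξ : ℂ))
      volume 0 N := by
  rw [intervalIntegrable_iff]
  refine Measure.integrableOn_of_bounded (M := |x|) (by simp)
    (measurable_einInt_integrand x).aestronglyMeasurable (Eventually.of_forall fun ξ => ?_)
  rw [norm_div]
  refine div_le_of_le_mul₀ (norm_nonneg _) (abs_nonneg _) ?_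
  have := Real.norm_exp_I_mul_ofReal_sub_one_le (x := x * ξ)
  rw [Complex.ofReal_mul, ← mul_assoc] at this
  simpa [abs_mul] using this

lemma intervalIntegrable_one_sub_cutoff_div {χ : ℝ → ℂ} (hχ : IsCutoff χ) {N : ℝ} (hN : 0 ≤ N) :
    IntervalIntegrable (fun ξ : ℝ => (1 - χ ξ) / (ξ : ℂ)) volume 0 N := by
  have h1 : IntervalIntegrable (fun ξ : ℝ => (1 - χ ξ) / (ξ : ℂ)) volume 0 1 := by
    rw [intervalIntegrable_iff_integrableOn_Ioc_of_le zero_le_one]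
    refine integrableOn_zero.congr_fun (fun ξ hξ => ?_) measurableSet_Ioc
    simp [hχ.eq_one ξ hξ.1.le hξ.2]
  have h2 : IntervalIntegrable (fun ξ : ℝ => (1 - χ ξ) / (ξ : ℂ)) volume 1 (max 1 N) := by
    refine ContinuousOn.intervalIntegrable ?_
    rw [Set.uIcc_of_le (le_max_left _ _)]
    refine ContinuousOn.div (continuousOn_const.sub (hχ.smooth.continuousOn.mono ?_))
      (by fun_prop) ?_
    · exact fun ξ hξ => le_trans zero_le_one hξ.1
    · intro ξ hξ
      have := hξ.1
      exact_mod_cast (by linarith : (0 : ℝ) < ξ).ne'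
  refine (h1.trans h2).mono_set ?_
  rw [Set.uIcc_of_le hN, Set.uIcc_of_le (hN.trans (le_max_right _ _))]
  exact Set.Icc_subset_Icc_right (le_max_right _ _)

lemma kernelZeroIntegrand_eq (χ : ℝ → ℂ) (x ξ : ℝ) : kernelZeroIntegrand χ x ξ =
    (Complex.exp (Complex.I * x * ξ) - 1) / (ξ : ℂ) + (1 - χ ξ) / (ξ : ℂ) := by
  rw [kernelZeroIntegrand, ← add_div]
  congr 1
  ring

lemma integral_kernelZeroIntegrand {χ : ℝ → ℂ} (hχ : IsCutoff χ) (x : ℝ) {N : ℝ} (hN : 2 ≤ N) :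
    ∫ ξ in (0 : ℝ)..N, kernelZeroIntegrand χ x ξ =
      einInt (x * N) + (Real.log N : ℂ) - logTail χ 0 := by
  have hN0 : (0 : ℝ) < N := by linarith
  have hi : ∀ {M : ℝ}, 0 ≤ M → IntervalIntegrable (fun ξ : ℝ => (1 - χ ξ) / (ξ : ℂ)) volume 0 M :=
    fun hM => intervalIntegrable_one_sub_cutoff_div hχ hM
  simp_rw [kernelZeroIntegrand_eq]
  rw [intervalIntegral.integral_add (intervalIntegrable_exp_sub_one_div x N) (hi hN0.le),
    einInt_ofReal_mul x hN0, add_sub_assoc]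
  congr 1
  have hcont : ∀ b : ℝ, 1 ≤ b → IntervalIntegrable (fun ξ : ℝ => χ ξ / (ξ : ℂ)) volume 1 b := by
    intro b hb
    refine ContinuousOn.intervalIntegrable ?_
    rw [Set.uIcc_of_le hb]
    refine ContinuousOn.div (hχ.smooth.continuousOn.mono ?_) (by fun_prop) ?_
    · exact fun ξ hξ => le_trans zero_le_one hξ.1
    · intro ξ hξ
      have := hξ.1
      exact_mod_cast (by linarith : (0 : ℝ) < ξ).ne'
  have hinv : IntervalIntegrable (fun ξ : ℝ => (1 : ℂ) / (ξ : ℂ)) volume 1 N := by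
    refine ContinuousOn.intervalIntegrable ?_
    rw [Set.uIcc_of_le (by linarith)]
    refine ContinuousOn.div (by fun_prop) (by fun_prop) fun ξ hξ => ?_
    have := hξ.1
    exact_mod_cast (by linarith : (0 : ℝ) < ξ).ne'
  have h01 : ∫ ξ in (0 : ℝ)..1, (1 - χ ξ) / (ξ : ℂ) = 0 := by
    refine intervalIntegral.integral_zero_ae (Eventually.of_forall fun ξ hξ => ?_)
    rw [Set.uIoc_of_le zero_le_one] at hξ
    simp [hχ.eq_one ξ hξ.1.le hξ.2]
  have h2N : ∫ ξ in (2 : ℝ)..N, χ ξ / (ξ : ℂ) = 0 := by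
    refine intervalIntegral.integral_zero_ae (Eventually.of_forall fun ξ hξ => ?_)
    rw [Set.uIoc_of_le hN] at hξ
    simp [hχ.eq_zero ξ hξ.1.le]
  have hlogN : ∫ ξ in (1 : ℝ)..N, (1 : ℂ) / (ξ : ℂ) = (Real.log N : ℂ) := by
    have := integral_one_div_of_pos one_pos hN0
    rw [div_one] at this
    rw [← this, ← intervalIntegral.integral_ofReal]
    simp
  have h2N' : IntervalIntegrable (fun ξ : ℝ => χ ξ / (ξ : ℂ)) volume 2 N :=
    (hcont N (by linarith)).mono_set (by
      rw [Set.uIcc_of_le hN, Set.uIcc_of_le (by linarith)]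
      exact Set.Icc_subset_Icc_left one_le_two)
  rw [← intervalIntegral.integral_add_adjacent_intervals (hi zero_le_one)
    ((hi zero_le_one).symm.trans (hi hN0.le)), h01, zero_add]
  simp_rw [sub_div]
  rw [intervalIntegral.integral_sub hinv (hcont N (by linarith)), hlogN,
    ← intervalIntegral.integral_add_adjacent_intervals (hcont 2 one_le_two) h2N', h2N, add_zero]
  simp [logTail]

lemma tendsto_integral_kernelZeroIntegrand {χ : ℝ → ℂ} (hχ : IsCutoff χ) {x : ℝ} (hx : x ≠ 0) :
    Tendsto (fun N : ℝ => ∫ ξ in (0 : ℝ)..N, kernelZeroIntegrand χ x ξ) atTop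
      (𝓝 (zeroKernel x - logTail χ 0)) := by
  refine ((tendsto_einInt_add_log hx).sub_const (logTail χ 0)).congr' ?_
  filter_upwards [eventually_ge_atTop 2] with N hN
  exact (integral_kernelZeroIntegrand hχ x hN).symm

lemma modKernel_zero_eq {χ : ℝ → ℂ} (hχ : IsCutoff χ) {x : ℝ} (hx : x ≠ 0) :
    modKernel χ .zero x = (1 / (2 * Real.pi) : ℂ) * (zeroKernel x - logTail χ 0) := by
  rw [modKernel, improperIntegral, (tendsto_integral_kernelZeroIntegrand hχ hx).limUnder_eq]

lemma modKernelConverges_zero {χ : ℝ → ℂ} (hχ : IsCutoff χ) {x : ℝ} (hx : x ≠ 0) :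
    ModKernelConverges χ .zero x := by
  refine ⟨fun N hN => ?_, _, tendsto_integral_kernelZeroIntegrand hχ hx⟩
  refine ((intervalIntegrable_exp_sub_one_div x N).add
    (intervalIntegrable_one_sub_cutoff_div hχ hN)).congr fun ξ _ => ?_
  exact (kernelZeroIntegrand_eq χ x ξ).symm

lemma offConverges {χ : ℝ → ℂ} (hχ : IsCutoff χ) {k : ℂ} (hk : ∀ t : ℝ, 0 ≤ t → k ≠ (t : ℂ))
    {x : ℝ} (hx : x ≠ 0) : OffConverges χ k x :=
  ⟨⟨fun _ hN => intervalIntegrable_kernelIntegrand hk x hN, _,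
    tendsto_integral_kernelIntegrand hk hx⟩, integrableOn_cutoff_div hχ hk⟩

/-- This is the renormalisation: $\log(-xk)=\log x+\log(-k)$ for $x>0$, the term $\log(-k)$ cancels
against $l(k)$, and `expLogLim` $-\log x$ cancels against the kernel at zero. -/
lemma modKernel_off_sub_zero {χ : ℝ → ℂ} (hχ : IsCutoff χ) {k : ℂ}
    (hk : ∀ t : ℝ, 0 ≤ t → k ≠ (t : ℂ)) {x : ℝ} (hx : x ≠ 0) :
    modKernel χ (.off k hk) x - modKernel χ .zero x = (1 / (2 * Real.pi) : ℂ) *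
      ((if 0 < x then expLogDefect (-(x * k)) else
        (starRingEnd ℂ) (expLogDefect (-((-x : ℝ) * (starRingEnd ℂ) k)))) -
        Complex.log (1 - k) - (logTail χ k - logTail χ 0)) := by
  rw [modKernel_zero_eq hχ hx, modKernel, kernel_eq hk hx, logTerm_eq hχ hk, ← mul_sub, ← mul_sub]
  congr 1
  have hk0 : -k ≠ 0 := Complex.slitPlane_ne_zero (neg_mem_slitPlane hk)
  have key : ∀ (k : ℂ) (x : ℝ), -k ≠ 0 → 0 < x → halfKernel k x =
      expLogDefect (-(x * k)) - Real.log x - Complex.log (-k) + expLogLim := by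
    intro k x hk0 hx
    have hl : Complex.log (-(x * k)) = Real.log x + Complex.log (-k) := by
      rw [← mul_neg, Complex.log_ofReal_mul hx hk0]
    rw [expLogDefect, hl, halfKernel]
    ring_nf
  rcases lt_or_gt_of_ne hx with h | h
  · have h1 := key ((starRingEnd ℂ) k) (-x) (by simpa using hk0) (neg_pos.2 h)
    have hconj : (starRingEnd ℂ) (Complex.log (-(starRingEnd ℂ) k)) = Complex.log (-k) := by
      rw [← map_neg, ← Complex.log_conj _ (by
        rw [map_neg]
        exact (Complex.slitPlane_arg_ne_pi (neg_mem_slitPlane (conj_ne_ofReal hk)))),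
        Complex.conj_conj]
    rw [fullKernel, zeroKernel, if_neg h.le.not_gt, if_neg h.le.not_gt, if_neg h.le.not_gt, h1]
    simp only [map_add, map_sub, hconj, Complex.conj_ofReal, Real.log_neg_eq_log]
    ring
  · rw [fullKernel, zeroKernel, if_pos h, if_pos h, if_pos h, key k x hk0 h]
    ring

/-! ### Hölder bounds for the kernels near zero energy -/

/-- The size of the singular kernels: `|x|^η + |x|^{-η}`. -/
noncomputable def powSum (η x : ℝ) : ℝ := |x| ^ η + |x| ^ (-η)

lemma measurable_powSum (η : ℝ) : Measurable (powSum η) := by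
  unfold powSum; fun_prop

lemma powSum_nonneg (η x : ℝ) : 0 ≤ powSum η x := by unfold powSum; positivity

lemma one_le_powSum {η x : ℝ} (hη : 0 ≤ η) (hx : x ≠ 0) : 1 ≤ powSum η x := by
  have hx0 := abs_pos.2 hx
  rcases le_total 1 |x| with h | h
  · have := Real.one_le_rpow h hη
    have := Real.rpow_nonneg hx0.le (-η)
    unfold powSum; linarith
  · have := Real.one_le_rpow_of_pos_of_le_one_of_nonpos hx0 h (neg_nonpos.2 hη)
    have := Real.rpow_nonneg hx0.le η
    unfold powSum; linarith

lemma abs_log_le_powSum {η x : ℝ} (hη : 0 < η) (hx : x ≠ 0) :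
    |Real.log x| ≤ powSum η x / η := by
  have hx0 := abs_pos.2 hx
  have h1 := Real.log_le_rpow_div hx0.le hη
  have h2 := Real.log_le_rpow_div (inv_pos.2 hx0).le hη
  rw [Real.inv_rpow hx0.le, ← Real.rpow_neg hx0.le, Real.log_inv] at h2
  rw [← Real.log_abs]
  have := Real.rpow_nonneg hx0.le (-η)
  have := Real.rpow_nonneg hx0.le η
  rw [powSum, add_div, abs_le]
  have : 0 ≤ |x| ^ (-η) / η := by positivity
  have : 0 ≤ |x| ^ η / η := by positivity
  constructor <;> linarith

lemma norm_modKernel_off_sub_zero_le {χ : ℝ → ℂ} (hχ : IsCutoff χ) {η : ℝ} (h0 : 0 < η)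
    (h1 : η < 1) : ∃ C : ℝ, 0 < C ∧ ∀ (k : ℂ) (hk : ∀ t : ℝ, 0 ≤ t → k ≠ (t : ℂ)),
      ‖k‖ ≤ 1 / 2 → ∀ x : ℝ, x ≠ 0 →
        ‖modKernel χ (.off k hk) x - modKernel χ .zero x‖ ≤ C * ‖k‖ ^ η * powSum η x := by
  obtain ⟨C, hC, hdef⟩ := norm_expLogDefect_le h0 h1
  obtain ⟨B, hB, htail⟩ := norm_logTail_sub_le hχ
  -- The three contributions are the defect, $\log(1-k)$ with $|\log(1-k)|\le\frac32|k|$ for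
  -- $|k|\le\frac12$, and the Lipschitz tail.
  refine ⟨C + 3 / 2 + B, by positivity, fun k hk hk2 x hx => ?_⟩
  rw [modKernel_off_sub_zero hχ hk hx, norm_mul]
  have hpi : ‖(1 / (2 * Real.pi) : ℂ)‖ ≤ 1 := by
    rw [norm_div, norm_mul, Complex.norm_real, Real.norm_of_nonneg Real.pi_pos.le]
    simp only [norm_one, Complex.norm_ofNat]
    rw [div_le_one (by positivity)]
    linarith [Real.pi_gt_three]
  have hps := one_le_powSum h0.le hx
  have hkη : ‖k‖ ≤ ‖k‖ ^ η := by
    rcases (norm_nonneg k).eq_or_lt with h | h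
    · rw [← h]; positivity
    · simpa using Real.rpow_le_rpow_of_exponent_ge h (by linarith) h1.le
  have hlog : ‖Complex.log (1 - k)‖ ≤ 3 / 2 * ‖k‖ := by
    have := Complex.norm_log_one_add_half_le_self (z := -k) (by simpa using hk2)
    simpa [sub_eq_add_neg] using this
  have hd : ‖(if 0 < x then expLogDefect (-(x * k)) else
        (starRingEnd ℂ) (expLogDefect (-((-x : ℝ) * (starRingEnd ℂ) k))))‖ ≤
        C * (‖k‖ ^ η * |x| ^ η) := by
    rw [← Real.mul_rpow (norm_nonneg _) (abs_nonneg _)]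
    rcases lt_or_gt_of_ne hx with h | h
    · rw [if_neg h.le.not_gt, Complex.norm_conj]
      refine (hdef _ (neg_ofReal_mul_mem_slitPlane
        (neg_mem_slitPlane (conj_ne_ofReal hk)) (neg_pos.2 h))).trans (le_of_eq ?_)
      rw [norm_neg, norm_mul, Complex.norm_conj, Complex.norm_real, norm_neg, Real.norm_eq_abs,
        mul_comm |x|]
    · rw [if_pos h]
      refine (hdef _ (neg_ofReal_mul_mem_slitPlane
        (neg_mem_slitPlane hk) h)).trans (le_of_eq ?_)
      rw [norm_neg, norm_mul, Complex.norm_real, Real.norm_eq_abs, mul_comm |x|]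
  have ht := htail k 0 hk2 (by simp)
  rw [sub_zero] at ht
  have hxη : |x| ^ η ≤ powSum η x := by
    have := Real.rpow_nonneg (abs_nonneg x) (-η)
    unfold powSum; linarith
  have hkη0 : 0 ≤ ‖k‖ ^ η := by positivity
  have hkps : ‖k‖ ≤ ‖k‖ ^ η * powSum η x := hkη.trans (le_mul_of_one_le_right hkη0 hps)
  refine (mul_le_of_le_one_left (norm_nonneg _) hpi).trans ?_
  calc _ ≤ C * (‖k‖ ^ η * |x| ^ η) + 3 / 2 * ‖k‖ + B * ‖k‖ :=
        (norm_sub_le _ _).trans (add_le_add ((norm_sub_le _ _).trans (add_le_add hd hlog)) ht)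
    _ ≤ C * (‖k‖ ^ η * powSum η x) + 3 / 2 * (‖k‖ ^ η * powSum η x) +
        B * (‖k‖ ^ η * powSum η x) := by gcongr
    _ = _ := by ring

lemma norm_modKernel_zero_le {χ : ℝ → ℂ} (hχ : IsCutoff χ) {η : ℝ} (h0 : 0 < η) :
    ∃ C : ℝ, 0 < C ∧ ∀ x : ℝ, x ≠ 0 → ‖modKernel χ .zero x‖ ≤ C * powSum η x := by
  refine ⟨‖(1 / (2 * Real.pi) : ℂ)‖ * (‖expLogLim‖ + 1 / η + ‖logTail χ 0‖), ?_, fun x hx => ?_⟩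
  · have : (1 / (2 * Real.pi) : ℂ) ≠ 0 := by simp [Real.pi_ne_zero]
    positivity
  rw [modKernel_zero_eq hχ hx, norm_mul, mul_assoc]
  gcongr
  have hps := one_le_powSum h0.le hx
  have hlog := abs_log_le_powSum h0 hx
  have hz : ‖zeroKernel x‖ ≤ ‖expLogLim‖ + powSum η x / η := by
    rw [zeroKernel]
    refine (norm_sub_le _ _).trans ?_
    rw [Complex.norm_real, Real.norm_eq_abs]
    refine add_le_add (le_of_eq ?_) hlog
    split_ifs <;> simp
  calc _ ≤ _ := norm_sub_le _ _
    _ ≤ ‖expLogLim‖ * 1 + powSum η x / η + ‖logTail χ 0‖ * 1 := by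
      rw [mul_one, mul_one]; gcongr
    _ ≤ ‖expLogLim‖ * powSum η x + powSum η x / η + ‖logTail χ 0‖ * powSum η x := by gcongr
    _ = _ := by ring

/-! ### Boundary values on the two sides of the cut, and measurability -/

lemma Side.sign_ne_zero (σ : Side) : σ.sign ≠ 0 := by cases σ <;> simp [Side.sign]

/-- The other side of the cut. -/
def Side.flip : Side → Side
  | .above => .below
  | .below => .above

lemma approach_ne_ofReal (σ : Side) (lam : ℝ) {ε : ℝ} (hε : 0 < ε) :
    ∀ t : ℝ, 0 ≤ t → approach σ lam ε ≠ (t : ℂ) := by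
  intro t _ h
  have := congrArg Complex.im h
  simp [approach, hε.ne', σ.sign_ne_zero] at this

lemma conj_approach (σ : Side) (lam ε : ℝ) :
    (starRingEnd ℂ) (approach σ lam ε) = approach σ.flip lam ε := by
  cases σ <;> simp [approach, Side.flip, Side.sign]

lemma continuous_approach (σ : Side) (lam : ℝ) : Continuous (approach σ lam) := by
  unfold approach; fun_prop

lemma tendsto_approach (σ : Side) (lam : ℝ) :
    Tendsto (approach σ lam) (𝓝[>] 0) (𝓝 (lam : ℂ)) := by
  have := (continuous_approach σ lam).tendsto 0
  simp only [approach, mul_zero, Complex.ofReal_zero, zero_mul, add_zero] at this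
  exact this.mono_left nhdsWithin_le_nhds

/-- $-\lambda$ lies on the branch cut of the logarithm, but each sign approaches it from one fixed
side: $-(\lambda+i\varepsilon)$ from below, $-(\lambda-i\varepsilon)$ from above. -/
lemma exists_tendsto_log_neg_approach (σ : Side) {lam : ℝ} (hlam : 0 < lam) :
    ∃ z : ℂ, Tendsto (fun ε => Complex.log (-approach σ lam ε)) (𝓝[>] 0) (𝓝 z) := by
  have hre : (-(lam : ℂ)).re < 0 := by simpa
  have him : (-(lam : ℂ)).im = 0 := by simp
  have ht := (tendsto_approach σ lam).neg
  cases σ with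
  | above =>
    refine ⟨_, (Complex.tendsto_log_nhdsWithin_im_neg_of_re_neg_of_im_zero hre him).comp
      (tendsto_nhdsWithin_iff.2 ⟨ht, ?_⟩)⟩
    filter_upwards [self_mem_nhdsWithin] with ε hε
    simpa [approach, Side.sign] using hε
  | below =>
    refine ⟨_, (Complex.tendsto_log_nhdsWithin_im_nonneg_of_re_neg_of_im_zero hre him).comp
      (tendsto_nhdsWithin_iff.2 ⟨ht, ?_⟩)⟩
    filter_upwards [self_mem_nhdsWithin] with ε hε
    simpa [approach, Side.sign] using le_of_lt hε

lemma exists_tendsto_halfKernel_approach (σ : Side) {lam : ℝ} (hlam : 0 < lam) {x : ℝ}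
    (hx : 0 < x) :
    ∃ z : ℂ, Tendsto (fun ε => halfKernel (approach σ lam ε) x) (𝓝[>] 0) (𝓝 z) := by
  obtain ⟨z, hz⟩ := exists_tendsto_log_neg_approach σ hlam
  have ht := (tendsto_approach σ lam).const_mul (x : ℂ)
  have hexp := (Complex.continuous_exp.tendsto _).comp (ht.const_mul Complex.I)
  have h0 : -((x : ℂ) * lam) ≠ 0 := by
    rw [neg_ne_zero]; exact_mod_cast (mul_pos hx hlam).ne'
  have hein := (hasDerivAt_einInt h0).continuousAt.tendsto.comp ht.neg
  refine ⟨_, (hexp.mul ((hz.const_add (Real.log x : ℂ)).add hein |>.const_sub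
    expLogLim)).congr' ?_⟩
  filter_upwards [self_mem_nhdsWithin] with ε hε
  have hk0 := Complex.slitPlane_ne_zero (neg_mem_slitPlane (approach_ne_ofReal σ lam hε))
  have hl : Complex.log (-(x * approach σ lam ε)) =
      Real.log x + Complex.log (-approach σ lam ε) := by
    rw [← mul_neg, Complex.log_ofReal_mul hx hk0]
  simp [halfKernel, expLog, hl]

lemma exists_tendsto_kernel_approach (σ : Side) {lam : ℝ} (hlam : 0 < lam) {x : ℝ}
    (hx : x ≠ 0) :
    ∃ z : ℂ, Tendsto (fun ε => kernel (approach σ lam ε) x) (𝓝[>] 0) (𝓝 z) := by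
  obtain ⟨z, hz⟩ : ∃ z : ℂ,
      Tendsto (fun ε => fullKernel (approach σ lam ε) x) (𝓝[>] 0) (𝓝 z) := by
    rcases lt_or_gt_of_ne hx with h | h
    -- The formula for $x<0$ conjugates $k$, which exchanges the two sides of the cut.
    · obtain ⟨z, hz⟩ := exists_tendsto_halfKernel_approach σ.flip hlam (neg_pos.2 h)
      refine ⟨_, ((Complex.continuous_conj.tendsto _).comp hz).congr fun ε => ?_⟩
      rw [fullKernel, if_neg h.le.not_gt, conj_approach]
      rfl
    · simp_rw [fullKernel, if_pos h]
      exact exists_tendsto_halfKernel_approach σ hlam h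
  refine ⟨_, (hz.const_mul (1 / (2 * Real.pi) : ℂ)).congr' ?_⟩
  filter_upwards [self_mem_nhdsWithin] with ε hε
  exact (kernel_eq (approach_ne_ofReal σ lam hε) hx).symm

lemma eventually_norm_approach_lt (σ : Side) {lam : ℝ} (hlam : 0 < lam) {r : ℝ} (h : lam < r) :
    ∀ᶠ ε in 𝓝[>] (0 : ℝ), ‖approach σ lam ε‖ < r := by
  have := (tendsto_approach σ lam).norm
  rw [Complex.norm_real, Real.norm_of_nonneg hlam.le] at this
  exact this.eventually_lt_const h

lemma exists_tendsto_logTerm_approach {χ : ℝ → ℂ} (hχ : IsCutoff χ) (σ : Side) {lam : ℝ}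
    (hlam : 0 < lam) (hlam2 : lam < 1 / 2) :
    ∃ z : ℂ, Tendsto (fun ε => logTerm χ (approach σ lam ε)) (𝓝[>] 0) (𝓝 z) := by
  obtain ⟨z, hz⟩ := exists_tendsto_log_neg_approach σ hlam
  obtain ⟨B, hB, hBk⟩ := norm_logTail_sub_le hχ
  have ht := tendsto_approach σ lam
  have hslit : (1 : ℂ) - lam ∈ Complex.slitPlane := by
    left; simp; linarith
  have hlog := (ht.const_sub 1).clog hslit
  have htail : Tendsto (fun ε => logTail χ (approach σ lam ε)) (𝓝[>] 0)
      (𝓝 (logTail χ lam)) := by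
    rw [tendsto_iff_norm_sub_tendsto_zero]
    have h2 : Tendsto (fun ε => B * ‖approach σ lam ε - lam‖) (𝓝[>] 0) (𝓝 0) := by
      simpa using ((tendsto_iff_norm_sub_tendsto_zero.1 ht).const_mul B)
    refine squeeze_zero' (Eventually.of_forall fun _ => norm_nonneg _) ?_ h2
    filter_upwards [eventually_norm_approach_lt σ hlam hlam2] with ε hε
    refine hBk _ _ hε.le ?_
    rw [Complex.norm_real, Real.norm_of_nonneg hlam.le]
    exact hlam2.le
  refine ⟨_, (((hlog.sub hz).add htail).const_mul (1 / (2 * Real.pi) : ℂ)).congr' ?_⟩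
  filter_upwards [self_mem_nhdsWithin] with ε hε
  exact (logTerm_eq hχ (approach_ne_ofReal σ lam hε)).symm

lemma modKernelConverges {χ : ℝ → ℂ} (hχ : IsCutoff χ) {κ : SpectralPoint}
    (hκ : ‖κ.val‖ < 1 / 2) {x : ℝ} (hx : x ≠ 0) : ModKernelConverges χ κ x := by
  cases κ with
  | off k hk => exact offConverges hχ hk hx
  | cut σ lam hlam =>
    have hlam2 : lam < 1 / 2 := by
      simpa [SpectralPoint.val, abs_of_pos hlam] using hκ
    exact ⟨fun ε hε => offConverges hχ (approach_ne_ofReal σ lam hε) hx,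
      exists_tendsto_kernel_approach σ hlam hx, exists_tendsto_logTerm_approach hχ σ hlam hlam2⟩
  | zero => exact modKernelConverges_zero hχ hx

/-- The values of `modKernel` on the cut are limits of values off the cut. -/
lemma tendsto_modKernel_cut {χ : ℝ → ℂ} (hχ : IsCutoff χ) (σ : Side) {lam : ℝ}
    (hlam : 0 < lam) (hlam2 : lam < 1 / 2) {x : ℝ} (hx : x ≠ 0) :
    Tendsto (fun ε => kernel (approach σ lam ε) x - logTerm χ (approach σ lam ε)) (𝓝[>] 0)
      (𝓝 (modKernel χ (.cut σ lam hlam) x)) :=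
  (tendsto_nhds_limUnder (exists_tendsto_kernel_approach σ hlam hx)).sub
    (tendsto_nhds_limUnder (exists_tendsto_logTerm_approach hχ σ hlam hlam2))

lemma norm_modKernel_sub_zero_le {χ : ℝ → ℂ} (hχ : IsCutoff χ) {η : ℝ} (h0 : 0 < η)
    (h1 : η < 1) : ∃ C : ℝ, 0 < C ∧ ∀ κ : SpectralPoint, ‖κ.val‖ < 1 / 2 → ∀ x : ℝ, x ≠ 0 →
      ‖modKernel χ κ x - modKernel χ .zero x‖ ≤ C * ‖κ.val‖ ^ η * powSum η x := by
  obtain ⟨C, hC, hoff⟩ := norm_modKernel_off_sub_zero_le hχ h0 h1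
  refine ⟨C, hC, fun κ hκ x hx => ?_⟩
  cases κ with
  | off k hk => exact hoff k hk hκ.le x hx
  | cut σ lam hlam =>
    have hlam2 : lam < 1 / 2 := by
      simpa [SpectralPoint.val, abs_of_pos hlam] using hκ
    have hl := ((tendsto_modKernel_cut hχ σ hlam hlam2 hx).sub_const (modKernel χ .zero x)).norm
    have hr := (((tendsto_approach σ lam).norm.rpow_const (p := η) (Or.inr h0.le)).const_mul
      C).mul_const (powSum η x)
    -- The estimate off the cut has a constant independent of $k$ and both sides converge, so it
    -- passes to the boundary values.
    refine le_of_tendsto_of_tendsto hl hr ?_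
    filter_upwards [self_mem_nhdsWithin, eventually_norm_approach_lt σ hlam hlam2] with ε hε hε2
    exact hoff _ (approach_ne_ofReal σ lam hε) hε2.le x hx
  | zero =>
    rw [sub_self, norm_zero]
    have := powSum_nonneg η x
    positivity

/-- Continuity off the origin suffices, since one point does not affect measurability. -/
lemma measurable_einInt : Measurable einInt := by
  have h1 : Measurable fun w : ℂ => if w = 0 then einInt 0 else einInt w := by
    refine measurable_of_continuousOn_compl_singleton 0 fun w hw => ?_
    have h2 := (hasDerivAt_einInt hw).continuousAt.continuousWithinAt (s := {0}ᶜ)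
    refine h2.congr (fun v hv => if_neg hv) (if_neg hw)
  convert h1 using 2 with w
  split_ifs with h
  · rw [h]
  · rfl

lemma measurable_fullKernel (k : ℂ) : Measurable (fullKernel k) := by
  have h : ∀ k : ℂ, Measurable (halfKernel k) := by
    intro k
    unfold halfKernel expLog
    have := measurable_einInt
    fun_prop
  unfold fullKernel
  refine Measurable.ite measurableSet_Ioi (h k) ?_
  exact Complex.continuous_conj.measurable.comp ((h _).comp measurable_neg)

lemma ae_ne_zero : ∀ᵐ x : ℝ, x ≠ 0 := by
  simp [ae_iff]

lemma aestronglyMeasurable_modKernel {χ : ℝ → ℂ} (hχ : IsCutoff χ) {κ : SpectralPoint}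
    (hκ : ‖κ.val‖ < 1 / 2) : AEStronglyMeasurable (modKernel χ κ) volume := by
  have hoff : ∀ k : ℂ, (∀ t : ℝ, 0 ≤ t → k ≠ (t : ℂ)) →
      AEStronglyMeasurable (fun x => kernel k x - logTerm χ k) volume := by
    intro k hk
    refine AEStronglyMeasurable.congr (f := fun x => (1 / (2 * Real.pi) : ℂ) * fullKernel k x -
      logTerm χ k) (((measurable_fullKernel k).const_mul _).sub_const _).aestronglyMeasurable ?_
    filter_upwards [ae_ne_zero] with x hx
    rw [kernel_eq hk hx]
  cases κ with
  | off k hk => exact hoff k hk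
  | cut σ lam hlam =>
    have hlam2 : lam < 1 / 2 := by
      simpa [SpectralPoint.val, abs_of_pos hlam] using hκ
    -- A countable sequence of $\varepsilon$ is needed: measurability passes to almost everywhere
    -- limits of sequences.
    have hseq : Tendsto (fun n : ℕ => 1 / ((n : ℝ) + 1)) atTop (𝓝[>] 0) :=
      tendsto_nhdsWithin_iff.2 ⟨tendsto_one_div_add_atTop_nhds_zero_nat,
        Eventually.of_forall fun n => by simp only [Set.mem_Ioi]; positivity⟩
    refine aestronglyMeasurable_of_tendsto_ae atTop (f := fun (n : ℕ) x =>
      kernel (approach σ lam (1 / ((n : ℝ) + 1))) x -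
        logTerm χ (approach σ lam (1 / ((n : ℝ) + 1))))
      (fun n => hoff _ (approach_ne_ofReal σ lam (by positivity))) ?_
    filter_upwards [ae_ne_zero] with x hx
    exact (tendsto_modKernel_cut hχ σ hlam hlam2 hx).comp hseq
  | zero =>
    refine AEStronglyMeasurable.congr (((measurable_zeroKernel.sub_const
      (logTail χ 0)).const_mul (1 / (2 * Real.pi) : ℂ)).aestronglyMeasurable) ?_
    filter_upwards [ae_ne_zero] with x hx
    rw [modKernel_zero_eq hχ hx]

/-- Uniform control of the modified kernels near `k = 0`. -/
lemma exists_modKernel_bounds {χ : ℝ → ℂ} (hχ : IsCutoff χ) {η : ℝ} (h0 : 0 < η) (h1 : η < 1) :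
    ∃ C : ℝ, 0 < C ∧ ∀ κ : SpectralPoint, ‖κ.val‖ < 1 / 2 → ∀ x : ℝ, x ≠ 0 →
      ‖modKernel χ κ x‖ ≤ C * powSum η x ∧
      ‖modKernel χ κ x - modKernel χ .zero x‖ ≤ C * ‖κ.val‖ ^ η * powSum η x := by
  obtain ⟨C, hC, hsub⟩ := norm_modKernel_sub_zero_le hχ h0 h1
  obtain ⟨C', hC', hzero⟩ := norm_modKernel_zero_le hχ h0
  refine ⟨C + C', by positivity, fun κ hκ x hx => ?_⟩
  have h2 := hsub κ hκ x hx
  have h3 := hzero x hx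
  have hp := powSum_nonneg η x
  have hk : ‖κ.val‖ ^ η ≤ 1 := Real.rpow_le_one (norm_nonneg _) (by linarith) h0.le
  have hk0 : 0 ≤ ‖κ.val‖ ^ η := by positivity
  constructor
  · have h4 := norm_le_norm_add_norm_sub' (modKernel χ κ x) (modKernel χ .zero x)
    have h5 : C * ‖κ.val‖ ^ η * powSum η x ≤ C * 1 * powSum η x := by gcongr
    nlinarith
  · refine h2.trans ?_
    gcongr
    linarith

/-! ### Convolution estimates in weighted spaces -/

lemma weight_pos (x : ℝ) : 0 < weight x := by unfold weight; positivity

lemma one_le_weight (x : ℝ) : 1 ≤ weight x := by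
  unfold weight; linarith [abs_nonneg x]

lemma continuous_weight : Continuous weight := by unfold weight; fun_prop

lemma continuous_weight_rpow (a : ℝ) : Continuous fun x => weight x ^ a :=
  continuous_weight.rpow_const fun x => Or.inl (weight_pos x).ne'

lemma weight_rpow_pos (a x : ℝ) : 0 < weight x ^ a := Real.rpow_pos_of_pos (weight_pos x) a

lemma abs_sub_le_weight_mul (x y : ℝ) : |x - y| ≤ weight x * weight y := by
  have := abs_sub x y
  unfold weight
  nlinarith [abs_nonneg x, abs_nonneg y]

lemma memLp_weight_rpow {a : ℝ} (ha : a < -(1 / 2)) : MemLp (fun y => weight y ^ a) 2 := by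
  rw [memLp_two_iff_integrable_sq (continuous_weight_rpow a).aestronglyMeasurable]
  have h := integrable_one_add_norm (E := ℝ) (μ := volume) (r := -(2 * a)) (by simp; linarith)
  refine h.congr (Eventually.of_forall fun y => ?_)
  simp only [neg_neg, Real.norm_eq_abs]
  rw [← Real.rpow_natCast, ← Real.rpow_mul (weight_pos y).le, weight]
  congr 1
  push_cast
  ring

/-- The local part of the singularity `|t|^{-η}`. -/
noncomputable def localSing (η t : ℝ) : ℝ := (Set.Ioo (-1) 1).indicator (fun t => |t| ^ (-η)) t

lemma localSing_nonneg (η t : ℝ) : 0 ≤ localSing η t :=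
  Set.indicator_nonneg (fun _ _ => by positivity) _

lemma measurable_localSing (η : ℝ) : Measurable (localSing η) := by
  unfold localSing
  exact Measurable.indicator (by fun_prop) measurableSet_Ioo

lemma memLp_localSing {η : ℝ} (hη : η < 1 / 2) : MemLp (localSing η) 2 := by
  rw [memLp_two_iff_integrable_sq (measurable_localSing η).aestronglyMeasurable]
  have h1 : IntervalIntegrable (fun t : ℝ => |t| ^ (-(2 * η))) volume 0 1 := by
    refine (intervalIntegral.intervalIntegrable_rpow' (r := -(2 * η))
      (by linarith)).congr fun t ht => ?_
    rw [Set.uIoc_of_le zero_le_one] at ht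
    simp only [abs_of_pos ht.1]
  have h2 : IntervalIntegrable (fun t : ℝ => |t| ^ (-(2 * η))) volume (-1) 0 := by
    rw [IntervalIntegrable.iff_comp_neg]
    simpa using h1.symm
  have h3 := h2.trans h1
  rw [intervalIntegrable_iff_integrableOn_Ioo_of_le (by norm_num)] at h3
  rw [← integrable_indicator_iff measurableSet_Ioo] at h3
  refine h3.congr (Eventually.of_forall fun t => ?_)
  simp only [localSing, Set.indicator]
  split_ifs
  · rw [← Real.rpow_natCast, ← Real.rpow_mul (abs_nonneg t)]
    congr 1
    push_cast
    ring
  · simp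

/-- The growth is shared by $|x-y|\le w(x)w(y)$. The singularity is kept only for $|x-y|<1$, where
it is square integrable if $2\eta<1$. -/
lemma powSum_sub_le {η : ℝ} (hη : 0 ≤ η) (x y : ℝ) :
    powSum η (x - y) ≤ 2 * weight x ^ η * weight y ^ η + localSing η (x - y) := by
  have h1 : |x - y| ^ η ≤ weight x ^ η * weight y ^ η := by
    rw [← Real.mul_rpow (weight_pos x).le (weight_pos y).le]
    exact Real.rpow_le_rpow (abs_nonneg _) (abs_sub_le_weight_mul x y) hη
  have hx := Real.one_le_rpow (one_le_weight x) hη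
  have hy := Real.one_le_rpow (one_le_weight y) hη
  have h2 : |x - y| ^ (-η) ≤ 1 + localSing η (x - y) := by
    by_cases h : x - y ∈ Set.Ioo (-1 : ℝ) 1
    · rw [localSing, Set.indicator_of_mem h]; linarith
    · have h3 : 1 ≤ |x - y| := by
        by_contra! h4
        exact h (abs_lt.1 h4)
      have := Real.rpow_le_one_of_one_le_of_nonpos h3 (neg_nonpos.2 hη)
      linarith [localSing_nonneg η (x - y)]
  unfold powSum
  nlinarith

/-- A measurable kernel of size at most `M (|x|^η + |x|^{-η})`. -/
structure KernelBound (η M : ℝ) (K : ℝ → ℂ) : Prop where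
  meas : AEStronglyMeasurable K volume
  bound : ∀ x : ℝ, x ≠ 0 → ‖K x‖ ≤ M * powSum η x

lemma aestronglyMeasurable_comp_sub {K : ℝ → ℂ} (hK : AEStronglyMeasurable K volume) (x : ℝ) :
    AEStronglyMeasurable (fun y => K (x - y)) volume :=
  hK.comp_quasiMeasurePreserving (quasiMeasurePreserving_sub_left_of_right_invariant volume x)

lemma ae_sub_ne_zero (x : ℝ) : ∀ᵐ y : ℝ, x - y ≠ 0 := by
  have : ∀ᵐ y : ℝ, y ≠ x := by simp [ae_iff]
  filter_upwards [this] with y hy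
  exact sub_ne_zero.2 hy.symm

/-- The translated kernel against an inverse weight is in `L²`, with slowly growing norm. -/
lemma exists_eLpNorm_kernel_le {η r : ℝ} (h0 : 0 < η) (h1 : η < 1 / 2) (hr : 1 / 2 + η < r) :
    ∃ D : ℝ, 0 < D ∧ ∀ (M : ℝ) (K : ℝ → ℂ), 0 ≤ M → KernelBound η M K → ∀ x : ℝ,
      MemLp (fun y => ((weight y ^ (-r) : ℝ) : ℂ) * K (x - y)) 2 ∧
      eLpNorm (fun y => ((weight y ^ (-r) : ℝ) : ℂ) * K (x - y)) 2 volume ≤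
        ENNReal.ofReal (D * M * weight x ^ η) := by
  have hA := memLp_weight_rpow (a := η - r) (by linarith)
  have hB := memLp_localSing h1
  set a := (eLpNorm (fun y => weight y ^ (η - r)) 2 volume).toReal with ha
  set b := (eLpNorm (localSing η) 2 volume).toReal with hb
  have ha0 : 0 ≤ a := ENNReal.toReal_nonneg
  have hb0 : 0 ≤ b := ENNReal.toReal_nonneg
  refine ⟨2 * a + b + 1, by positivity, fun M K hM hK x => ?_⟩
  have hwx := Real.one_le_rpow (one_le_weight x) h0.le
  have hBx : MemLp (fun y => localSing η (x - y)) 2 :=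
    hB.comp_measurePreserving (Measure.measurePreserving_sub_left volume x)
  have hBxn : eLpNorm (fun y => localSing η (x - y)) 2 volume = eLpNorm (localSing η) 2 volume :=
    eLpNorm_comp_measurePreserving (measurable_localSing η).aestronglyMeasurable
      (Measure.measurePreserving_sub_left volume x)
  -- The first summand is in $L^2$ because $r-\eta>\frac12$; the norm of the second does not depend
  -- on $x$ by translation invariance.
  set g : ℝ → ℝ := (M * 2 * weight x ^ η) • (fun y => weight y ^ (η - r)) +
    M • (fun y => localSing η (x - y)) with hg
  have hgm : MemLp g 2 := (hA.const_smul _).add (hBx.const_smul _)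
  have hle : ∀ᵐ y : ℝ, ‖((weight y ^ (-r) : ℝ) : ℂ) * K (x - y)‖ ≤ g y := by
    filter_upwards [ae_sub_ne_zero x] with y hy
    rw [norm_mul, Complex.norm_real, Real.norm_of_nonneg (weight_rpow_pos _ _).le]
    have hw1 : weight y ^ (-r) ≤ 1 :=
      Real.rpow_le_one_of_one_le_of_nonpos (one_le_weight y) (by linarith)
    have hw0 := (weight_rpow_pos (-r) y).le
    have e : weight y ^ (η - r) = weight y ^ η * weight y ^ (-r) := by
      rw [← Real.rpow_add (weight_pos y)]; congr 1
    simp only [hg, Pi.add_apply, Pi.smul_apply, smul_eq_mul, e]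
    have hs := powSum_sub_le h0.le x y
    have hl := localSing_nonneg η (x - y)
    calc _ ≤ weight y ^ (-r) * (M * powSum η (x - y)) := by gcongr; exact hK.bound _ hy
      _ ≤ weight y ^ (-r) * (M * (2 * weight x ^ η * weight y ^ η + localSing η (x - y))) := by
          gcongr
      _ = M * 2 * weight x ^ η * (weight y ^ η * weight y ^ (-r)) +
          weight y ^ (-r) * (M * localSing η (x - y)) := by ring
      _ ≤ _ := by
          have : weight y ^ (-r) * (M * localSing η (x - y)) ≤ M * localSing η (x - y) :=
            mul_le_of_le_one_left (by positivity) hw1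
          gcongr
  have hmeas : AEStronglyMeasurable (fun y => ((weight y ^ (-r) : ℝ) : ℂ) * K (x - y)) volume :=
    (Complex.continuous_ofReal.comp (continuous_weight_rpow (-r))).aestronglyMeasurable.mul
      (aestronglyMeasurable_comp_sub hK.meas x)
  refine ⟨hgm.mono' hmeas hle, ?_⟩
  refine (eLpNorm_mono_ae_real hle).trans ?_
  refine (eLpNorm_add_le (hA.const_smul _).1 (hBx.const_smul _).1 one_le_two).trans ?_
  rw [eLpNorm_const_smul, eLpNorm_const_smul, hBxn, ← ENNReal.ofReal_toReal hA.2.ne,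
    ← ENNReal.ofReal_toReal hB.2.ne, ← ha, ← hb, Real.enorm_of_nonneg (by positivity),
    Real.enorm_of_nonneg hM, ← ENNReal.ofReal_mul (by positivity), ← ENNReal.ofReal_mul hM,
    ← ENNReal.ofReal_add (by positivity) (by positivity)]
  refine ENNReal.ofReal_le_ofReal ?_
  have : M * b ≤ M * b * weight x ^ η := le_mul_of_one_le_right (by positivity) hwx
  have : 0 ≤ M * weight x ^ η := by positivity
  nlinarith

/-- Hölder's inequality for the `L¹` norm of a product of `L²` functions. -/
lemma integral_norm_mul_le {f g : ℝ → ℂ} (hf : MemLp f 2) (hg : MemLp g 2) :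
    Integrable (fun y => f y * g y) ∧
      ∫ y, ‖f y * g y‖ ≤ (eLpNorm f 2 volume).toReal * (eLpNorm g 2 volume).toReal := by
  have hi : Integrable (fun y => f y * g y) := hf.integrable_mul hg
  refine ⟨hi, ?_⟩
  have h := eLpNorm_smul_le_mul_eLpNorm (p := 2) (q := 2) (r := 1) hg.1 hf.1
  have h2 := ENNReal.toReal_mono (ENNReal.mul_ne_top hf.2.ne hg.2.ne) h
  rw [ENNReal.toReal_mul] at h2
  refine le_trans (le_of_eq ?_) h2
  rw [integral_norm_eq_lintegral_enorm hi.1, eLpNorm_one_eq_lintegral_enorm]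
  rfl

/-- The integral `∫ K(x - y) f(y) dy`. -/
noncomputable def conv (K f : ℝ → ℂ) (x : ℝ) : ℂ := ∫ y, K (x - y) * f y

lemma MemWeightedLp.aestronglyMeasurable {E : Type*} [NormedAddCommGroup E] [NormedSpace ℝ E]
    {p : ℝ≥0∞} {r : ℝ} {f : ℝ → E} (hf : MemWeightedLp p r f) :
    AEStronglyMeasurable f volume := by
  have h := (continuous_weight_rpow (-r)).aestronglyMeasurable.smul hf.1
  refine h.congr (Eventually.of_forall fun x => ?_)
  simp only [Pi.smul_apply', smul_smul]
  rw [← Real.rpow_add (weight_pos x), neg_add_cancel, Real.rpow_zero, one_smul]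

/-- Convolution of a singular kernel with a weighted `L²` function. -/
lemma exists_conv_bound {η r : ℝ} (h0 : 0 < η) (h1 : η < 1 / 2) (hr : 1 / 2 + η < r) :
    ∃ D : ℝ, 0 < D ∧ ∀ (M : ℝ) (K : ℝ → ℂ), 0 ≤ M → KernelBound η M K →
      ∀ f : ℝ → ℂ, MemWeightedLp 2 r f → ∀ x : ℝ,
        Integrable (fun y => K (x - y) * f y) ∧
        ∫ y, ‖K (x - y) * f y‖ ≤ D * M * weight x ^ η * (weightedNorm 2 r f).toReal := by
  obtain ⟨D, hD, hDK⟩ := exists_eLpNorm_kernel_le h0 h1 hr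
  refine ⟨D, hD, fun M K hM hK f hf x => ?_⟩
  obtain ⟨hm, hn⟩ := hDK M K hM hK x
  obtain ⟨hi, hle⟩ := integral_norm_mul_le hm hf
  have e : ∀ y, ((weight y ^ (-r) : ℝ) : ℂ) * K (x - y) * (weight y ^ r • f y) =
      K (x - y) * f y := by
    intro y
    rw [Complex.real_smul]
    have : ((weight y ^ (-r) : ℝ) : ℂ) * ((weight y ^ r : ℝ) : ℂ) = 1 := by
      rw [← Complex.ofReal_mul, ← Real.rpow_add (weight_pos y)]; simp
    linear_combination (K (x - y) * f y) * this
  simp_rw [e] at hi hle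
  refine ⟨hi, hle.trans ?_⟩
  refine mul_le_mul_of_nonneg_right ?_ ENNReal.toReal_nonneg
  have := (weight_rpow_pos η x).le
  exact ENNReal.toReal_le_of_le_ofReal (by positivity) hn

lemma norm_conv_le (K f : ℝ → ℂ) (x : ℝ) : ‖conv K f x‖ ≤ ∫ y, ‖K (x - y) * f y‖ :=
  norm_integral_le_integral_norm _

lemma aestronglyMeasurable_conv {K f : ℝ → ℂ} (hK : AEStronglyMeasurable K volume)
    (hf : AEStronglyMeasurable f volume) : AEStronglyMeasurable (conv K f) volume := by
  have h : AEStronglyMeasurable (fun p : ℝ × ℝ => K (p.1 - p.2) * f p.2)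
      (volume.prod volume) := by
    have hf2 : AEStronglyMeasurable (fun p : ℝ × ℝ => f p.2) (volume.prod volume) := hf.comp_snd
    exact (hK.comp_quasiMeasurePreserving (quasiMeasurePreserving_sub volume volume)).mul hf2
  exact h.integral_prod_right'

/-- The function `w^{-r} g`. -/
noncomputable def unweight (r : ℝ) (g : ℝ → ℂ) (y : ℝ) : ℂ := ((weight y ^ (-r) : ℝ) : ℂ) * g y

lemma weight_smul_unweight (r : ℝ) (g : ℝ → ℂ) (y : ℝ) : weight y ^ r • unweight r g y = g y := by
  have : ((weight y ^ r : ℝ) : ℂ) * ((weight y ^ (-r) : ℝ) : ℂ) = 1 := by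
    rw [← Complex.ofReal_mul, ← Real.rpow_add (weight_pos y)]; simp
  rw [Complex.real_smul, unweight]
  linear_combination (g y) * this

lemma memWeightedLp_unweight (r : ℝ) {g : ℝ → ℂ} (hg : MemLp g 2) :
    MemWeightedLp 2 r (unweight r g) := by
  unfold MemWeightedLp
  simp_rw [weight_smul_unweight]
  exact hg

lemma weightedNorm_unweight (r : ℝ) (g : ℝ → ℂ) :
    weightedNorm 2 r (unweight r g) = eLpNorm g 2 volume := by
  unfold weightedNorm
  simp_rw [weight_smul_unweight]

lemma conv_congr {K f g : ℝ → ℂ} (h : f =ᵐ[volume] g) : conv K f = conv K g := by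
  ext x
  refine integral_congr_ae ?_
  filter_upwards [h] with y hy
  rw [hy]

/-! ### Compactness of the weighted integral operators -/

/-- An integral operator obtained from weakly continuous, dominated pointwise evaluations is
compact on `L²`. -/
lemma isCompactOperator_of_tendsto (A : Lp ℂ 2 (volume : Measure ℝ) →L[ℂ] Lp ℂ 2 volume)
    (T : Lp ℂ 2 (volume : Measure ℝ) → ℝ → ℂ) (b : ℝ → ℝ) (hb : MemLp b 2)
    (hA : ∀ g, A g =ᵐ[volume] T g)
    (hT : ∀ g, ‖g‖ ≤ 1 → ∀ x, ‖T g x‖ ≤ b x)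
    (hlim : ∀ (gs : ℕ → Lp ℂ 2 (volume : Measure ℝ)) (g : Lp ℂ 2 (volume : Measure ℝ)),
      (∀ h, Tendsto (fun n => inner ℂ h (gs n)) atTop (𝓝 (inner ℂ h g))) →
      ∀ x, Tendsto (fun n => T (gs n) x) atTop (𝓝 (T g x))) :
    IsCompactOperator A := by
  have : Fact ((2 : ℝ≥0∞) ≠ ∞) := ⟨by norm_num⟩
  refine (isCompactOperator_iff_image_closedBall_subset_compact
    (A : Lp ℂ 2 (volume : Measure ℝ) →ₗ[ℂ] Lp ℂ 2 (volume : Measure ℝ)) one_pos).2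
    ⟨_, IsSeqCompact.isCompact ?_, subset_rfl⟩
  intro ys hys
  choose gs hgs hAgs using hys
  have hgs1 : ∀ n, ‖gs n‖ ≤ 1 := fun n => by simpa using hgs n
  -- The dual unit ball of the separable space $L^2$ is weak-* sequentially compact. The Riesz
  -- isometry turns this into a weakly convergent subsequence whose limit is again in the unit ball,
  -- so the image of the closed ball is itself compact.
  obtain ⟨ℓ, hℓ, φ, hφ, hφl⟩ := WeakDual.isSeqCompact_closedBall ℂ
    (Lp ℂ 2 (volume : Measure ℝ)) 0 1
    (x := fun n => StrongDual.toWeakDual (InnerProductSpace.toDual ℂ _ (gs n))) (fun n => by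
      simpa using hgs1 n)
  set g := (InnerProductSpace.toDual ℂ (Lp ℂ 2 (volume : Measure ℝ))).symm
    (WeakDual.toStrongDual ℓ) with hg
  have hg1 : ‖g‖ ≤ 1 := by
    rw [hg, LinearIsometryEquiv.norm_map]
    simpa using hℓ
  have hweak : ∀ h, Tendsto (fun n => inner ℂ h (gs (φ n))) atTop (𝓝 (inner ℂ h g)) := by
    intro h
    have h1 := ((WeakDual.eval_continuous h).tendsto ℓ).comp hφl
    have h2 : ℓ h = inner ℂ g h := by
      rw [hg, InnerProductSpace.toDual_symm_apply]
      rfl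
    rw [h2] at h1
    have h3 := (Complex.continuous_conj.tendsto _).comp h1
    rw [inner_conj_symm] at h3
    refine h3.congr fun n => ?_
    have : (StrongDual.toWeakDual (InnerProductSpace.toDual ℂ _ (gs (φ n)))) h =
      inner ℂ (gs (φ n)) h := InnerProductSpace.toDual_apply_apply ..
    simp only [Function.comp]
    rw [this, inner_conj_symm]
  refine ⟨A g, ⟨g, by simpa using hg1, rfl⟩, φ, hφ, ?_⟩
  have hys' : ∀ n, ys n = A (gs n) := fun n => (hAgs n).symm
  simp_rw [Function.comp_def, hys']
  rw [Lp.tendsto_Lp_iff_tendsto_eLpNorm']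
  have hpt := hlim (fun n => gs (φ n)) g hweak
  -- Weak convergence gives pointwise convergence of the images; domination by $(2|b|)^2$ upgrades
  -- it to convergence in $L^2$.
  have key : Tendsto (fun n => ∫⁻ x, ‖(A (gs (φ n)) : ℝ → ℂ) x - (A g : ℝ → ℂ) x‖ₑ ^ (2 : ℝ))
      atTop (𝓝 (∫⁻ _ : ℝ, 0)) := by
    refine tendsto_lintegral_of_dominated_convergence' (fun x => (2 * ‖b x‖ₑ) ^ (2 : ℝ))
      (fun n => (((Lp.aestronglyMeasurable _).sub
        (Lp.aestronglyMeasurable _)).enorm.pow_const _)) (fun n => ?_) ?_ ?_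
    · filter_upwards [hA (gs (φ n)), hA g] with x h1 h2
      rw [h1, h2]
      refine ENNReal.rpow_le_rpow ((enorm_sub_le).trans ?_) (by norm_num)
      have h3 : ∀ g, ‖g‖ ≤ 1 → ‖T g x‖ₑ ≤ ‖b x‖ₑ := fun g hg =>
        enorm_le_iff_norm_le.2 ((hT g hg x).trans (le_abs_self _))
      rw [two_mul]
      exact add_le_add (h3 _ (hgs1 _)) (h3 _ hg1)
    · have h4 : MemLp (fun x => 2 * b x) 2 := hb.const_mul 2
      have := lintegral_rpow_enorm_lt_top_of_eLpNorm_lt_top (by norm_num) (by norm_num) h4.2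
      refine ne_of_lt (lt_of_le_of_lt (le_of_eq ?_) this)
      congr 1
      ext x
      simp [enorm_mul, Real.enorm_of_nonneg]
    · have hall : ∀ᵐ x, ∀ n, (A (gs (φ n)) : ℝ → ℂ) x = T (gs (φ n)) x :=
        ae_all_iff.2 fun n => hA _
      filter_upwards [hall, hA g] with x h1 h2
      simp_rw [h1, h2]
      have h5 := ((hpt x).sub_const (T g x)).enorm
      rw [sub_self, enorm_zero] at h5
      simpa [Function.comp_def] using (ENNReal.continuous_rpow_const (y := 2)).tendsto 0 |>.comp h5
  rw [lintegral_zero] at key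
  have key2 := (ENNReal.continuous_rpow_const (y := (1 / 2 : ℝ))).tendsto 0 |>.comp key
  rw [ENNReal.zero_rpow_of_pos (by norm_num)] at key2
  refine key2.congr fun n => ?_
  rw [eLpNorm_eq_lintegral_rpow_enorm_toReal (by norm_num) (by norm_num)]
  simp

lemma weightedNorm_unweight_coe (r : ℝ) (g : Lp ℂ 2 (volume : Measure ℝ)) :
    (weightedNorm 2 r (unweight r g)).toReal = ‖g‖ := by
  rw [weightedNorm_unweight, Lp.norm_def]

/-- The weighted integral operator `g ↦ v · (K * (w^{-r} g))` is compact on `L²`, with norm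
controlled by the size of the kernel. -/
lemma exists_convOperator {η r : ℝ} (h0 : 0 < η) (h1 : η < 1 / 2) (hr : 1 / 2 + η < r)
    {v : ℝ → ℂ} (hv : MemWeightedLp 2 η v) :
    ∃ D : ℝ, 0 < D ∧ ∀ (M : ℝ) (K : ℝ → ℂ), 0 ≤ M → KernelBound η M K →
      ∃ A : Lp ℂ 2 (volume : Measure ℝ) →L[ℂ] Lp ℂ 2 (volume : Measure ℝ),
        (∀ g, A g =ᵐ[volume] fun x => v x * conv K (unweight r g) x) ∧
        ‖A‖ ≤ D * M ∧ IsCompactOperator A := by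
  obtain ⟨D, hD, hDK⟩ := exists_conv_bound h0 h1 hr
  obtain ⟨D', hD', hDK'⟩ := exists_eLpNorm_kernel_le h0 h1 hr
  set V := (weightedNorm 2 η v).toReal with hV
  have hV0 : 0 ≤ V := ENNReal.toReal_nonneg
  refine ⟨D * V + 1, by positivity, fun M K hM hK => ?_⟩
  set T : Lp ℂ 2 (volume : Measure ℝ) → ℝ → ℂ := fun g x => v x * conv K (unweight r g) x with hTdef
  have hmem : ∀ g : Lp ℂ 2 (volume : Measure ℝ), MemWeightedLp 2 r (unweight r g) := fun g =>
    memWeightedLp_unweight r (Lp.memLp g)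
  have hT : ∀ g x, ‖T g x‖ ≤ D * M * ‖g‖ * ‖weight x ^ η • v x‖ := by
    intro g x
    have h2 := (norm_conv_le K (unweight r g) x).trans (hDK M K hM hK _ (hmem g) x).2
    rw [weightedNorm_unweight_coe] at h2
    rw [norm_mul, norm_smul, Real.norm_of_nonneg (weight_rpow_pos η x).le]
    calc _ ≤ ‖v x‖ * (D * M * weight x ^ η * ‖g‖) := by gcongr
      _ = _ := by ring
  have hTmem : ∀ g, MemLp (T g) 2 := by
    intro g
    refine MemLp.mono' (g := fun x => D * M * ‖g‖ * ‖weight x ^ η • v x‖)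
      (hv.norm.const_mul _) ?_ (Eventually.of_forall (hT g))
    exact hv.aestronglyMeasurable.mul
      (aestronglyMeasurable_conv hK.meas (hmem g).aestronglyMeasurable)
  have hTnorm : ∀ g, (eLpNorm (T g) 2 volume).toReal ≤ D * M * ‖g‖ * V := by
    intro g
    have h2 := eLpNorm_mono_real (p := 2) (μ := volume) (hT g)
    have h3 : eLpNorm (fun x => D * M * ‖g‖ * ‖weight x ^ η • v x‖) 2 volume =
        ENNReal.ofReal (D * M * ‖g‖) * weightedNorm 2 η v := by
      have := eLpNorm_const_smul (D * M * ‖g‖) (fun x => ‖weight x ^ η • v x‖) 2 volume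
      rw [eLpNorm_norm, Real.enorm_of_nonneg (by positivity)] at this
      exact this
    rw [h3] at h2
    have h4 := ENNReal.toReal_mono (ENNReal.mul_ne_top ENNReal.ofReal_ne_top hv.2.ne) h2
    rwa [ENNReal.toReal_mul, ENNReal.toReal_ofReal (by positivity)] at h4
  have hadd : ∀ g h : Lp ℂ 2 (volume : Measure ℝ), T (g + h) = T g + T h := by
    intro g h
    ext x
    have e : conv K (unweight r ↑↑(g + h)) = conv K (unweight r g + unweight r h) := by
      refine conv_congr ?_
      filter_upwards [Lp.coeFn_add g h] with y hy
      simp only [unweight, Pi.add_apply]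
      rw [hy, Pi.add_apply, mul_add]
    simp only [hTdef, e, Pi.add_apply, ← mul_add]
    congr 1
    simp only [conv, Pi.add_apply, mul_add]
    exact integral_add (hDK M K hM hK _ (hmem g) x).1 (hDK M K hM hK _ (hmem h) x).1
  have hsmul : ∀ (c : ℂ) (g : Lp ℂ 2 (volume : Measure ℝ)), T (c • g) = c • T g := by
    intro c g
    ext x
    have e : conv K (unweight r ↑↑(c • g)) = conv K (c • unweight r g) := by
      refine conv_congr ?_
      filter_upwards [Lp.coeFn_smul c g] with y hy
      simp only [unweight, hy, Pi.smul_apply, smul_eq_mul]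
      ring
    simp only [hTdef, e, Pi.smul_apply, smul_eq_mul]
    simp only [conv, Pi.smul_apply, smul_eq_mul]
    rw [mul_left_comm, ← integral_const_mul c]
    congr 1
    refine integral_congr_ae (Eventually.of_forall fun y => ?_)
    simp only
    ring
  let L : Lp ℂ 2 (volume : Measure ℝ) →ₗ[ℂ] Lp ℂ 2 (volume : Measure ℝ) :=
    { toFun := fun g => (hTmem g).toLp
      map_add' := fun g h => by
        rw [← MemLp.toLp_add]
        exact MemLp.toLp_congr _ _ (by rw [hadd])
      map_smul' := fun c g => by
        rw [RingHom.id_apply, ← MemLp.toLp_const_smul]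
        exact MemLp.toLp_congr _ _ (by rw [hsmul]) }
  have hL : ∀ g, ‖L g‖ ≤ (D * V + 1) * M * ‖g‖ := by
    intro g
    change ‖(hTmem g).toLp‖ ≤ _
    rw [Lp.norm_toLp]
    refine (hTnorm g).trans ?_
    have : 0 ≤ M * ‖g‖ := by positivity
    nlinarith
  refine ⟨L.mkContinuous _ hL, fun g => (hTmem g).coeFn_toLp,
    L.mkContinuous_norm_le (by positivity) hL, ?_⟩
  refine isCompactOperator_of_tendsto _ T (fun x => D * M * ‖weight x ^ η • v x‖)
    (hv.norm.const_mul _) (fun g => (hTmem g).coeFn_toLp) ?_ ?_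
  · intro g hg x
    refine (hT g x).trans ?_
    rw [mul_assoc, mul_assoc, mul_assoc]
    have := mul_le_of_le_one_left (norm_nonneg (weight x ^ η • v x)) hg
    gcongr
  · intro gs g hgs x
    refine Tendsto.const_mul _ ?_
    -- For fixed $x$ the convolution is the inner product of $g$ with the $L^2$ function
    -- $y\mapsto\overline{w(y)^{-r}K(x-y)}$, hence weakly continuous in $g$.
    have hk := (hDK' M K hM hK x).1.star
    have e : ∀ g : Lp ℂ 2 (volume : Measure ℝ),
        conv K (unweight r g) x = inner ℂ hk.toLp g := by
      intro g
      rw [L2.inner_def, conv]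
      refine integral_congr_ae ?_
      filter_upwards [hk.coeFn_toLp] with y hy
      rw [hy, RCLike.inner_apply, unweight]
      simp only [Pi.star_apply, RCLike.star_def, map_mul, Complex.conj_conj]
      ring
    simp_rw [e]
    exact hgs _

/-! ### Positivity of the quadratic form of $x\,K(x)$ -/

/-- The integrand `(e^{ixξ} - 1 - ixξ 1_{ξ ≤ 1}) / ξ²`, a second order regularisation of
`e^{ixξ} / ξ²`. -/
noncomputable def quadIntegrand (x ξ : ℝ) : ℂ :=
  (Complex.exp (Complex.I * x * ξ) - 1 - (if ξ ≤ 1 then Complex.I * x * ξ else 0)) / (ξ : ℂ) ^ 2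

/-- The dominating function of `quadIntegrand`. -/
noncomputable def quadBound (δ ξ : ℝ) : ℝ := if ξ ≤ 1 then ξ ^ (δ - 1) else ξ ^ (-2 : ℝ)

lemma integrableOn_quadBound {δ : ℝ} (hδ : 0 < δ) :
    IntegrableOn (quadBound δ) (Set.Ioi 0) := by
  have h1 : IntegrableOn (quadBound δ) (Set.Ioc 0 1) := by
    have := intervalIntegral.intervalIntegrable_rpow' (a := 0) (b := 1) (r := δ - 1) (by linarith)
    rw [intervalIntegrable_iff_integrableOn_Ioc_of_le zero_le_one] at this
    exact this.congr_fun (fun ξ hξ => (if_pos hξ.2).symm) measurableSet_Ioc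
  have h2 : IntegrableOn (quadBound δ) (Set.Ioi 1) :=
    (integrableOn_Ioi_rpow_of_lt (a := -2) (by norm_num) one_pos).congr_fun
      (fun ξ hξ => (if_neg (not_le.2 hξ)).symm) measurableSet_Ioi
  have := h1.union h2
  rwa [Set.Ioc_union_Ioi_eq_Ioi zero_le_one] at this

/-- For $\xi\le1$, with $a=|x|\xi$, the bound $a^{1+\delta}$ interpolates between the Taylor
remainder $a^2$ and the trivial linear bound. It leaves the integrable $\xi^{\delta-1}$ at $0$ and
needs only slightly more than one moment in $x$. -/
lemma norm_quadIntegrand_le {δ : ℝ} (h0 : 0 < δ) (h1 : δ < 1) (x : ℝ) {ξ : ℝ} (hξ : 0 < ξ) :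
    ‖quadIntegrand x ξ‖ ≤ 3 * weight x ^ (1 + δ) * quadBound δ ξ := by
  have hw := Real.one_le_rpow (one_le_weight x) (by linarith : 0 ≤ 1 + δ)
  have hnorm : ‖Complex.exp (Complex.I * x * ξ)‖ = 1 := by
    rw [mul_assoc, ← Complex.ofReal_mul, mul_comm, Complex.norm_exp_ofReal_mul_I]
  rw [quadIntegrand, quadBound, norm_div, norm_pow, Complex.norm_real, Real.norm_of_nonneg hξ.le]
  have hξ2 : 0 < ξ ^ 2 := by positivity
  rw [div_le_iff₀ hξ2]
  split_ifs with h
  · set a := |x| * ξ with ha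
    have ha0 : 0 ≤ a := by positivity
    have hia : ‖Complex.I * x * ξ‖ = a := by simp [ha, abs_of_pos hξ]
    have key : ‖Complex.exp (Complex.I * x * ξ) - 1 - Complex.I * x * ξ‖ ≤ 3 * a ^ (1 + δ) := by
      rcases le_total a 1 with hle | hge
      · refine (Complex.norm_exp_sub_one_sub_id_le (by rwa [hia])).trans ?_
        rw [hia]
        rcases ha0.eq_or_lt with h0a | h0a
        · rw [← h0a]; simp; positivity
        · have := Real.rpow_le_rpow_of_exponent_ge h0a hle (by push_cast; linarith : 1 + δ ≤ (2 : ℕ))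
          rw [Real.rpow_natCast] at this
          have : 0 ≤ a ^ (1 + δ) := by positivity
          linarith
      · have h2 : a ≤ a ^ (1 + δ) := by
          simpa using Real.rpow_le_rpow_of_exponent_le hge (by linarith : 1 ≤ 1 + δ)
        refine (norm_sub_le _ _).trans ?_
        rw [hia]
        have := norm_sub_le (Complex.exp (Complex.I * x * ξ)) 1
        rw [hnorm, norm_one] at this
        linarith
    refine key.trans ?_
    have e1 : a ^ (1 + δ) = |x| ^ (1 + δ) * ξ ^ (1 + δ) := Real.mul_rpow (abs_nonneg x) hξ.le
    have e2 : ξ ^ (δ - 1) * ξ ^ 2 = ξ ^ (1 + δ) := by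
      rw [← Real.rpow_natCast, ← Real.rpow_add hξ]; congr 1; push_cast; ring
    have e3 : |x| ^ (1 + δ) ≤ weight x ^ (1 + δ) :=
      Real.rpow_le_rpow (abs_nonneg x) (by unfold weight; linarith) (by linarith)
    rw [e1, mul_assoc, e2]
    have : 0 ≤ ξ ^ (1 + δ) := by positivity
    nlinarith
  · have e2 : ξ ^ (-2 : ℝ) * ξ ^ 2 = 1 := by
      rw [← Real.rpow_natCast, ← Real.rpow_add hξ]; simp
    rw [mul_assoc _ _ (ξ ^ 2), e2, sub_zero]
    have := norm_sub_le (Complex.exp (Complex.I * x * ξ)) 1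
    rw [hnorm, norm_one] at this
    linarith

lemma measurable_quadIntegrand : Measurable fun p : ℝ × ℝ => quadIntegrand p.1 p.2 := by
  unfold quadIntegrand
  refine Measurable.div (Measurable.sub (by fun_prop) (Measurable.ite ?_ (by fun_prop)
    measurable_const)) (by fun_prop)
  exact measurableSet_le measurable_snd measurable_const

lemma integrableOn_quadIntegrand (x : ℝ) : IntegrableOn (quadIntegrand x) (Set.Ioi 0) := by
  have h := (integrableOn_quadBound (δ := 1 / 2) (by norm_num)).const_mul
    (3 * weight x ^ (1 + 1 / 2 : ℝ))
  refine Integrable.mono' h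
    (measurable_quadIntegrand.comp (measurable_const.prodMk measurable_id)).aestronglyMeasurable ?_
  filter_upwards [ae_restrict_mem measurableSet_Ioi] with ξ hξ
  exact norm_quadIntegrand_le (by norm_num) (by norm_num) x hξ

lemma hasDerivAt_exp_sub_one_div (x : ℝ) {ξ : ℝ} (hξ : ξ ≠ 0) :
    HasDerivAt (fun ξ : ℝ => (Complex.exp (Complex.I * x * ξ) - 1) / (ξ : ℂ))
      (Complex.I * x * Complex.exp (Complex.I * x * ξ) / ξ -
        (Complex.exp (Complex.I * x * ξ) - 1) / (ξ : ℂ) ^ 2) ξ := by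
  have hξ' : (ξ : ℂ) ≠ 0 := by exact_mod_cast hξ
  have h1 : HasDerivAt (fun ξ : ℝ => Complex.I * x * (ξ : ℂ)) (Complex.I * x) ξ := by
    simpa using (hasDerivAt_id ξ).ofReal_comp.const_mul (Complex.I * x)
  have h2 : HasDerivAt (fun ξ : ℝ => (ξ : ℂ)) 1 ξ := (hasDerivAt_id ξ).ofReal_comp
  refine ((h1.cexp.sub_const 1).div h2 hξ').congr_deriv ?_
  field_simp

/-- Integration by parts: a primitive is $ix\,$`expLog`$(x\xi)-(e^{ix\xi}-1)/\xi$, whose second term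
vanishes at infinity. -/
lemma integral_quadIntegrand_Ioi_one {x : ℝ} (hx : 0 < x) :
    ∫ ξ in Set.Ioi (1 : ℝ), quadIntegrand x ξ =
      Complex.I * x * expLogLim - (Complex.I * x * expLog x - (Complex.exp (Complex.I * x) - 1)) := by
  have hx' : (x : ℂ) ≠ 0 := by exact_mod_cast hx.ne'
  have hd : ∀ ξ : ℝ, 0 < ξ → HasDerivAt (fun ξ : ℝ => Complex.I * x * expLog ((x * ξ : ℝ)) -
      (Complex.exp (Complex.I * x * ξ) - 1) / (ξ : ℂ))
      ((Complex.exp (Complex.I * x * ξ) - 1) / (ξ : ℂ) ^ 2) ξ := by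
    intro ξ hξ
    have hξ' : (ξ : ℂ) ≠ 0 := by exact_mod_cast hξ.ne'
    have hw := ofReal_mem_slitPlane_of_pos (mul_pos hx hξ)
    have h1 : HasDerivAt (fun ξ : ℝ => ((x * ξ : ℝ) : ℂ)) (x : ℂ) ξ := by
      simpa using ((hasDerivAt_id ξ).const_mul x).ofReal_comp
    refine ((((hasDerivAt_expLog hw).comp ξ h1).const_mul (Complex.I * x)).sub
      (hasDerivAt_exp_sub_one_div x hξ.ne')).congr_deriv ?_
    push_cast
    rw [← mul_assoc Complex.I]
    field_simp
    ring
  have hlim : Tendsto (fun ξ : ℝ => Complex.I * x * expLog ((x * ξ : ℝ)) -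
      (Complex.exp (Complex.I * x * ξ) - 1) / (ξ : ℂ)) atTop
      (𝓝 (Complex.I * x * expLogLim - 0)) := by
    refine ((tendsto_expLog_ofReal.comp (tendsto_id.const_mul_atTop hx)).const_mul _).sub ?_
    rw [tendsto_zero_iff_norm_tendsto_zero]
    have h2 : Tendsto (fun ξ : ℝ => 2 / ξ) atTop (𝓝 0) := tendsto_const_nhds.div_atTop tendsto_id
    refine squeeze_zero' (Eventually.of_forall fun _ => norm_nonneg _) ?_ h2
    filter_upwards [eventually_gt_atTop 0] with ξ hξ
    rw [norm_div, Complex.norm_real, Real.norm_of_nonneg hξ.le]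
    gcongr
    refine (norm_sub_le _ _).trans (le_of_eq ?_)
    rw [mul_assoc, ← Complex.ofReal_mul, mul_comm, Complex.norm_exp_ofReal_mul_I]
    norm_num
  have hcongr : Set.EqOn (quadIntegrand x)
      (fun ξ : ℝ => (Complex.exp (Complex.I * x * ξ) - 1) / (ξ : ℂ) ^ 2) (Set.Ioi 1) := by
    intro ξ hξ
    simp [quadIntegrand, not_le.2 (Set.mem_Ioi.1 hξ)]
  have hint := ((integrableOn_quadIntegrand x).mono_set
    (Set.Ioi_subset_Ioi zero_le_one)).congr_fun hcongr measurableSet_Ioi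
  rw [setIntegral_congr_fun measurableSet_Ioi hcongr,
    integral_Ioi_of_hasDerivAt_of_tendsto' (fun ξ hξ => hd ξ (one_pos.trans_le hξ)) hint hlim]
  simp

lemma integral_quadIntegrand_Ioc {x : ℝ} (hx : 0 < x) :
    ∫ ξ in Set.Ioc (0 : ℝ) 1, quadIntegrand x ξ =
      Complex.I * x * einInt x - (Complex.exp (Complex.I * x) - 1) + Complex.I * x := by
  have hx' : (x : ℂ) ≠ 0 := by exact_mod_cast hx.ne'
  rw [← intervalIntegral.integral_of_le zero_le_one]
  set P : ℝ → ℂ := fun ξ : ℝ => Complex.I * x * einInt ((x * ξ : ℝ)) -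
      (Complex.exp (Complex.I * x * ξ) - 1) / (ξ : ℂ) with hP
  have hd : ∀ ξ : ℝ, 0 < ξ → HasDerivAt P
      ((Complex.exp (Complex.I * x * ξ) - 1 - Complex.I * x * ξ) / (ξ : ℂ) ^ 2) ξ := by
    intro ξ hξ
    have hξ' : (ξ : ℂ) ≠ 0 := by exact_mod_cast hξ.ne'
    have hw : ((x * ξ : ℝ) : ℂ) ≠ 0 := by exact_mod_cast (mul_pos hx hξ).ne'
    have h1 : HasDerivAt (fun ξ : ℝ => ((x * ξ : ℝ) : ℂ)) (x : ℂ) ξ := by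
      simpa using ((hasDerivAt_id ξ).const_mul x).ofReal_comp
    refine ((((hasDerivAt_einInt hw).comp ξ h1).const_mul (Complex.I * x)).sub
      (hasDerivAt_exp_sub_one_div x hξ.ne')).congr_deriv ?_
    push_cast
    rw [← mul_assoc Complex.I]
    field_simp
    ring
  -- Division by zero gives $P(0)=0$, whereas the right limit is $-ix$; hence the fundamental
  -- theorem is used in its form with limits at the endpoints.
  have h0 : Tendsto P (𝓝[>] 0) (𝓝 (Complex.I * x * 0 - Complex.I * x)) := by
    refine Tendsto.sub (Tendsto.const_mul _ ?_) ?_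
    · rw [tendsto_zero_iff_norm_tendsto_zero]
      have hc : Continuous fun ξ : ℝ => ‖((x * ξ : ℝ) : ℂ)‖ * Real.exp ‖((x * ξ : ℝ) : ℂ)‖ := by
        fun_prop
      have hc0 := (hc.tendsto 0).mono_left (nhdsWithin_le_nhds (s := Set.Ioi 0))
      simp only [mul_zero, Complex.ofReal_zero, norm_zero, zero_mul] at hc0
      exact squeeze_zero (fun _ => norm_nonneg _) (fun ξ => norm_einInt_le _) hc0
    · have h1 : HasDerivAt (fun ξ : ℝ => Complex.exp (Complex.I * x * ξ)) (Complex.I * x) 0 := by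
        have h2 : HasDerivAt (fun ξ : ℝ => Complex.I * x * (ξ : ℂ)) (Complex.I * x) 0 := by
          simpa using (hasDerivAt_id (0 : ℝ)).ofReal_comp.const_mul (Complex.I * x)
        simpa using h2.cexp
      have h3 := h1.tendsto_slope.mono_left
        (nhdsWithin_mono 0 (fun ξ (hξ : 0 < ξ) => hξ.ne' : Set.Ioi (0 : ℝ) ⊆ {0}ᶜ))
      refine h3.congr fun ξ => ?_
      simp [slope, div_eq_inv_mul]
  have h1 : Tendsto P (𝓝[<] 1) (𝓝 (P 1)) :=
    ((hd 1 one_pos).continuousAt.tendsto).mono_left nhdsWithin_le_nhds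
  have hint : IntervalIntegrable (quadIntegrand x) volume 0 1 := by
    rw [intervalIntegrable_iff_integrableOn_Ioc_of_le zero_le_one]
    exact (integrableOn_quadIntegrand x).mono_set Set.Ioc_subset_Ioi_self
  rw [intervalIntegral.integral_eq_sub_of_hasDerivAt_of_tendsto one_pos (f := P)
    (fun ξ hξ => ?_) hint h0 h1]
  · simp [hP]
  · refine (hd ξ hξ.1).congr_deriv ?_
    simp [quadIntegrand, hξ.2.le]

lemma conj_zeroKernel_neg {x : ℝ} (hx : x ≠ 0) :
    (starRingEnd ℂ) (zeroKernel (-x)) = zeroKernel x := by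
  rw [zeroKernel, zeroKernel, Real.log_neg_eq_log, map_sub, Complex.conj_ofReal]
  rcases lt_or_gt_of_ne hx with h | h
  · rw [if_pos (neg_pos.2 h), if_neg h.le.not_gt]
  · rw [if_neg (by linarith), if_pos h, Complex.conj_conj]

/-- Up to an affine function of $x$, $ixK(x)$ is a superposition of the characters $e^{ix\xi}$,
$\xi>0$, with the positive density $\xi^{-2}$. This is the source of positivity in the uniqueness
proof. -/
lemma integral_quadIntegrand (x : ℝ) :
    ∫ ξ in Set.Ioi (0 : ℝ), quadIntegrand x ξ =
      Complex.I * (x * zeroKernel x) + Complex.I * x := by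
  have key : ∀ x : ℝ, 0 < x → ∫ ξ in Set.Ioi (0 : ℝ), quadIntegrand x ξ =
      Complex.I * (x * zeroKernel x) + Complex.I * x := by
    intro x hx
    rw [← Set.Ioc_union_Ioi_eq_Ioi zero_le_one, setIntegral_union
      (Set.Ioc_disjoint_Ioi le_rfl) measurableSet_Ioi
      ((integrableOn_quadIntegrand x).mono_set Set.Ioc_subset_Ioi_self)
      ((integrableOn_quadIntegrand x).mono_set (Set.Ioi_subset_Ioi zero_le_one)),
      integral_quadIntegrand_Ioc hx, integral_quadIntegrand_Ioi_one hx, zeroKernel, if_pos hx,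
      expLog, Complex.ofReal_log hx.le]
    ring
  rcases lt_trichotomy x 0 with h | rfl | h
  · have e : ∀ ξ, quadIntegrand x ξ = (starRingEnd ℂ) (quadIntegrand (-x) ξ) := by
      intro ξ
      simp only [quadIntegrand, map_div₀, map_sub, map_pow, Complex.conj_ofReal, map_one,
        ← Complex.exp_conj, apply_ite (starRingEnd ℂ), map_mul, map_zero, Complex.conj_I]
      push_cast
      ring_nf
    simp_rw [e]
    rw [integral_conj, key (-x) (neg_pos.2 h)]
    simp only [map_add, map_mul, Complex.conj_I, Complex.conj_ofReal, conj_zeroKernel_neg h.ne]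
    push_cast
    ring
  · simp [quadIntegrand]
  · exact key x h

lemma integrable_weight_mul {a r : ℝ} (h : a + 1 / 2 < r) {f : ℝ → ℂ}
    (hf : MemWeightedLp 2 r f) : Integrable fun y => ((weight y ^ a : ℝ) : ℂ) * f y := by
  have h1 : MemLp (fun y => ((weight y ^ (a - r) : ℝ) : ℂ)) 2 :=
    (memLp_weight_rpow (a := a - r) (by linarith)).ofReal
  refine (integral_norm_mul_le h1 hf).1.congr (Eventually.of_forall fun y => ?_)
  simp only [Complex.real_smul]
  rw [← mul_assoc, ← Complex.ofReal_mul, ← Real.rpow_add (weight_pos y), sub_add_cancel]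

lemma weight_sub_le (x y : ℝ) : weight (x - y) ≤ weight x * weight y := by
  have := abs_sub x y
  unfold weight
  nlinarith [abs_nonneg x, abs_nonneg y]

lemma integrable_of_norm_le_weight_mul {a : ℝ} {f g : ℝ → ℂ}
    (hf : Integrable fun y => ((weight y ^ a : ℝ) : ℂ) * f y) (hg : AEStronglyMeasurable g volume)
    (h : ∀ y, ‖g y‖ ≤ weight y ^ a * ‖f y‖) : Integrable g :=
  Integrable.mono' hf.norm hg (Eventually.of_forall fun y => by
    rw [norm_mul, Complex.norm_real, Real.norm_of_nonneg (weight_rpow_pos a y).le]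
    exact h y)

/-- The Fourier integral `∫ e^{-iξy} f(y) dy`. -/
noncomputable def fourierInt (f : ℝ → ℂ) (ξ : ℝ) : ℂ :=
  ∫ y : ℝ, Complex.exp (-(Complex.I * ξ * y)) * f y

lemma norm_exp_I_real (a b : ℝ) : ‖Complex.exp (Complex.I * a * b)‖ = 1 := by
  rw [mul_assoc, ← Complex.ofReal_mul, mul_comm, Complex.norm_exp_ofReal_mul_I]

lemma norm_exp_neg_I_real (a b : ℝ) : ‖Complex.exp (-(Complex.I * a * b))‖ = 1 := by
  have := norm_exp_I_real (-a) b
  rwa [Complex.ofReal_neg, mul_neg, neg_mul] at this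

lemma continuous_fourierInt {f : ℝ → ℂ} (hf : Integrable f) : Continuous (fourierInt f) := by
  refine continuous_of_dominated (bound := fun y => ‖f y‖) (fun ξ => ?_) (fun ξ => ?_) hf.norm ?_
  · exact (Continuous.aestronglyMeasurable (by fun_prop)).mul hf.1
  · refine Eventually.of_forall fun y => ?_
    rw [norm_mul, norm_exp_neg_I_real, one_mul]
  · exact Eventually.of_forall fun y => by fun_prop

section Quadratic

variable {δ : ℝ} {f : ℝ → ℂ}

/-- The weight is submultiplicative, $w(x-y)\le w(x)w(y)$, so the growth $w^{1+\delta}$ of the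
kernel is absorbed by the moments of the two factors. This licenses the exchange of integrals. -/
lemma integrable_quad_prod (h0 : 0 < δ) (h1 : δ < 1)
    (hf : Integrable fun y => ((weight y ^ (1 + δ) : ℝ) : ℂ) * f y)
    (hfm : AEStronglyMeasurable f volume) :
    Integrable (fun q : (ℝ × ℝ) × ℝ =>
      (starRingEnd ℂ) (f q.1.1) * f q.1.2 * quadIntegrand (q.1.1 - q.1.2) q.2)
      ((volume.prod volume).prod (volume.restrict (Set.Ioi 0))) := by
  have hb := (integrableOn_quadBound h0).const_mul 3
  have hdom := (hf.norm.mul_prod hf.norm).mul_prod hb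
  have hf1 : AEStronglyMeasurable (fun p : ℝ × ℝ => (starRingEnd ℂ) (f p.1) * f p.2)
      (volume.prod volume) :=
    (Complex.continuous_conj.comp_aestronglyMeasurable hfm.comp_fst).mul hfm.comp_snd
  have hmeas : AEStronglyMeasurable (fun q : (ℝ × ℝ) × ℝ =>
      (starRingEnd ℂ) (f q.1.1) * f q.1.2 * quadIntegrand (q.1.1 - q.1.2) q.2)
      ((volume.prod volume).prod (volume.restrict (Set.Ioi 0))) := by
    refine hf1.comp_fst.mul ?_
    exact (measurable_quadIntegrand.comp (g := quadIntegrand.uncurry) (f := fun q : (ℝ × ℝ) × ℝ =>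
      (q.1.1 - q.1.2, q.2)) (by fun_prop)).aestronglyMeasurable
  refine hdom.mono' hmeas ?_
  have hpos : ∀ᵐ q ∂((volume.prod volume).prod (volume.restrict (Set.Ioi 0)) :
      Measure ((ℝ × ℝ) × ℝ)), 0 < q.2 :=
    Measure.quasiMeasurePreserving_snd.ae (ae_restrict_mem measurableSet_Ioi)
  filter_upwards [hpos] with q hq
  rw [norm_mul, norm_mul, Complex.norm_conj, norm_mul, norm_mul, Complex.norm_real,
    Complex.norm_real, Real.norm_of_nonneg (weight_rpow_pos _ _).le,
    Real.norm_of_nonneg (weight_rpow_pos _ _).le]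
  have hq1 := norm_quadIntegrand_le h0 h1 (q.1.1 - q.1.2) hq
  have hw : weight (q.1.1 - q.1.2) ^ (1 + δ) ≤ weight q.1.1 ^ (1 + δ) * weight q.1.2 ^ (1 + δ) := by
    rw [← Real.mul_rpow (weight_pos _).le (weight_pos _).le]
    exact Real.rpow_le_rpow (weight_pos _).le (weight_sub_le _ _) (by linarith)
  have hb0 : 0 ≤ quadBound δ q.2 := by
    unfold quadBound
    have := hq.le
    split_ifs <;> positivity
  calc _ ≤ ‖f q.1.1‖ * ‖f q.1.2‖ *
        (3 * (weight q.1.1 ^ (1 + δ) * weight q.1.2 ^ (1 + δ)) * quadBound δ q.2) := by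
        gcongr
        exact hq1.trans (by gcongr)
    _ = _ := by ring

lemma integrable_conj_comp (hf : Integrable f) : Integrable fun y => (starRingEnd ℂ) (f y) :=
  hf.mono (Complex.continuous_conj.comp_aestronglyMeasurable hf.1)
    (Eventually.of_forall fun y => by rw [Complex.norm_conj])

/-- The constant and linear corrections each carry a factor $\int f$ or its conjugate, hence vanish.
The exponential factorises and leaves $|\hat f(\xi)|^2$. -/
lemma integral_quad_prod (hf : Integrable f) (hyf : Integrable fun y : ℝ => (y : ℂ) * f y)
    (hmean : ∫ y, f y = 0) (ξ : ℝ) :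
    ∫ p : ℝ × ℝ, (starRingEnd ℂ) (f p.1) * f p.2 * quadIntegrand (p.1 - p.2) ξ =
      ((‖fourierInt f ξ‖ ^ 2 / ξ ^ 2 : ℝ) : ℂ) := by
  set c : ℂ := if ξ ≤ 1 then Complex.I * ξ else 0 with hc
  set g : ℝ → ℂ := fun y => Complex.exp (-(Complex.I * ξ * y)) * f y with hg
  have hgi : Integrable g := by
    refine hf.mono ((Continuous.aestronglyMeasurable (by fun_prop)).mul hf.1)
      (Eventually.of_forall fun y => ?_)
    rw [norm_mul, norm_exp_neg_I_real, one_mul]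
  have hcf := integrable_conj_comp hf
  have hcg := integrable_conj_comp hgi
  have hcy := integrable_conj_comp hyf
  have e : ∀ p : ℝ × ℝ, (starRingEnd ℂ) (f p.1) * f p.2 * quadIntegrand (p.1 - p.2) ξ =
      ((starRingEnd ℂ) (g p.1) * g p.2 - (starRingEnd ℂ) (f p.1) * f p.2 -
        c * ((starRingEnd ℂ) (p.1 * f p.1) * f p.2 - (starRingEnd ℂ) (f p.1) * (p.2 * f p.2))) /
        (ξ : ℂ) ^ 2 := by
    intro p
    have h1 : (starRingEnd ℂ) (g p.1) * g p.2 = (starRingEnd ℂ) (f p.1) * f p.2 *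
        Complex.exp (Complex.I * (p.1 - p.2 : ℝ) * ξ) := by
      have : Complex.exp (Complex.I * (p.1 - p.2 : ℝ) * ξ) =
          Complex.exp (Complex.I * ξ * p.1) * Complex.exp (-(Complex.I * ξ * p.2)) := by
        rw [← Complex.exp_add]; congr 1; push_cast; ring
      rw [this]
      simp only [hg, map_mul, ← Complex.exp_conj, map_neg, Complex.conj_I, Complex.conj_ofReal]
      ring_nf
    have h2 : (if ξ ≤ 1 then Complex.I * (p.1 - p.2 : ℝ) * ξ else 0) = c * (p.1 - p.2) := by
      rw [hc]
      split_ifs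
      · push_cast; ring
      · simp
    rw [quadIntegrand, h1, h2, map_mul, Complex.conj_ofReal]
    ring
  simp_rw [e]
  have i1 : Integrable (fun p : ℝ × ℝ => (starRingEnd ℂ) (g p.1) * g p.2)
    (volume.prod volume) := hcg.mul_prod hgi
  have i2 : Integrable (fun p : ℝ × ℝ => (starRingEnd ℂ) (f p.1) * f p.2)
    (volume.prod volume) := hcf.mul_prod hf
  have i3 : Integrable (fun p : ℝ × ℝ => (starRingEnd ℂ) (p.1 * f p.1) * f p.2)
    (volume.prod volume) := hcy.mul_prod hf
  have i4 : Integrable (fun p : ℝ × ℝ => (starRingEnd ℂ) (f p.1) * (p.2 * f p.2))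
    (volume.prod volume) := hcf.mul_prod hyf
  have i12 : Integrable (fun p : ℝ × ℝ => (starRingEnd ℂ) (g p.1) * g p.2 -
    (starRingEnd ℂ) (f p.1) * f p.2) (volume.prod volume) := i1.sub i2
  have i34 : Integrable (fun p : ℝ × ℝ => c * ((starRingEnd ℂ) (p.1 * f p.1) * f p.2 -
    (starRingEnd ℂ) (f p.1) * (p.2 * f p.2))) (volume.prod volume) := (i3.sub i4).const_mul c
  rw [integral_div, Measure.volume_eq_prod, integral_sub i12 i34, integral_sub i1 i2,
    integral_const_mul, integral_sub i3 i4,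
    integral_prod_mul (fun x => (starRingEnd ℂ) (g x)) g,
    integral_prod_mul (fun x => (starRingEnd ℂ) (f x)) f,
    integral_prod_mul (fun x : ℝ => (starRingEnd ℂ) (x * f x)) f,
    integral_prod_mul (fun x => (starRingEnd ℂ) (f x)) (fun y : ℝ => y * f y), integral_conj,
    integral_conj, hmean]
  have : ∫ y, g y = fourierInt f ξ := rfl
  rw [this]
  simp only [map_zero, mul_zero, zero_mul, sub_zero]
  rw [← Complex.normSq_eq_conj_mul_self, Complex.normSq_eq_norm_sq]
  push_cast
  rfl

/-- If the quadratic form of the kernel `x · zeroKernel x` vanishes on a function of mean zero,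
then its Fourier integral vanishes on the positive half-line. -/
lemma fourierInt_eq_zero (h0 : 0 < δ) (h1 : δ < 1)
    (hf : Integrable fun y => ((weight y ^ (1 + δ) : ℝ) : ℂ) * f y)
    (hfm : AEStronglyMeasurable f volume) (hmean : ∫ y, f y = 0)
    (hq : ∫ p : ℝ × ℝ, (starRingEnd ℂ) (f p.1) * f p.2 *
      ((p.1 - p.2 : ℝ) * zeroKernel (p.1 - p.2)) = 0) {ξ : ℝ} (hξ : 0 < ξ) :
    fourierInt f ξ = 0 := by
  have hw1 : ∀ y, 1 ≤ weight y ^ (1 + δ) := fun y =>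
    Real.one_le_rpow (one_le_weight y) (by linarith)
  have hfi : Integrable f := integrable_of_norm_le_weight_mul hf hfm fun y =>
    le_mul_of_one_le_left (norm_nonneg _) (hw1 y)
  have hyf : Integrable fun y : ℝ => (y : ℂ) * f y := by
    refine integrable_of_norm_le_weight_mul hf
      (Complex.continuous_ofReal.aestronglyMeasurable.mul hfm) fun y => ?_
    rw [norm_mul, Complex.norm_real, Real.norm_eq_abs]
    gcongr
    have h2 : weight y ≤ weight y ^ (1 + δ) := by
      simpa using Real.rpow_le_rpow_of_exponent_le (one_le_weight y) (by linarith : 1 ≤ 1 + δ)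
    refine le_trans ?_ h2
    unfold weight; linarith
  have hcf := integrable_conj_comp hfi
  have hcy := integrable_conj_comp hyf
  have hQ := integrable_quad_prod h0 h1 hf hfm
  -- Integrating in $\xi$ first gives $i$ times the quadratic form plus a linear term; integrating
  -- in space first gives $\int_0^\infty|\hat f|^2\xi^{-2}d\xi$.
  have hswap := integral_integral_swap (f := fun (p : ℝ × ℝ) (ξ : ℝ) =>
    (starRingEnd ℂ) (f p.1) * f p.2 * quadIntegrand (p.1 - p.2) ξ) hQ
  have hlin : Integrable (fun p : ℝ × ℝ => (starRingEnd ℂ) (f p.1) * f p.2 * (p.1 - p.2 : ℝ))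
      (volume.prod volume) := by
    refine ((hcy.mul_prod hfi).sub (hcf.mul_prod hyf)).congr (Eventually.of_forall fun p => ?_)
    simp only [Pi.sub_apply, map_mul, Complex.conj_ofReal]
    push_cast
    ring
  have hlin0 : ∫ p : ℝ × ℝ, (starRingEnd ℂ) (f p.1) * f p.2 * (p.1 - p.2 : ℝ)
      ∂(volume.prod volume) = 0 := by
    have e : ∀ p : ℝ × ℝ, (starRingEnd ℂ) (f p.1) * f p.2 * (p.1 - p.2 : ℝ) =
        (starRingEnd ℂ) (p.1 * f p.1) * f p.2 - (starRingEnd ℂ) (f p.1) * (p.2 * f p.2) := by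
      intro p
      rw [map_mul, Complex.conj_ofReal]
      push_cast
      ring
    simp_rw [e]
    rw [integral_sub (hcy.mul_prod hfi) (hcf.mul_prod hyf),
      integral_prod_mul (fun x : ℝ => (starRingEnd ℂ) (x * f x)) f,
      integral_prod_mul (fun x => (starRingEnd ℂ) (f x)) (fun y : ℝ => y * f y), integral_conj,
      integral_conj, hmean]
    simp
  have hleft := hQ.integral_prod_left
  simp only [integral_const_mul, integral_quadIntegrand] at hswap hleft
  have e2 : ∀ p : ℝ × ℝ, (starRingEnd ℂ) (f p.1) * f p.2 *
      (Complex.I * ((p.1 - p.2 : ℝ) * zeroKernel (p.1 - p.2)) + Complex.I * (p.1 - p.2 : ℝ)) =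
      Complex.I * ((starRingEnd ℂ) (f p.1) * f p.2 *
        ((p.1 - p.2 : ℝ) * zeroKernel (p.1 - p.2))) +
      Complex.I * ((starRingEnd ℂ) (f p.1) * f p.2 * (p.1 - p.2 : ℝ)) := fun p => by ring
  simp_rw [e2] at hswap hleft
  have hmain : Integrable (fun p : ℝ × ℝ => Complex.I * ((starRingEnd ℂ) (f p.1) * f p.2 *
        ((p.1 - p.2 : ℝ) * zeroKernel (p.1 - p.2)))) (volume.prod volume) := by
    refine (hleft.sub (hlin.const_mul Complex.I)).congr (Eventually.of_forall fun p => ?_)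
    simp only [Pi.sub_apply, add_sub_cancel_right]
  rw [integral_add hmain (hlin.const_mul _), integral_const_mul, integral_const_mul, hlin0,
    ← Measure.volume_eq_prod, hq] at hswap
  simp_rw [integral_quad_prod hfi hyf hmean] at hswap
  rw [integral_complex_ofReal, mul_zero, add_zero] at hswap
  have hright := hQ.integral_prod_right
  simp only [← Measure.volume_eq_prod, integral_quad_prod hfi hyf hmean] at hright
  have hright' : Integrable (fun ξ : ℝ => ‖fourierInt f ξ‖ ^ 2 / ξ ^ 2)
      (volume.restrict (Set.Ioi 0)) :=
    hright.re.congr (Eventually.of_forall fun ξ => Complex.ofReal_re _)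
  have hzero : ∫ ξ in Set.Ioi (0 : ℝ), ‖fourierInt f ξ‖ ^ 2 / ξ ^ 2 = 0 := by
    exact_mod_cast hswap.symm
  rw [integral_eq_zero_iff_of_nonneg (fun ξ => by positivity) hright'] at hzero
  have hae : fourierInt f =ᵐ[volume.restrict (Set.Ioi 0)] fun _ => (0 : ℂ) := by
    filter_upwards [hzero, ae_restrict_mem measurableSet_Ioi] with ξ h hξ
    have hξ' : (ξ : ℝ) ≠ 0 := (Set.mem_Ioi.1 hξ).ne'
    simpa [hξ'] using h
  -- Continuity of the Fourier integral turns vanishing almost everywhere into vanishing everywhere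
  -- on the open half-line.
  exact Measure.eqOn_open_of_ae_eq hae isOpen_Ioi (continuous_fourierInt hfi).continuousOn
    continuousOn_const hξ

end Quadratic

/-! ### Pairings with the zero-energy kernel -/

lemma exists_kernelBound_zeroKernel {η : ℝ} (hη : 0 < η) :
    ∃ M : ℝ, 0 ≤ M ∧ KernelBound η M zeroKernel := by
  refine ⟨‖expLogLim‖ + 1 / η, by positivity, measurable_zeroKernel.aestronglyMeasurable,
    fun x hx => ?_⟩
  have hps := one_le_powSum hη.le hx
  have hlog := abs_log_le_powSum hη hx
  rw [zeroKernel]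
  refine (norm_sub_le _ _).trans ?_
  rw [Complex.norm_real, Real.norm_eq_abs]
  have h1 : ‖if 0 < x then expLogLim else (starRingEnd ℂ) expLogLim‖ = ‖expLogLim‖ := by
    split_ifs <;> simp
  rw [h1, add_mul]
  refine add_le_add (le_mul_of_one_le_right (norm_nonneg _) hps) (hlog.trans (le_of_eq ?_))
  ring

lemma MemWeightedLp.mono_exponent {r r' : ℝ} (h : r' ≤ r) {f : ℝ → ℂ}
    (hf : MemWeightedLp 2 r f) : MemWeightedLp 2 r' f := by
  refine MemLp.mono hf ((continuous_weight_rpow r').aestronglyMeasurable.smul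
    hf.aestronglyMeasurable) (Eventually.of_forall fun x => ?_)
  rw [norm_smul, norm_smul, Real.norm_of_nonneg (weight_rpow_pos _ _).le,
    Real.norm_of_nonneg (weight_rpow_pos _ _).le]
  gcongr
  exact one_le_weight x

/-- Multiplication by a function of size `w^b` costs `b` powers of the weight. -/
lemma MemWeightedLp.mul_of_norm_le {r b C : ℝ} {f g : ℝ → ℂ} (hf : MemWeightedLp 2 r f)
    (hg : AEStronglyMeasurable g volume) (h : ∀ᵐ x, ‖g x‖ ≤ C * weight x ^ b * ‖f x‖) :
    MemWeightedLp 2 (r - b) g := by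
  refine MemLp.mono' (g := fun x => C * ‖weight x ^ r • f x‖) (hf.norm.const_mul C)
    ((continuous_weight_rpow _).aestronglyMeasurable.smul hg) ?_
  filter_upwards [h] with x hx
  rw [norm_smul, norm_smul, Real.norm_of_nonneg (weight_rpow_pos _ _).le,
    Real.norm_of_nonneg (weight_rpow_pos _ _).le]
  have e : weight x ^ r = weight x ^ (r - b) * weight x ^ b := by
    rw [← Real.rpow_add (weight_pos x), sub_add_cancel]
  have := (weight_rpow_pos (r - b) x).le
  calc _ ≤ weight x ^ (r - b) * (C * weight x ^ b * ‖f x‖) := by gcongr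
    _ = _ := by rw [e]; ring

lemma ae_prod_sub_ne_zero :
    ∀ᵐ p : ℝ × ℝ ∂(volume.prod volume), p.1 - p.2 ≠ 0 :=
  (quasiMeasurePreserving_sub volume volume).ae ae_ne_zero

lemma integral_prod_conv {η r M : ℝ} (h0 : 0 < η) (h1 : η < 1 / 2) (hr : 1 / 2 + η < r)
    (hM : 0 ≤ M) {K f a : ℝ → ℂ} (hK : KernelBound η M K) (hf : MemWeightedLp 2 r f)
    (ham : AEStronglyMeasurable a volume)
    (ha : Integrable fun x => ((weight x ^ η : ℝ) : ℂ) * a x) :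
    Integrable (fun p : ℝ × ℝ => a p.1 * (K (p.1 - p.2) * f p.2)) (volume.prod volume) ∧
      ∫ p : ℝ × ℝ, a p.1 * (K (p.1 - p.2) * f p.2) = ∫ x, a x * conv K f x := by
  obtain ⟨D, hD, hDK⟩ := exists_conv_bound h0 h1 hr
  have hmeas : AEStronglyMeasurable (fun p : ℝ × ℝ => a p.1 * (K (p.1 - p.2) * f p.2))
      (volume.prod volume) :=
    ham.comp_fst.mul ((hK.meas.comp_quasiMeasurePreserving
      (quasiMeasurePreserving_sub volume volume)).mul hf.aestronglyMeasurable.comp_snd)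
  have hint : Integrable (fun p : ℝ × ℝ => a p.1 * (K (p.1 - p.2) * f p.2))
      (volume.prod volume) := by
    rw [integrable_prod_iff hmeas]
    refine ⟨Eventually.of_forall fun x => (hDK M K hM hK f hf x).1.const_mul (a x), ?_⟩
    refine Integrable.mono' (ha.norm.mul_const (D * M * (weightedNorm 2 r f).toReal))
      hmeas.norm.integral_prod_right' (Eventually.of_forall fun x => ?_)
    rw [Real.norm_of_nonneg (integral_nonneg fun _ => norm_nonneg _)]
    simp only [norm_mul (a x)]
    rw [integral_const_mul, norm_mul, Complex.norm_real,
      Real.norm_of_nonneg (weight_rpow_pos _ _).le]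
    calc _ ≤ ‖a x‖ * (D * M * weight x ^ η * (weightedNorm 2 r f).toReal) := by
          gcongr
          exact (hDK M K hM hK f hf x).2
      _ = _ := by ring
  refine ⟨hint, ?_⟩
  rw [Measure.volume_eq_prod, integral_prod _ hint]
  simp_rw [integral_const_mul]
  rfl

/-- The Hermitian symmetry of `zeroKernel`. -/
lemma conj_integral_zeroKernel (a b : ℝ → ℂ) :
    (starRingEnd ℂ) (∫ p : ℝ × ℝ, (starRingEnd ℂ) (a p.1) * (zeroKernel (p.1 - p.2) * b p.2)) =
      ∫ p : ℝ × ℝ, (starRingEnd ℂ) (b p.1) * (zeroKernel (p.1 - p.2) * a p.2) := by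
  rw [← integral_conj, Measure.volume_eq_prod, ← integral_prod_swap]
  refine integral_congr_ae ?_
  filter_upwards [ae_prod_sub_ne_zero] with p hp
  simp only [Prod.fst_swap, Prod.snd_swap, map_mul, Complex.conj_conj]
  rw [← neg_sub p.1 p.2, conj_zeroKernel_neg hp]
  ring

/-- With $f=u\varphi$ the integrand is $\rho\,u\,|\varphi|^2$, which is real because $\rho$ and $u$
are. It is used with $\rho=1$ and $\rho(x)=x$. -/
lemma conj_integral_of_eq_mul {u ρ : ℝ → ℝ} {f φ : ℝ → ℂ}
    (h : f =ᵐ[volume] fun x => (u x : ℂ) * φ x) :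
    (starRingEnd ℂ) (∫ x, (starRingEnd ℂ) (ρ x * f x) * φ x) =
      ∫ x, (starRingEnd ℂ) (ρ x * f x) * φ x := by
  rw [← integral_conj]
  refine integral_congr_ae ?_
  filter_upwards [h] with x hx
  rw [hx]
  simp only [map_mul, Complex.conj_conj, Complex.conj_ofReal]
  ring

/-- If `f` has mean zero and its Fourier integral vanishes on the positive half-line, then its
convolution with the zero-energy kernel vanishes. -/
lemma conv_zeroKernel_eq_zero {r : ℝ} (hr : 3 / 2 < r) {f : ℝ → ℂ} (hf : MemWeightedLp 2 r f)
    (hmean : ∫ y, f y = 0) (hF : ∀ ξ : ℝ, 0 < ξ → fourierInt f ξ = 0) (x : ℝ) :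
    conv zeroKernel f x = 0 := by
  have hfm := hf.aestronglyMeasurable
  have hfi : Integrable f := by
    have := integrable_weight_mul (a := 0) (by linarith) hf
    simpa using this
  have hwf : Integrable fun y => ((weight y ^ (1 : ℝ) : ℝ) : ℂ) * f y :=
    integrable_weight_mul (by linarith) hf
  have hker : ∀ (y n t : ℝ), Complex.exp (Complex.I * (((x - y : ℝ) : ℂ) * n) * t) - 1 =
      Complex.exp (Complex.I * x * (n * t)) * Complex.exp (-(Complex.I * (n * t : ℝ) * y)) - 1 := by
    intro y n t
    rw [← Complex.exp_add]
    congr 2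
    push_cast
    ring
  -- `einInt`$((x-y)n)$ integrates $(e^{i(x-y)nt}-1)/t$ over $0<t\le1$. The frequency $nt$ is
  -- positive, so $\hat f(nt)=0$ kills the exponential and the zero mean kills the $-1$.
  have hzero : ∀ n : ℝ, 1 ≤ n → ∫ y, einInt ((x - y : ℝ) * n) * f y = 0 := by
    intro n hn
    have hn0 : 0 < n := by linarith
    have hprod : Integrable (fun p : ℝ × ℝ =>
        (Complex.exp (Complex.I * (((x - p.1 : ℝ) : ℂ) * n) * p.2) - 1) / (p.2 : ℂ) * f p.1)
        (volume.prod (volume.restrict (Set.Ioc 0 1))) := by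
      have hdom := (hwf.norm.const_mul (n * weight x)).mul_prod
        (integrable_const (1 : ℝ) : Integrable _ (volume.restrict (Set.Ioc (0 : ℝ) 1)))
      refine hdom.mono' ?_ (Eventually.of_forall fun p => ?_)
      · refine AEStronglyMeasurable.mul ?_ hfm.comp_fst
        apply Measurable.aestronglyMeasurable
        fun_prop
      · have h1 := Real.norm_exp_I_mul_ofReal_sub_one_le (x := (x - p.1) * n * p.2)
        have h2 : ‖(Complex.exp (Complex.I * (((x - p.1 : ℝ) : ℂ) * n) * p.2) - 1) / (p.2 : ℂ)‖ ≤
            n * |x - p.1| := by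
          rw [norm_div, Complex.norm_real]
          refine div_le_of_le_mul₀ (norm_nonneg _) (by positivity) ?_
          refine (le_of_eq ?_).trans (h1.trans (le_of_eq ?_))
          · congr 3
            push_cast
            ring
          · rw [norm_mul, norm_mul, Real.norm_of_nonneg hn0.le, Real.norm_eq_abs]
            ring
        rw [norm_mul, norm_mul, Complex.norm_real, Real.norm_of_nonneg (weight_rpow_pos _ _).le,
          Real.rpow_one, mul_one]
        calc _ ≤ n * |x - p.1| * ‖f p.1‖ := by gcongr
          _ ≤ n * (weight x * weight p.1) * ‖f p.1‖ := by
            gcongr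
            exact abs_sub_le_weight_mul x p.1
          _ = _ := by ring
    have hsw := integral_integral_swap (f := fun (y t : ℝ) =>
      (Complex.exp (Complex.I * (((x - y : ℝ) : ℂ) * n) * t) - 1) / (t : ℂ) * f y) hprod
    have hl : ∀ y : ℝ, ∫ t in Set.Ioc (0 : ℝ) 1,
        (Complex.exp (Complex.I * (((x - y : ℝ) : ℂ) * n) * t) - 1) / (t : ℂ) * f y =
        einInt ((x - y : ℝ) * n) * f y := by
      intro y
      rw [integral_mul_const, einInt, intervalIntegral.integral_of_le zero_le_one]
    simp_rw [hl] at hsw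
    rw [hsw]
    refine setIntegral_eq_zero_of_forall_eq_zero fun t ht => ?_
    have e : ∀ y : ℝ, (Complex.exp (Complex.I * (((x - y : ℝ) : ℂ) * n) * t) - 1) / (t : ℂ) * f y =
        (Complex.exp (Complex.I * x * (n * t)) *
          (Complex.exp (-(Complex.I * (n * t : ℝ) * y)) * f y) - f y) / (t : ℂ) := by
      intro y
      rw [hker]
      ring
    simp_rw [e]
    have hi : Integrable fun y : ℝ => Complex.exp (-(Complex.I * (n * t : ℝ) * y)) * f y := by
      refine hfi.mono ((Continuous.aestronglyMeasurable (by fun_prop)).mul hfm)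
        (Eventually.of_forall fun y => ?_)
      rw [norm_mul, norm_exp_neg_I_real, one_mul]
    have hFt : ∫ y : ℝ, Complex.exp (-(Complex.I * (n * t : ℝ) * y)) * f y = 0 :=
      hF (n * t) (mul_pos hn0 ht.1)
    rw [integral_div, integral_sub (hi.const_mul _) hfi, integral_const_mul, hFt, hmean]
    simp
  obtain ⟨C, hC, hCb⟩ := norm_einInt_add_log_le
  set L : ℝ → ℂ := fun x => ((C + |Real.log x| : ℝ) : ℂ) with hL
  have hLK : KernelBound (1 / 4) (C + 4) L := by
    refine ⟨Measurable.aestronglyMeasurable (by fun_prop), fun x hx => ?_⟩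
    have hps := one_le_powSum (η := 1 / 4) (by norm_num) hx
    have hlog := abs_log_le_powSum (η := 1 / 4) (by norm_num) hx
    rw [hL, Complex.norm_real, Real.norm_of_nonneg (by positivity)]
    nlinarith
  obtain ⟨D, hD, hDK⟩ := exists_conv_bound (η := 1 / 4) (r := r) (by norm_num) (by norm_num)
    (by linarith)
  have hdom := (hDK _ L (by positivity) hLK f hf x).1.norm
  -- $K(x-y)$ is the limit of `einInt`$((x-y)n)+\log n$, dominated uniformly in $n\ge1$. The added
  -- constant $\log n$ does not contribute, since $f$ has mean zero.
  have hlim : Tendsto (fun n : ℝ => ∫ y, (einInt ((x - y : ℝ) * n) + (Real.log n : ℂ)) * f y)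
      atTop (𝓝 (conv zeroKernel f x)) := by
    refine tendsto_integral_filter_of_dominated_convergence _ ?_ ?_ hdom ?_
    · refine Eventually.of_forall fun n => ?_
      refine AEStronglyMeasurable.mul (Measurable.aestronglyMeasurable ?_) hfm
      have := measurable_einInt
      fun_prop
    · filter_upwards [eventually_ge_atTop 1] with n hn
      filter_upwards [ae_sub_ne_zero x] with y hy
      rw [norm_mul, norm_mul, hL, Complex.norm_real, Real.norm_of_nonneg (by positivity)]
      gcongr
      exact hCb _ hy n hn
    · filter_upwards [ae_sub_ne_zero x] with y hy
      exact (tendsto_einInt_add_log hy).mul_const (f y)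
  refine tendsto_nhds_unique hlim (tendsto_const_nhds.congr' ?_)
  filter_upwards [eventually_ge_atTop 1] with n hn
  have e : ∀ y, (einInt ((x - y : ℝ) * n) + (Real.log n : ℂ)) * f y =
      (einInt ((x - y : ℝ) * n)) * f y + (Real.log n : ℂ) * f y := fun y => by ring
  have hn0 : 0 < n := by linarith
  have hein : Integrable fun y => (einInt ((x - y : ℝ) * n)) * f y := by
    have h1 : Integrable fun y => (einInt ((x - y : ℝ) * n) + (Real.log n : ℂ)) * f y := by
      refine hdom.mono' ?_ ?_
      · refine AEStronglyMeasurable.mul (Measurable.aestronglyMeasurable ?_) hfm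
        have := measurable_einInt
        fun_prop
      · filter_upwards [ae_sub_ne_zero x] with y hy
        rw [norm_mul, norm_mul, hL, Complex.norm_real, Real.norm_of_nonneg (by positivity)]
        gcongr
        exact hCb _ hy n hn
    refine (h1.sub (hfi.const_mul (Real.log n : ℂ))).congr (Eventually.of_forall fun y => ?_)
    simp only [Pi.sub_apply]
    ring
  simp_rw [e]
  rw [integral_add hein (hfi.const_mul _), hzero n hn, integral_const_mul, hmean]
  simp

/-! ### Decay gained from mean zero -/

/-- For $|t|\le\frac12$ the logarithm is at most $\frac32|t|\le\frac32|t|^\theta$. For larger $|t|$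
it is bounded by powers of $|1-t|\le3|t|$, and $|t|^\theta$ is bounded below. -/
lemma abs_log_one_sub_le {η θ : ℝ} (hη : 0 < η) (hηθ : η ≤ θ) (hθ : θ ≤ 1) {t : ℝ}
    (ht : 1 - t ≠ 0) :
    |Real.log (1 - t)| ≤ (3 / η + 2) * (|t| ^ θ * (1 + |1 - t| ^ (-η))) := by
  have hθ0 : 0 < θ := hη.trans_le hηθ
  have hp : 0 ≤ |1 - t| ^ (-η) := by positivity
  have htθ : 0 ≤ |t| ^ θ := by positivity
  rcases le_total |t| (1 / 2) with h | h
  · have h1 := Complex.norm_log_one_add_half_le_self (z := -(t : ℂ)) (by simpa using h)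
    have h2 : Complex.log (1 + -(t : ℂ)) = (Real.log (1 - t) : ℂ) := by
      rw [Complex.ofReal_log (by linarith [le_abs_self t])]
      push_cast
      ring_nf
    rw [h2, Complex.norm_real, norm_neg, Complex.norm_real, Real.norm_eq_abs,
      Real.norm_eq_abs] at h1
    have h3 : |t| ≤ |t| ^ θ := by
      rcases (abs_nonneg t).eq_or_lt with h0 | h0
      · rw [← h0, Real.zero_rpow hθ0.ne']
      · simpa using Real.rpow_le_rpow_of_exponent_ge h0 (by linarith) hθ
    have h4 : 0 ≤ |t| ^ θ * |1 - t| ^ (-η) := by positivity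
    have h5 : 0 ≤ 3 / η * (|t| ^ θ * (1 + |1 - t| ^ (-η))) := by positivity
    nlinarith
  · have h1 := abs_log_le_powSum hη ht
    have h2 : |1 - t| ≤ 3 * |t| := by
      have := abs_sub 1 t
      rw [abs_one] at this
      linarith
    have h3 : (1 : ℝ) ≤ 3 * |t| ^ θ := by
      have h6 : (1 : ℝ) ≤ (2 * |t|) ^ θ := Real.one_le_rpow (by linarith) hθ0.le
      rw [Real.mul_rpow zero_le_two (abs_nonneg t)] at h6
      have h7 : (2 : ℝ) ^ θ ≤ 2 := by
        simpa using Real.rpow_le_rpow_of_exponent_le one_le_two hθ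
      nlinarith
    have h4 : |1 - t| ^ η ≤ 3 * |t| ^ θ := by
      calc |1 - t| ^ η ≤ (3 * |t|) ^ η := Real.rpow_le_rpow (abs_nonneg _) h2 hη.le
        _ ≤ (3 * |t|) ^ θ := Real.rpow_le_rpow_of_exponent_le (by linarith) hηθ
        _ = 3 ^ θ * |t| ^ θ := Real.mul_rpow (by norm_num) (abs_nonneg t)
        _ ≤ 3 * |t| ^ θ := by
          gcongr
          simpa using Real.rpow_le_rpow_of_exponent_le (by norm_num : (1 : ℝ) ≤ 3) hθ
    have h5 : powSum η (1 - t) ≤ 3 * (|t| ^ θ * (1 + |1 - t| ^ (-η))) := by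
      unfold powSum
      nlinarith
    have h6 : 0 ≤ |t| ^ θ * (1 + |1 - t| ^ (-η)) := by positivity
    calc _ ≤ powSum η (1 - t) / η := h1
      _ ≤ 3 * (|t| ^ θ * (1 + |1 - t| ^ (-η))) / η := by gcongr
      _ = 3 / η * (|t| ^ θ * (1 + |1 - t| ^ (-η))) := by ring
      _ ≤ _ := by nlinarith

/-- The logarithms differ by $\log|1-y/x|$. The sign-dependent constant changes only if $|y|\ge|x|$,
and there $|y/x|^\theta\ge1$ pays for it. -/
lemma norm_zeroKernel_sub_le {η θ : ℝ} (hη : 0 < η) (hηθ : η ≤ θ) (hθ : θ ≤ 1) :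
    ∃ C : ℝ, 0 ≤ C ∧ ∀ x y : ℝ, x ≠ 0 → x - y ≠ 0 →
      ‖zeroKernel (x - y) - zeroKernel x‖ ≤
        C * (|y / x| ^ θ * (1 + |1 - y / x| ^ (-η))) := by
  refine ⟨2 * ‖expLogLim‖ + (3 / η + 2), by positivity, fun x y hx hxy => ?_⟩
  have hθ0 : 0 < θ := hη.trans_le hηθ
  have e1 : x - y = x * (1 - y / x) := by field_simp
  have ht : 1 - y / x ≠ 0 := by
    intro h
    rw [e1, h, mul_zero] at hxy
    exact hxy rfl
  have hl : Real.log (x - y) = Real.log x + Real.log (1 - y / x) := by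
    rw [e1, Real.log_mul hx ht]
  have hlog := abs_log_one_sub_le hη hηθ hθ ht
  set S := |y / x| ^ θ * (1 + |1 - y / x| ^ (-η)) with hS
  have hS0 : 0 ≤ S := by positivity
  have hc : ‖(if 0 < x - y then expLogLim else (starRingEnd ℂ) expLogLim) -
      (if 0 < x then expLogLim else (starRingEnd ℂ) expLogLim)‖ ≤ 2 * ‖expLogLim‖ * S := by
    by_cases h : (0 < x - y ↔ 0 < x)
    · simp only [h, sub_self, norm_zero]
      positivity
    · have h1 : 1 ≤ |y / x| := by
        rw [abs_div, one_le_div (abs_pos.2 hx)]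
        by_contra! h2
        apply h
        rw [abs_lt] at h2
        constructor
        · intro h3
          by_contra! h4
          rw [abs_of_nonpos h4] at h2
          linarith
        · intro h3
          rw [abs_of_pos h3] at h2
          linarith
      have h2 : 1 ≤ S := by
        have h3 := Real.one_le_rpow h1 hθ0.le
        have h4 : 0 ≤ |1 - y / x| ^ (-η) := by positivity
        nlinarith
      refine (norm_sub_le _ _).trans ?_
      have h5 : ∀ p : Prop, [Decidable p] →
          ‖if p then expLogLim else (starRingEnd ℂ) expLogLim‖ = ‖expLogLim‖ := by
        intro p _
        split_ifs <;> simp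
      rw [h5, h5]
      nlinarith [norm_nonneg expLogLim]
  have e2 : zeroKernel (x - y) - zeroKernel x =
      ((if 0 < x - y then expLogLim else (starRingEnd ℂ) expLogLim) -
      (if 0 < x then expLogLim else (starRingEnd ℂ) expLogLim)) -
        (Real.log (1 - y / x) : ℂ) := by
    rw [zeroKernel, zeroKernel, hl]
    push_cast
    ring
  rw [e2]
  refine (norm_sub_le _ _).trans ?_
  rw [Complex.norm_real, Real.norm_eq_abs]
  linarith

/-- Mean zero turns the logarithmic growth of the convolution into decay. -/
lemma exists_norm_conv_zeroKernel_le {η θ r : ℝ} (hη : 0 < η) (hη2 : η < 1 / 2) (hηθ : η ≤ θ)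
    (hθ : θ ≤ 1) (hr : θ + 1 / 2 + η < r) {f : ℝ → ℂ} (hf : MemWeightedLp 2 r f)
    (hmean : ∫ y, f y = 0) :
    ∃ C : ℝ, ∀ x, ‖conv zeroKernel f x‖ ≤ C * weight x ^ (2 * η - θ) := by
  have hθ0 : 0 < θ := hη.trans_le hηθ
  have hfm := hf.aestronglyMeasurable
  obtain ⟨C, hC, hCb⟩ := norm_zeroKernel_sub_le hη hηθ hθ
  obtain ⟨M, hM, hK⟩ := exists_kernelBound_zeroKernel hη
  obtain ⟨D, hD, hDK⟩ := exists_conv_bound hη hη2 (by linarith : 1 / 2 + η < r)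
  obtain ⟨D', hD', hDK'⟩ := exists_conv_bound hη hη2 (by linarith : 1 / 2 + η < r - θ)
  have hP : KernelBound η 1 (fun x => (powSum η x : ℂ)) := by
    refine ⟨(Complex.measurable_ofReal.comp (measurable_powSum η)).aestronglyMeasurable,
      fun x _ => ?_⟩
    rw [Complex.norm_real, Real.norm_of_nonneg (powSum_nonneg η x), one_mul]
  set g : ℝ → ℂ := fun y => ((|y| ^ θ : ℝ) : ℂ) * f y with hg
  have hgn : ∀ y, ‖g y‖ = |y| ^ θ * ‖f y‖ := by
    intro y
    rw [hg, norm_mul, Complex.norm_real, Real.norm_of_nonneg (by positivity)]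
  have hgm : MemWeightedLp 2 (r - θ) g := by
    refine hf.mul_of_norm_le (C := 1) (AEStronglyMeasurable.mul
      (Measurable.aestronglyMeasurable (by fun_prop)) hfm) (Eventually.of_forall fun y => ?_)
    rw [hgn, one_mul]
    gcongr
    unfold weight
    linarith
  set N := (weightedNorm 2 r f).toReal with hN
  set N' := (weightedNorm 2 (r - θ) g).toReal with hN'
  have hN0 : 0 ≤ N := ENNReal.toReal_nonneg
  have hN0' : 0 ≤ N' := ENNReal.toReal_nonneg
  have hfi : Integrable f := by
    have := integrable_weight_mul (a := 0) (by linarith) hf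
    simpa using this
  -- The first summand covers $|x|\le1$, where there is nothing to gain; the second covers
  -- $|x|\ge1$.
  refine ⟨2 * (D * M * N) + 4 * C * D' * N', fun x => ?_⟩
  have hwp := weight_rpow_pos (2 * η - θ) x
  have hw := weight_pos x
  rcases le_total |x| 1 with hx | hx
  · have h1 := (norm_conv_le zeroKernel f x).trans (hDK M _ hM hK f hf x).2
    have h2 : weight x ^ η ≤ 2 * weight x ^ (2 * η - θ) := by
      have h3 : weight x ^ (θ - η) ≤ 2 := by
        calc weight x ^ (θ - η) ≤ 2 ^ (θ - η) := by
              refine Real.rpow_le_rpow hw.le ?_ (by linarith)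
              unfold weight; linarith
          _ ≤ 2 ^ (1 : ℝ) := Real.rpow_le_rpow_of_exponent_le one_le_two (by linarith)
          _ = 2 := Real.rpow_one 2
      have h4 : weight x ^ η = weight x ^ (θ - η) * weight x ^ (2 * η - θ) := by
        rw [← Real.rpow_add hw]; congr 1; ring
      rw [h4]
      gcongr
    calc _ ≤ D * M * weight x ^ η * N := h1
      _ ≤ D * M * (2 * weight x ^ (2 * η - θ)) * N := by gcongr
      _ = 2 * (D * M * N) * weight x ^ (2 * η - θ) := by ring
      _ ≤ _ := by
        refine mul_le_mul_of_nonneg_right ?_ hwp.le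
        have : 0 ≤ 4 * C * D' * N' := by positivity
        linarith
  · have hx0 : x ≠ 0 := by
      rintro rfl
      simp at hx
      linarith
    have hxpos : 0 < |x| := abs_pos.2 hx0
    -- Mean zero allows $K(x)$ to be subtracted. The difference yields $|x|^{-\theta}$ at the price
    -- of moving $|y|^\theta$ onto $f$. One loss $|x|^\eta$ comes from rescaling the singularity and
    -- one $w(x)^\eta$ from the convolution bound, hence the exponent $2\eta-\theta$.
    have e : conv zeroKernel f x = ∫ y, (zeroKernel (x - y) - zeroKernel x) * f y := by
      simp_rw [sub_mul]
      rw [integral_sub (hDK M _ hM hK f hf x).1 (hfi.const_mul _), integral_const_mul, hmean,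
        mul_zero, sub_zero]
      rfl
    have hpt : ∀ᵐ y : ℝ, ‖(zeroKernel (x - y) - zeroKernel x) * f y‖ ≤
        C * |x| ^ (-θ) * (2 * |x| ^ η) * ‖(powSum η (x - y) : ℂ) * g y‖ := by
      filter_upwards [ae_sub_ne_zero x] with y hy
      rw [norm_mul, norm_mul, hgn, Complex.norm_real, Real.norm_of_nonneg (powSum_nonneg _ _)]
      have h1 := hCb x y hx0 hy
      have h2 : |y / x| ^ θ = |y| ^ θ * |x| ^ (-θ) := by
        rw [abs_div, Real.div_rpow (abs_nonneg _) (abs_nonneg _), Real.rpow_neg (abs_nonneg _)]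
        rfl
      have h3 : |1 - y / x| ^ (-η) = |x - y| ^ (-η) * |x| ^ η := by
        have : 1 - y / x = (x - y) / x := by field_simp
        rw [this, abs_div, Real.div_rpow (abs_nonneg _) (abs_nonneg _),
          Real.rpow_neg (abs_nonneg x), div_inv_eq_mul]
      have h4 : 1 + |1 - y / x| ^ (-η) ≤ 2 * |x| ^ η * powSum η (x - y) := by
        rw [h3]
        have h5 := one_le_powSum hη.le hy
        have h6 := Real.one_le_rpow hx hη.le
        have h7 : |x - y| ^ (-η) ≤ powSum η (x - y) := by
          unfold powSum
          have : 0 ≤ |x - y| ^ η := by positivity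
          linarith
        nlinarith
      calc _ ≤ C * (|y / x| ^ θ * (1 + |1 - y / x| ^ (-η))) * ‖f y‖ := by gcongr
        _ ≤ C * ((|y| ^ θ * |x| ^ (-θ)) * (2 * |x| ^ η * powSum η (x - y))) * ‖f y‖ := by
          rw [h2]; gcongr
        _ = _ := by ring
    have hconv := hDK' 1 _ zero_le_one hP g hgm x
    have h1 : ‖conv zeroKernel f x‖ ≤ C * |x| ^ (-θ) * (2 * |x| ^ η) * (D' * 1 * weight x ^ η * N') := by
      rw [e]
      refine (norm_integral_le_of_norm_le (hconv.1.norm.const_mul _) hpt).trans ?_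
      rw [integral_const_mul]
      gcongr
      exact hconv.2
    have h2 : |x| ^ (-θ) ≤ 2 * weight x ^ (-θ) := by
      have h3 : weight x ≤ 2 * |x| := by unfold weight; linarith
      rw [Real.rpow_neg hxpos.le, Real.rpow_neg hw.le]
      have h4 : weight x ^ θ ≤ 2 * |x| ^ θ := by
        calc weight x ^ θ ≤ (2 * |x|) ^ θ := Real.rpow_le_rpow hw.le h3 hθ0.le
          _ = 2 ^ θ * |x| ^ θ := Real.mul_rpow zero_le_two hxpos.le
          _ ≤ 2 * |x| ^ θ := by
            gcongr
            simpa using Real.rpow_le_rpow_of_exponent_le one_le_two hθ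
      have h5 : 0 < |x| ^ θ := by positivity
      have h6 := weight_rpow_pos θ x
      rw [← div_eq_mul_inv, inv_eq_one_div, div_le_div_iff₀ h5 h6]
      linarith
    have h3 : |x| ^ η ≤ weight x ^ η :=
      Real.rpow_le_rpow hxpos.le (by unfold weight; linarith) hη.le
    have h4 : weight x ^ (2 * η - θ) = weight x ^ (-θ) * weight x ^ η * weight x ^ η := by
      rw [← Real.rpow_add hw, ← Real.rpow_add hw]; congr 1; ring
    have h5 := (weight_rpow_pos η x).le
    calc _ ≤ C * |x| ^ (-θ) * (2 * |x| ^ η) * (D' * 1 * weight x ^ η * N') := h1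
      _ ≤ C * (2 * weight x ^ (-θ)) * (2 * weight x ^ η) * (D' * 1 * weight x ^ η * N') := by
        gcongr
      _ = 4 * C * D' * N' * weight x ^ (2 * η - θ) := by rw [h4]; ring
      _ ≤ _ := by
        refine mul_le_mul_of_nonneg_right ?_ hwp.le
        have : 0 ≤ 2 * (D * M * N) := by positivity
        linarith

lemma MemWeightedLp.ofReal {p : ℝ≥0∞} {s : ℝ} {u : ℝ → ℝ} (hu : MemWeightedLp p s u) :
    MemWeightedLp p s (fun x => (u x : ℂ)) := by
  have : MemLp (fun x => ((weight x ^ s • u x : ℝ) : ℂ)) p volume := MemLp.ofReal hu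
  refine this.congr_norm (((continuous_weight_rpow s).aestronglyMeasurable).smul
    (Complex.continuous_ofReal.comp_aestronglyMeasurable hu.aestronglyMeasurable))
    (Eventually.of_forall fun x => ?_)
  simp

/-- A mean zero solution of the homogeneous equation has enough decay. -/
lemma memWeightedLp_of_eq_mul_conv {s s₁ η : ℝ} (hη : 0 < η) (hη2 : η ≤ 1 / 16)
    (hηs : 1 / 2 + 16 * η ≤ s₁) (hs : s₁ < s) {u : ℝ → ℝ} (hu : MemWeightedLp 2 s u) (c : ℂ)
    {f : ℝ → ℂ} (hf : MemWeightedLp 2 s₁ f) (hmean : ∫ y, f y = 0)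
    (heq : f =ᵐ[volume] fun x => (u x : ℂ) * (c * conv zeroKernel f x)) :
    MemWeightedLp 2 (3 / 2 + 14 * η) f := by
  -- The equation gives $f\in L^2_{s-2\eta+\theta}$. With $\theta=r-\frac12-2\eta$ and
  -- $s>\frac12+16\eta$ this gains at least $12\eta$; with $\theta=1$ it already reaches
  -- $\frac32+14\eta$.
  have hstep : ∀ r : ℝ, 1 / 2 + 16 * η ≤ r → MemWeightedLp 2 r f →
      MemWeightedLp 2 (min (r + 12 * η) (3 / 2 + 14 * η)) f := by
    intro r hr hfr
    set θ := min 1 (r - 1 / 2 - 2 * η) with hθ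
    have hθ1 : θ ≤ 1 := min_le_left _ _
    have hθ2 : θ ≤ r - 1 / 2 - 2 * η := min_le_right _ _
    have hθη : η ≤ θ := le_min (by linarith) (by linarith)
    obtain ⟨C, hC⟩ := exists_norm_conv_zeroKernel_le hη (by linarith) hθη hθ1
      (by linarith : θ + 1 / 2 + η < r) hfr hmean
    have h1 : MemWeightedLp 2 (s - (2 * η - θ)) f := by
      refine hu.ofReal.mul_of_norm_le (C := ‖c‖ * C) hf.aestronglyMeasurable ?_
      filter_upwards [heq] with x hx
      rw [hx, norm_mul, norm_mul]
      calc _ ≤ ‖(u x : ℂ)‖ * (‖c‖ * (C * weight x ^ (2 * η - θ))) := by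
            gcongr
            exact hC x
        _ = _ := by ring
    refine h1.mono_exponent ?_
    rcases min_choice 1 (r - 1 / 2 - 2 * η) with h | h
    · rw [← hθ] at h
      refine (min_le_right _ _).trans ?_
      linarith
    · rw [← hθ] at h
      refine (min_le_left _ _).trans ?_
      linarith
  have hind : ∀ n : ℕ, MemWeightedLp 2 (min (s₁ + 12 * η * n) (3 / 2 + 14 * η)) f := by
    intro n
    induction n with
    | zero => exact hf.mono_exponent ((min_le_left _ _).trans (by simp))
    | succ n ih =>
      refine (hstep _ (le_min ?_ (by linarith)) ih).mono_exponent ?_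
      · have : 0 ≤ 12 * η * (n : ℝ) := by positivity
        linarith
      · rw [← min_add_add_right]
        refine le_min (le_min ?_ ?_) (min_le_right _ _)
        · refine (min_le_left _ _).trans (le_of_eq ?_)
          push_cast
          ring
        · refine (min_le_right _ _).trans ?_
          linarith
  -- The gain per step is fixed, so finitely many steps reach the cap.
  obtain ⟨n, hn⟩ := exists_nat_gt ((3 / 2 + 14 * η) / (12 * η))
  rw [div_lt_iff₀ (by positivity)] at hn
  refine (hind n).mono_exponent (le_min ?_ le_rfl)
  have : (n : ℝ) * (12 * η) = 12 * η * n := by ring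
  linarith

/-! ### Triviality of the homogeneous equation at zero energy -/

lemma conv_modKernel_zero {χ : ℝ → ℂ} (hχ : IsCutoff χ) {r : ℝ} (hr : 1 / 2 < r)
    {f : ℝ → ℂ} (hf : MemWeightedLp 2 r f) (x : ℝ) :
    conv (modKernel χ .zero) f x = (1 / (2 * Real.pi) : ℂ) *
      (conv zeroKernel f x - logTail χ 0 * ∫ y, f y) := by
  obtain ⟨η, hη, hη2, hηr⟩ : ∃ η : ℝ, 0 < η ∧ η < 1 / 2 ∧ 1 / 2 + η < r :=
    ⟨min (1 / 4) ((r - 1 / 2) / 2), lt_min (by norm_num) (by linarith),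
      (min_le_left _ _).trans_lt (by norm_num), by
        linarith [min_le_right (1 / 4 : ℝ) ((r - 1 / 2) / 2)]⟩
  obtain ⟨M, hM, hK⟩ := exists_kernelBound_zeroKernel hη
  obtain ⟨D, hD, hDK⟩ := exists_conv_bound hη hη2 hηr
  have hfi : Integrable f := by
    have := integrable_weight_mul (a := 0) (by linarith) hf
    simpa using this
  have e : conv (modKernel χ .zero) f x = ∫ y, (1 / (2 * Real.pi) : ℂ) *
      (zeroKernel (x - y) * f y - logTail χ 0 * f y) := by
    refine integral_congr_ae ?_
    filter_upwards [ae_sub_ne_zero x] with y hy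
    rw [modKernel_zero_eq hχ hy]
    ring
  rw [e, integral_const_mul, integral_sub (hDK M _ hM hK f hf x).1 (hfi.const_mul _),
    integral_const_mul]
  rfl

lemma conj_one_div_two_pi :
    (starRingEnd ℂ) (1 / (2 * Real.pi) : ℂ) = (1 / (2 * Real.pi) : ℂ) := by
  have : (1 / (2 * Real.pi) : ℂ) = ((1 / (2 * Real.pi) : ℝ) : ℂ) := by push_cast; rfl
  rw [this, Complex.conj_ofReal]

/-- A solution of the homogeneous equation at `k = 0` has mean zero as soon as the constant in the
kernel is not real. -/
lemma integral_eq_zero_of_eq_mul_conv {χ : ℝ → ℂ} (hχ : IsCutoff χ) (him : (logTail χ 0).im ≠ 0)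
    {r : ℝ} (hr : 1 / 2 < r) {u : ℝ → ℝ} {f : ℝ → ℂ} (hf : MemWeightedLp 2 r f)
    (heq : f =ᵐ[volume] fun x => (u x : ℂ) * conv (modKernel χ .zero) f x) :
    ∫ y, f y = 0 := by
  obtain ⟨η, hη, hη2, hηr⟩ : ∃ η : ℝ, 0 < η ∧ η < 1 / 2 ∧ 1 / 2 + η < r :=
    ⟨min (1 / 4) ((r - 1 / 2) / 2), lt_min (by norm_num) (by linarith),
      (min_le_left _ _).trans_lt (by norm_num), by
        linarith [min_le_right (1 / 4 : ℝ) ((r - 1 / 2) / 2)]⟩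
  obtain ⟨M, hM, hK⟩ := exists_kernelBound_zeroKernel hη
  have hfm := hf.aestronglyMeasurable
  have hfi : Integrable f := by
    have := integrable_weight_mul (a := 0) (by linarith) hf
    simpa using this
  have hcf := integrable_conj_comp hfi
  have ha : Integrable fun x => ((weight x ^ η : ℝ) : ℂ) * (starRingEnd ℂ) (f x) := by
    refine (integrable_conj_comp (integrable_weight_mul (a := η) (by linarith) hf)).congr
      (Eventually.of_forall fun x => ?_)
    simp
  obtain ⟨hint, hprod⟩ := integral_prod_conv hη hη2 hηr hM hK hf hcf.1 ha
  have hint' : Integrable fun x => (starRingEnd ℂ) (f x) * conv zeroKernel f x := by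
    refine hint.integral_prod_left.congr (Eventually.of_forall fun x => ?_)
    simp only [integral_const_mul]
    rfl
  set m := ∫ y, f y with hm
  set A := ∫ x, (starRingEnd ℂ) (f x) * conv zeroKernel f x with hA
  -- $\int\bar f\,(K*f)$ is real by Hermitian symmetry, and `hB` says the same of the pairing with
  -- the full kernel. Their difference, a real multiple of $c\,|\int f|^2$, is therefore real.
  have hAc : (starRingEnd ℂ) A = A := by
    rw [← hprod]
    exact conj_integral_zeroKernel f f
  have hB := conj_integral_of_eq_mul (ρ := fun _ => 1) heq
  simp only [Complex.ofReal_one, one_mul] at hB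
  have e : ∀ x, (starRingEnd ℂ) (f x) * conv (modKernel χ .zero) f x =
      (1 / (2 * Real.pi) : ℂ) * ((starRingEnd ℂ) (f x) * conv zeroKernel f x -
        logTail χ 0 * m * (starRingEnd ℂ) (f x)) := by
    intro x
    rw [conv_modKernel_zero hχ hr hf x]
    ring
  simp_rw [e] at hB
  rw [integral_const_mul, integral_sub hint' (hcf.const_mul _), integral_const_mul, integral_conj,
    ← hA, ← hm, map_mul] at hB
  have hκ0 : (1 / (2 * Real.pi) : ℂ) ≠ 0 := by simp [Real.pi_ne_zero]
  rw [conj_one_div_two_pi] at hB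
  have h1 := mul_left_cancel₀ hκ0 hB
  rw [map_sub, hAc] at h1
  have h2 := sub_right_injective h1
  rw [mul_assoc, Complex.mul_conj, map_mul, Complex.conj_ofReal] at h2
  by_contra hne
  have hns : ((Complex.normSq m : ℝ) : ℂ) ≠ 0 := by
    exact_mod_cast (Complex.normSq_pos.2 hne).ne'
  exact him (Complex.conj_eq_iff_im.1 (mul_right_cancel₀ hns h2))

/-- The homogeneous equation at `k = 0` has only the trivial solution. -/
lemma eq_zero_of_eq_mul_conv {χ : ℝ → ℂ} (hχ : IsCutoff χ) (him : (logTail χ 0).im ≠ 0)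
    {s s₁ : ℝ} (hs₁ : 1 / 2 < s₁) (hs : s₁ < s) {u : ℝ → ℝ} (hu : MemWeightedLp 2 s u)
    {f : ℝ → ℂ} (hf : MemWeightedLp 2 s₁ f)
    (heq : f =ᵐ[volume] fun x => (u x : ℂ) * conv (modKernel χ .zero) f x) :
    f =ᵐ[volume] 0 := by
  obtain ⟨η, hη, hη2, hηs⟩ : ∃ η : ℝ, 0 < η ∧ η ≤ 1 / 16 ∧ 1 / 2 + 16 * η ≤ s₁ :=
    ⟨min (1 / 16) ((s₁ - 1 / 2) / 16), lt_min (by norm_num) (by linarith), min_le_left _ _, by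
        linarith [min_le_right (1 / 16 : ℝ) ((s₁ - 1 / 2) / 16)]⟩
  have hmean := integral_eq_zero_of_eq_mul_conv hχ him hs₁ hf heq
  have hconv : ∀ x, conv (modKernel χ .zero) f x =
      (1 / (2 * Real.pi) : ℂ) * conv zeroKernel f x := by
    intro x
    rw [conv_modKernel_zero hχ hs₁ hf x, hmean, mul_zero, sub_zero]
  simp_rw [hconv] at heq
  have hfr := memWeightedLp_of_eq_mul_conv hη hη2 hηs hs hu _ hf hmean heq
  have hfm := hf.aestronglyMeasurable
  have hxf : MemWeightedLp 2 (3 / 2 + 14 * η - 1) fun y : ℝ => (y : ℂ) * f y := by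
    refine hfr.mul_of_norm_le (C := 1) (Complex.continuous_ofReal.aestronglyMeasurable.mul hfm)
      (Eventually.of_forall fun y => ?_)
    rw [norm_mul, Complex.norm_real, one_mul, Real.rpow_one, Real.norm_eq_abs]
    gcongr
    unfold weight
    linarith
  obtain ⟨M, hM, hK⟩ := exists_kernelBound_zeroKernel hη
  have hweight : ∀ g : ℝ → ℂ, ∀ r, 1 / 2 + η < r → MemWeightedLp 2 r g →
      Integrable fun x => ((weight x ^ η : ℝ) : ℂ) * (starRingEnd ℂ) (g x) := by
    intro g r hr hg
    refine (integrable_conj_comp (integrable_weight_mul (a := η) (by linarith) hg)).congr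
      (Eventually.of_forall fun x => ?_)
    simp
  have hconj : ∀ g : ℝ → ℂ, AEStronglyMeasurable g volume →
      AEStronglyMeasurable (fun x => (starRingEnd ℂ) (g x)) volume := fun g hg =>
    Complex.continuous_conj.comp_aestronglyMeasurable hg
  obtain ⟨hint1, hprod1⟩ := integral_prod_conv hη (by linarith) (by linarith) hM hK hfr
    (hconj _ hxf.aestronglyMeasurable) (hweight _ _ (by linarith) hxf)
  obtain ⟨hint2, -⟩ := integral_prod_conv hη (by linarith) (by linarith) hM hK hxf
    (hconj _ hfm) (hweight _ _ (by linarith) hfr)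
  -- $\int x\bar f\,(K*f)$ is also real. Conjugation moves the factor $x$ to the other variable, so
  -- the form of the commutator of multiplication by $x$ with the convolution vanishes on $f$. The
  -- improved decay makes both double integrals converge.
  have hE := conj_integral_of_eq_mul (ρ := fun x => x) heq
  have e1 : ∀ x : ℝ, (starRingEnd ℂ) (x * f x) * ((1 / (2 * Real.pi) : ℂ) * conv zeroKernel f x) =
      (1 / (2 * Real.pi) : ℂ) * ((starRingEnd ℂ) (x * f x) * conv zeroKernel f x) := fun x => by
    ring
  simp_rw [e1] at hE
  rw [integral_const_mul, ← hprod1, map_mul, conj_integral_zeroKernel (fun x => x * f x) f] at hE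
  have hκ0 : (1 / (2 * Real.pi) : ℂ) ≠ 0 := by simp [Real.pi_ne_zero]
  rw [conj_one_div_two_pi] at hE
  have hE' := mul_left_cancel₀ hκ0 hE
  have hq : ∫ p : ℝ × ℝ, (starRingEnd ℂ) (f p.1) * f p.2 *
      ((p.1 - p.2 : ℝ) * zeroKernel (p.1 - p.2)) = 0 := by
    have e2 : ∀ p : ℝ × ℝ, (starRingEnd ℂ) (f p.1) * f p.2 *
        ((p.1 - p.2 : ℝ) * zeroKernel (p.1 - p.2)) =
        (starRingEnd ℂ) (p.1 * f p.1) * (zeroKernel (p.1 - p.2) * f p.2) -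
        (starRingEnd ℂ) (f p.1) * (zeroKernel (p.1 - p.2) * (p.2 * f p.2)) := by
      intro p
      rw [map_mul, Complex.conj_ofReal]
      push_cast
      ring
    simp_rw [e2]
    rw [Measure.volume_eq_prod, integral_sub hint1 hint2, ← Measure.volume_eq_prod, hE', sub_self]
  have hF : ∀ ξ : ℝ, 0 < ξ → fourierInt f ξ = 0 := fun ξ hξ =>
    fourierInt_eq_zero hη (by linarith) (integrable_weight_mul (by linarith) hfr) hfm hmean hq hξ
  filter_upwards [heq] with x hx
  rw [hx, conv_zeroKernel_eq_zero (by linarith) hfr hmean hF x]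
  simp

/-! ### Fredholm perturbation -/

/-- Stability of the equation `g = b + A g` near a compact operator without eigenvalue `1`. -/
lemma exists_perturbation_bound {E : Type*} [NormedAddCommGroup E] [NormedSpace ℂ E]
    [CompleteSpace E] (A₀ : E →L[ℂ] E) (hA₀ : IsCompactOperator A₀)
    (hinj : ∀ g, g = A₀ g → g = 0) :
    ∃ c : ℝ, 0 < c ∧ (∀ x, ‖x‖ ≤ c * ‖x - A₀ x‖) ∧
      ∀ A : E →L[ℂ] E, c * ‖A - A₀‖ ≤ 1 / 2 → ∀ b, ∃ g, g = b + A g := by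
  -- Fredholm alternative: $1$ is an eigenvalue of the compact operator or lies in its resolvent
  -- set.
  have hunit : IsUnit (1 - A₀) := by
    rcases hA₀.hasEigenvalue_or_mem_resolventSet one_ne_zero with h | h
    · obtain ⟨g, hg⟩ := h.exists_hasEigenvector
      refine absurd (hinj g ?_) hg.2
      simpa using hg.apply_eq_smul.symm
    · simpa [spectrum.mem_resolventSet_iff] using h
  obtain ⟨U, hU⟩ := hunit
  set R : E →L[ℂ] E := ↑U⁻¹ with hR
  have hRU : R * (1 - A₀) = 1 := by rw [← hU]; exact U.inv_mul
  have hUR : (1 - A₀) * R = 1 := by rw [← hU]; exact U.mul_inv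
  refine ⟨‖R‖ + 1, by positivity, fun x => ?_, fun A hA b => ?_⟩
  · have h1 : R (x - A₀ x) = x := by simpa using congrArg (fun T : E →L[ℂ] E => T x) hRU
    calc ‖x‖ = ‖R (x - A₀ x)‖ := by rw [h1]
      _ ≤ ‖R‖ * ‖x - A₀ x‖ := R.le_opNorm _
      _ ≤ _ := by gcongr; linarith
  · have hlt : ‖R * (A - A₀)‖ < 1 := by
      refine (norm_mul_le _ _).trans_lt ?_
      have : ‖R‖ * ‖A - A₀‖ ≤ (‖R‖ + 1) * ‖A - A₀‖ := by gcongr; linarith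
      linarith
    obtain ⟨V, hV⟩ := isUnit_one_sub_of_norm_lt_one hlt
    -- $1-A=(1-A_0)(1-R(A-A_0))$, and the second factor is inverted by a Neumann series. Only a
    -- right inverse is needed here; uniqueness will come from the lower bound for $1-A_0$.
    have hfac : 1 - A = (1 - A₀) * (V : E →L[ℂ] E) := by
      rw [hV, mul_sub, mul_one, ← mul_assoc, hUR, one_mul]
      abel
    set S : E →L[ℂ] E := ↑V⁻¹ with hS
    have hAS : (1 - A) * (S * R) = 1 := by
      rw [hfac, mul_assoc, ← mul_assoc (V : E →L[ℂ] E), hS, V.mul_inv, one_mul, hUR]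
    refine ⟨S (R b), ?_⟩
    have h2 : S (R b) - A (S (R b)) = b := by
      simpa using congrArg (fun T : E →L[ℂ] E => T b) hAS
    rw [← sub_eq_iff_eq_add]
    exact h2

/-! ### From weighted $L^2$ to the equations in weighted $L^\infty$ -/

lemma KernelBound.sub {η M : ℝ} {K K' : ℝ → ℂ} (hK : AEStronglyMeasurable K volume)
    (hK' : AEStronglyMeasurable K' volume) (h : ∀ x : ℝ, x ≠ 0 → ‖K x - K' x‖ ≤ M * powSum η x) :
    KernelBound η M (fun x => K x - K' x) := ⟨hK.sub hK', h⟩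

lemma conv_sub_kernel {K K' f : ℝ → ℂ} {x : ℝ} (h : Integrable fun y => K (x - y) * f y)
    (h' : Integrable fun y => K' (x - y) * f y) :
    conv (fun x => K x - K' x) f x = conv K f x - conv K' f x := by
  simp only [conv, sub_mul]
  exact integral_sub h h'

lemma conv_sub_right {K f f' : ℝ → ℂ} {x : ℝ} (h : Integrable fun y => K (x - y) * f y)
    (h' : Integrable fun y => K (x - y) * f' y) :
    conv K (fun y => f y - f' y) x = conv K f x - conv K f' x := by
  simp only [conv, mul_sub]
  exact integral_sub h h'

lemma memWeightedLp_top_of_norm_le {r C : ℝ} {f : ℝ → ℂ} (hf : AEStronglyMeasurable f volume)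
    (h : ∀ᵐ x, ‖f x‖ ≤ C * weight x ^ (-r)) : MemWeightedLp ∞ r f := by
  refine memLp_top_of_bound ((continuous_weight_rpow r).aestronglyMeasurable.smul hf) C ?_
  filter_upwards [h] with x hx
  rw [norm_smul, Real.norm_of_nonneg (weight_rpow_pos _ _).le]
  have e : weight x ^ r * weight x ^ (-r) = 1 := by
    rw [← Real.rpow_add (weight_pos x), add_neg_cancel, Real.rpow_zero]
  have := (weight_rpow_pos r x).le
  calc _ ≤ weight x ^ r * (C * weight x ^ (-r)) := by gcongr
    _ = C * (weight x ^ r * weight x ^ (-r)) := by ring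
    _ = C := by rw [e, mul_one]

lemma weightedNorm_top_le {r C : ℝ} {f : ℝ → ℂ} (h : ∀ᵐ x, ‖f x‖ ≤ C * weight x ^ (-r)) :
    weightedNorm ∞ r f ≤ ENNReal.ofReal C := by
  rw [weightedNorm, eLpNorm_exponent_top]
  refine eLpNormEssSup_le_of_ae_bound ?_
  filter_upwards [h] with x hx
  rw [norm_smul, Real.norm_of_nonneg (weight_rpow_pos _ _).le]
  have e : weight x ^ r * weight x ^ (-r) = 1 := by
    rw [← Real.rpow_add (weight_pos x), add_neg_cancel, Real.rpow_zero]
  have := (weight_rpow_pos r x).le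
  calc _ ≤ weight x ^ r * (C * weight x ^ (-r)) := by gcongr
    _ = C * (weight x ^ r * weight x ^ (-r)) := by ring
    _ = C := by rw [e, mul_one]

lemma MemWeightedLp.exists_norm_le {r : ℝ} {f : ℝ → ℂ} (hf : MemWeightedLp ∞ r f) :
    ∃ C : ℝ, ∀ᵐ x, ‖f x‖ ≤ C * weight x ^ (-r) := by
  obtain ⟨C, hC⟩ : ∃ C : ℝ, ∀ᵐ x, ‖weight x ^ r • f x‖ ≤ C := by
    have h := hf.2
    rw [eLpNorm_exponent_top] at h
    refine ⟨(eLpNormEssSup (fun x => weight x ^ r • f x) volume).toReal, ?_⟩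
    filter_upwards [ae_le_eLpNormEssSup (f := fun x => weight x ^ r • f x) (μ := volume)] with x hx
    have := ENNReal.toReal_mono h.ne hx
    rwa [toReal_enorm] at this
  refine ⟨C, hC.mono fun x hx => ?_⟩
  rw [norm_smul, Real.norm_of_nonneg (weight_rpow_pos _ _).le] at hx
  rw [Real.rpow_neg (weight_pos x).le, ← div_eq_mul_inv, le_div_iff₀ (weight_rpow_pos _ _)]
  linarith

/-- `m = h + T_κ^0 m` in `L^∞_r`. -/
def IsModSol (χ : ℝ → ℂ) (u : ℝ → ℝ) (r : ℝ) (κ : SpectralPoint) (h m : ℝ → ℂ) : Prop :=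
  MemWeightedLp ∞ r m ∧ ∀ᵐ x, m x = h x + modT χ u κ m x

lemma memWeightedLp_mul_of_top {s s₁ : ℝ} {u : ℝ → ℝ} (hu : MemWeightedLp 2 s u) {φ : ℝ → ℂ}
    (hφ : MemWeightedLp ∞ (-(s - s₁)) φ) : MemWeightedLp 2 s₁ fun y => (u y : ℂ) * φ y := by
  obtain ⟨C, hC⟩ := hφ.exists_norm_le
  have h := hu.ofReal.mul_of_norm_le (b := s - s₁) (C := C)
    (hu.ofReal.aestronglyMeasurable.mul hφ.aestronglyMeasurable) (by
      filter_upwards [hC] with x hx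
      rw [neg_neg] at hx
      rw [Pi.mul_apply, norm_mul, mul_comm]
      gcongr)
  rwa [sub_sub_cancel] at h

lemma unweight_toLp_ae {r : ℝ} {f : ℝ → ℂ} (hf : MemWeightedLp 2 r f) :
    unweight r (hf.toLp : Lp ℂ 2 (volume : Measure ℝ)) =ᵐ[volume] f := by
  filter_upwards [hf.coeFn_toLp] with x hx
  rw [unweight, hx, Complex.real_smul, ← mul_assoc, ← Complex.ofReal_mul,
    ← Real.rpow_add (weight_pos x)]
  simp

/-- Solvability of `m = h + T_κ^0 m` for `κ` near `0`, with a Hölder estimate at `κ = 0`. -/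
theorem exists_modSol_bounds {s s₁ : ℝ} (hs₁ : 1 / 2 < s₁) (hs : s₁ < s)
    {u : ℝ → ℝ} (hu : MemWeightedLp 2 s u) {χ : ℝ → ℂ} (hχ : IsCutoff χ)
    (him : (logTail χ 0).im ≠ 0) :
    ∃ k₀ η C : ℝ, 0 < k₀ ∧ k₀ ≤ 1 / 2 ∧ 0 < η ∧ η < 1 ∧ 0 < C ∧
      (∀ κ : SpectralPoint, ‖κ.val‖ < k₀ → ∀ φ : ℝ → ℂ, MemWeightedLp ∞ (-(s - s₁)) φ →
        ∀ x : ℝ, Integrable fun y => modKernel χ κ (x - y) * ((u y : ℂ) * φ y)) ∧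
      ∀ κ : SpectralPoint, ‖κ.val‖ < k₀ → ∀ h : ℝ → ℂ, AEStronglyMeasurable h volume →
        (∀ x, ‖h x‖ ≤ 1) →
        (∃ m, IsModSol χ u (-(s - s₁)) κ h m ∧
          ∀ m', IsModSol χ u (-(s - s₁)) κ h m' → m' =ᵐ[volume] m) ∧
        ((∀ x, ‖h x - 1‖ ≤ 2 * ‖κ.val‖ ^ η * weight x ^ η) → ∀ m m₀ : ℝ → ℂ,
          IsModSol χ u (-(s - s₁)) κ h m → IsModSol χ u (-(s - s₁)) .zero (fun _ => 1) m₀ →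
          weightedNorm ∞ (-(s - s₁)) (fun x => m x - m₀ x) ≤
            ENNReal.ofReal (C * ‖κ.val‖ ^ η)) := by
  -- $\eta<\frac12$ makes the local singularity square integrable, $\frac12+\eta<s_1$ is needed for
  -- the convolution bound, and $\eta\le s-s_1$ lets growth $w^\eta$ fit into $L^\infty_{-(s-s_1)}$.
  obtain ⟨η, hη, hη2, hηs₁, hηs⟩ : ∃ η : ℝ, 0 < η ∧ η < 1 / 2 ∧ 1 / 2 + η < s₁ ∧ η ≤ s - s₁ := by
    refine ⟨min (1 / 4) (min ((s₁ - 1 / 2) / 2) (s - s₁)),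
      lt_min (by norm_num) (lt_min (by linarith) (by linarith)),
      (min_le_left _ _).trans_lt (by norm_num), ?_, (min_le_right _ _).trans (min_le_right _ _)⟩
    have := (min_le_right (1 / 4 : ℝ) (min ((s₁ - 1 / 2) / 2) (s - s₁))).trans (min_le_left _ _)
    linarith
  have hzero : ‖SpectralPoint.zero.val‖ < 1 / 2 := by simp [SpectralPoint.val]
  obtain ⟨M, hM, hbounds⟩ := exists_modKernel_bounds hχ hη (by linarith : η < 1)
  have hKκ : ∀ κ : SpectralPoint, ‖κ.val‖ < 1 / 2 → KernelBound η M (modKernel χ κ) :=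
    fun κ hκ => ⟨aestronglyMeasurable_modKernel hχ hκ, fun x hx => (hbounds κ hκ x hx).1⟩
  have hKd : ∀ κ : SpectralPoint, ‖κ.val‖ < 1 / 2 → KernelBound η (M * ‖κ.val‖ ^ η)
      (fun x => modKernel χ κ x - modKernel χ .zero x) := fun κ hκ =>
    .sub (aestronglyMeasurable_modKernel hχ hκ) (aestronglyMeasurable_modKernel hχ hzero)
      fun x hx => (hbounds κ hκ x hx).2
  obtain ⟨D, hD, hDK⟩ := exists_conv_bound hη hη2 hηs₁
  set v : ℝ → ℂ := fun x => ((weight x ^ s₁ : ℝ) : ℂ) * u x with hv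
  have hvm : MemWeightedLp 2 η v := by
    have h1 : MemWeightedLp 2 (s - s₁) v := by
      refine hu.ofReal.mul_of_norm_le (C := 1)
        ((Complex.continuous_ofReal.comp (continuous_weight_rpow s₁)).aestronglyMeasurable.mul
          hu.ofReal.aestronglyMeasurable) (Eventually.of_forall fun x => ?_)
      rw [hv, norm_mul, Complex.norm_real, Real.norm_of_nonneg (weight_rpow_pos _ _).le, one_mul]
    exact h1.mono_exponent hηs
  obtain ⟨E, hE, hEK⟩ := exists_convOperator hη hη2 hηs₁ hvm
  have hA := fun κ : {κ : SpectralPoint // ‖κ.val‖ < 1 / 2} => hEK M _ hM.le (hKκ κ.1 κ.2)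
  choose A hAae hAnorm hAcomp using hA
  set A₀ := A ⟨.zero, hzero⟩ with hA₀
  have hconvi : ∀ κ : SpectralPoint, ‖κ.val‖ < 1 / 2 → ∀ f, MemWeightedLp 2 s₁ f → ∀ x,
      Integrable fun y => modKernel χ κ (x - y) * f y := fun κ hκ f hf x =>
    (hDK M _ hM.le (hKκ κ hκ) f hf x).1
  have hmemun : ∀ g : Lp ℂ 2 (volume : Measure ℝ), MemWeightedLp 2 s₁ (unweight s₁ g) := fun g =>
    memWeightedLp_unweight s₁ (Lp.memLp g)
  have hAsub : ∀ κ, ‖A κ - A₀‖ ≤ E * (M * ‖κ.1.val‖ ^ η) := by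
    intro κ
    obtain ⟨B, hB, hBn, -⟩ := hEK _ _ (by positivity) (hKd κ.1 κ.2)
    have : A κ - A₀ = B := by
      ext1 g
      refine Lp.ext ?_
      rw [sub_apply]
      filter_upwards [Lp.coeFn_sub (A κ g) (A₀ g), hAae κ g, hAae ⟨.zero, hzero⟩ g, hB g]
        with x h1 h2 h3 h4
      rw [h1, Pi.sub_apply, h2, h3, h4, conv_sub_kernel (hconvi _ κ.2 _ (hmemun g) x)
        (hconvi _ hzero _ (hmemun g) x)]
      ring
    rw [this]
    exact hBn
  have hvu : ∀ x, v x = ((weight x ^ s₁ : ℝ) : ℂ) * u x := fun x => rfl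
  have hunw : ∀ (x : ℝ) (z : ℂ), ((weight x ^ (-s₁) : ℝ) : ℂ) * (v x * z) = u x * z := by
    intro x z
    have : ((weight x ^ (-s₁) : ℝ) : ℂ) * ((weight x ^ s₁ : ℝ) : ℂ) = 1 := by
      rw [← Complex.ofReal_mul, ← Real.rpow_add (weight_pos x)]; simp
    rw [hvu]
    linear_combination (u x * z) * this
  -- A fixed point $g$ of $A_0$ gives $f=w^{-s_1}g\in L^2_{s_1}$ solving the homogeneous equation at
  -- $k=0$.
  have hinj : ∀ g, g = A₀ g → g = 0 := by
    intro g hg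
    have h1 : (unweight s₁ g) =ᵐ[volume] fun x =>
        (u x : ℂ) * conv (modKernel χ .zero) (unweight s₁ g) x := by
      have h2 : (g : ℝ → ℂ) =ᵐ[volume] (A₀ g : ℝ → ℂ) := by rw [← hg]
      filter_upwards [h2, hAae ⟨.zero, hzero⟩ g] with x hx1 hx2
      conv_lhs => rw [unweight, hx1, hx2, hunw]
    have h3 := eq_zero_of_eq_mul_conv hχ him hs₁ hs hu (hmemun g) h1
    refine Lp.ext ?_
    filter_upwards [h3, Lp.coeFn_zero ℂ 2 (volume : Measure ℝ)] with x hx1 hx2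
    rw [hx2, Pi.zero_apply, ← weight_smul_unweight s₁ g x, hx1, Pi.zero_apply, smul_zero]
  obtain ⟨c, hc, hcb, hcs⟩ := exists_perturbation_bound A₀ (hAcomp _) hinj
  obtain ⟨k₀, hk₀, hk₀2, hsmall⟩ : ∃ k₀ : ℝ, 0 < k₀ ∧ k₀ ≤ 1 / 2 ∧
      ∀ t : ℝ, 0 ≤ t → t < k₀ → c * (E * (M * t ^ η)) ≤ 1 / 2 := by
    have hlim : Tendsto (fun t : ℝ => c * (E * (M * t ^ η))) (𝓝 0) (𝓝 (c * (E * (M * 0 ^ η)))) :=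
      (((Real.continuousAt_rpow_const 0 η (Or.inr hη.le)).tendsto.const_mul M).const_mul
        E).const_mul c
    rw [Real.zero_rpow hη.ne', mul_zero, mul_zero, mul_zero] at hlim
    have hev := hlim.eventually_lt_const (by norm_num : (0 : ℝ) < 1 / 2)
    obtain ⟨k, hk, hkb⟩ := Metric.eventually_nhds_iff.1 hev
    refine ⟨min k (1 / 2), lt_min hk (by norm_num), min_le_right _ _, fun t ht0 ht => ?_⟩
    refine (hkb ?_).le
    rw [Real.dist_eq, sub_zero, abs_of_nonneg ht0]
    exact ht.trans_le (min_le_left _ _)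
  have hlt2 : ∀ {κ : SpectralPoint}, ‖κ.val‖ < k₀ → ‖κ.val‖ < 1 / 2 := fun h => h.trans_le hk₀2
  have hcA : ∀ κ, ‖κ.1.val‖ < k₀ → c * ‖A κ - A₀‖ ≤ 1 / 2 := fun κ hκ =>
    (mul_le_mul_of_nonneg_left (hAsub κ) hc.le).trans (hsmall _ (norm_nonneg _) hκ)
  -- The perturbation takes up at most half of $\|g\|$ and is absorbed on the left, which doubles
  -- the constant.
  have hcb2 : ∀ κ, ‖κ.1.val‖ < k₀ → ∀ g, ‖g‖ ≤ 2 * c * ‖g - A κ g‖ := by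
    intro κ hκ g
    have h1 := hcb g
    have e : g - A₀ g = (g - A κ g) + (A κ - A₀) g := by
      rw [sub_apply]; abel
    have h2 : ‖g - A₀ g‖ ≤ ‖g - A κ g‖ + ‖A κ - A₀‖ * ‖g‖ := by
      rw [e]
      exact (norm_add_le _ _).trans (by gcongr; exact (A κ - A₀).le_opNorm g)
    have h3 := mul_le_mul_of_nonneg_right (hcA κ hκ) (norm_nonneg g)
    have h4 := mul_le_mul_of_nonneg_left h2 hc.le
    nlinarith
  -- passage between the equation for `m` and the one for `w^{s₁} u m`
  have hb : ∀ h : ℝ → ℂ, AEStronglyMeasurable h volume → (∀ x, ‖h x‖ ≤ 1) →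
      MemWeightedLp 2 s₁ fun y => (u y : ℂ) * h y := by
    intro h hhm hh1
    have h1 := hu.ofReal.mul_of_norm_le (b := 0) (C := 1)
      (hu.ofReal.aestronglyMeasurable.mul hhm) (Eventually.of_forall fun x => by
        rw [Pi.mul_apply, norm_mul, Real.rpow_zero, one_mul, one_mul]
        exact mul_le_of_le_one_right (norm_nonneg _) (hh1 x))
    rw [sub_zero] at h1
    exact h1.mono_exponent hs.le
  have hsol : ∀ (κ : {κ : SpectralPoint // ‖κ.val‖ < 1 / 2}) (h m : ℝ → ℂ)
      (hbh : MemWeightedLp 2 s₁ fun y => (u y : ℂ) * h y)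
      (hm : IsModSol χ u (-(s - s₁)) κ.1 h m),
      ((memWeightedLp_mul_of_top hu hm.1).toLp : Lp ℂ 2 (volume : Measure ℝ)) = hbh.toLp +
        A κ (memWeightedLp_mul_of_top hu hm.1).toLp := by
    intro κ h m hbh hm
    refine Lp.ext ?_
    filter_upwards [Lp.coeFn_add (hbh.toLp : Lp ℂ 2 (volume : Measure ℝ))
      (A κ (memWeightedLp_mul_of_top hu hm.1).toLp), hbh.coeFn_toLp,
      (memWeightedLp_mul_of_top hu hm.1).coeFn_toLp,
      hAae κ (memWeightedLp_mul_of_top hu hm.1).toLp, hm.2] with x h1 h2 h3 h4 h5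
    rw [h1, Pi.add_apply, h2, h3, h4, conv_congr (unweight_toLp_ae _), h5, hvu,
      Complex.real_smul, Complex.real_smul]
    have : modT χ u κ.1 m x = conv (modKernel χ κ.1) (fun y => (u y : ℂ) * m y) x := rfl
    rw [this]
    ring
  set V := (weightedNorm 2 η v).toReal with hV
  have hV0 : 0 ≤ V := ENNReal.toReal_nonneg
  -- data bounded by `C w^η` give elements of `L²` of norm at most `C V`
  have hbnorm : ∀ (g : Lp ℂ 2 (volume : Measure ℝ)) (p : ℝ → ℂ) (a : ℝ), 0 ≤ a →
      (∀ᵐ x, g x = v x * p x) → (∀ x, ‖p x‖ ≤ a * weight x ^ η) → ‖g‖ ≤ a * V := by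
    intro g p a ha hg hp
    have h1 : eLpNorm g 2 volume ≤ ENNReal.ofReal a * weightedNorm 2 η v := by
      refine eLpNorm_le_mul_eLpNorm_of_ae_le_mul ?_ 2
      filter_upwards [hg] with x hx
      rw [hx, norm_mul, norm_smul, Real.norm_of_nonneg (weight_rpow_pos _ _).le]
      calc _ ≤ ‖v x‖ * (a * weight x ^ η) := by gcongr; exact hp x
        _ = _ := by ring
    rw [Lp.norm_def]
    have h2 := ENNReal.toReal_mono (ENNReal.mul_ne_top ENNReal.ofReal_ne_top hvm.2.ne) h1
    rwa [ENNReal.toReal_mul, ENNReal.toReal_ofReal ha] at h2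
  have hwη : ∀ x, weight x ^ η ≤ weight x ^ (-(-(s - s₁))) := fun x => by
    rw [neg_neg]
    exact Real.rpow_le_rpow_of_exponent_le (one_le_weight x) hηs
  have hw1 : ∀ x, 1 ≤ weight x ^ η := fun x => Real.one_le_rpow (one_le_weight x) hη.le
  -- In order: the contribution of $h-1$, of $G^0_\kappa*(um-um_0)$, and of
  -- $(G^0_\kappa-G^0_0)*(um_0)$.
  set C := 2 + D * M * (c * (2 * V + E * M * (2 * c * V))) + D * M * (2 * c * V) with hC
  refine ⟨k₀, η, C, hk₀, hk₀2, hη, by linarith, by positivity, ?_, ?_⟩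
  · intro κ hκ φ hφ x
    exact hconvi κ (hlt2 hκ) _ (memWeightedLp_mul_of_top hu hφ) x
  intro κ hκ h hhm hh1
  set κ' : {κ : SpectralPoint // ‖κ.val‖ < 1 / 2} := ⟨κ, hlt2 hκ⟩ with hκ'
  have hbh := hb h hhm hh1
  refine ⟨?_, ?_⟩
  · obtain ⟨g, hg⟩ := hcs (A κ') (hcA κ' hκ) hbh.toLp
    set f := unweight s₁ g with hf
    have hfm : MemWeightedLp 2 s₁ f := hmemun g
    -- $m$ is defined from $f$ through the equation and not by dividing $f$ by $u$, which may
    -- vanish; that $um=f$ is then a consequence of $g=b+A_\kappa g$.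
    set m : ℝ → ℂ := fun x => h x + conv (modKernel χ κ) f x with hm
    have hmm : AEStronglyMeasurable m volume := hhm.add
      (aestronglyMeasurable_conv (hKκ κ (hlt2 hκ)).meas hfm.aestronglyMeasurable)
    have hum : (fun y => (u y : ℂ) * m y) =ᵐ[volume] f := by
      have hg' : (g : ℝ → ℂ) =ᵐ[volume]
          ((hbh.toLp + A κ' g : Lp ℂ 2 (volume : Measure ℝ)) : ℝ → ℂ) := by rw [← hg]
      filter_upwards [hg', Lp.coeFn_add (hbh.toLp : Lp ℂ 2 (volume : Measure ℝ)) (A κ' g),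
        hbh.coeFn_toLp, hAae κ' g] with x h1 h2 h3 h4
      have h5 : g x = v x * m x := by
        rw [h1, h2, Pi.add_apply, h3, h4, Complex.real_smul, hvu]
        ring
      rw [hf, unweight, h5, hunw]
    have hTm : ∀ x, modT χ u κ m x = conv (modKernel χ κ) f x := fun x =>
      congrFun (conv_congr hum) x
    have hsolm : IsModSol χ u (-(s - s₁)) κ h m := by
      refine ⟨memWeightedLp_top_of_norm_le (C := 1 + D * M * (weightedNorm 2 s₁ f).toReal) hmm
        (Eventually.of_forall fun x => ?_), Eventually.of_forall fun x => ?_⟩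
      · have h1 := (norm_conv_le (modKernel χ κ) f x).trans
          (hDK M _ hM.le (hKκ κ (hlt2 hκ)) f hfm x).2
        have h2 : 0 ≤ (weightedNorm 2 s₁ f).toReal := ENNReal.toReal_nonneg
        calc _ ≤ ‖h x‖ + ‖conv (modKernel χ κ) f x‖ := norm_add_le _ _
          _ ≤ 1 * weight x ^ η + D * M * weight x ^ η * (weightedNorm 2 s₁ f).toReal := by
            rw [one_mul]
            exact add_le_add ((hh1 x).trans (hw1 x)) h1
          _ = (1 + D * M * (weightedNorm 2 s₁ f).toReal) * weight x ^ η := by ring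
          _ ≤ _ := mul_le_mul_of_nonneg_left (hwη x) (by positivity)
      · rw [hTm]
    refine ⟨m, hsolm, fun m' hm' => ?_⟩
    have e1 := hsol κ' h m hbh hsolm
    have e2 := hsol κ' h m' hbh hm'
    set G := (MemLp.toLp _ (memWeightedLp_mul_of_top hu hsolm.1) :
      Lp ℂ 2 (volume : Measure ℝ)) with hG
    set G' := (MemLp.toLp _ (memWeightedLp_mul_of_top hu hm'.1) :
      Lp ℂ 2 (volume : Measure ℝ)) with hG'
    have e3 : G' - G = 0 := by
      have h1 := hcb2 κ' hκ (G' - G)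
      have h2 : G' - G - A κ' (G' - G) = 0 := by
        rw [map_sub]
        nth_rewrite 1 [e1, e2]
        abel
      rw [h2, norm_zero, mul_zero] at h1
      exact norm_le_zero_iff.1 h1
    have e4 : (fun y => (u y : ℂ) * m' y) =ᵐ[volume] fun y => (u y : ℂ) * m y := by
      have h1 := unweight_toLp_ae (memWeightedLp_mul_of_top hu hm'.1)
      have h2 := unweight_toLp_ae (memWeightedLp_mul_of_top hu hsolm.1)
      rw [← hG'] at h1
      rw [← hG] at h2
      rw [sub_eq_zero.1 e3] at h1
      exact h1.symm.trans h2
    -- The right-hand side of the equation sees $m$ only through $um$, so equality of the products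
    -- forces equality of the solutions, also where $u=0$.
    have e5 : modT χ u κ m' = modT χ u κ m := conv_congr e4
    filter_upwards [hm'.2, hsolm.2] with x h1 h2
    rw [h1, h2, e5]
  · intro hh m m₀ hm hm₀
    have hb1 := hb (fun _ => 1) aestronglyMeasurable_const (fun x => by simp)
    have e1 := hsol κ' h m hbh hm
    have e2 := hsol ⟨.zero, hzero⟩ _ m₀ hb1 hm₀
    have hfm := memWeightedLp_mul_of_top hu hm.1
    have hfm₀ := memWeightedLp_mul_of_top hu hm₀.1
    set f := fun y => (u y : ℂ) * m y with hf
    set f₀ := fun y => (u y : ℂ) * m₀ y with hf₀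
    set G := (MemLp.toLp _ hfm : Lp ℂ 2 (volume : Measure ℝ)) with hG
    set G₀ := (MemLp.toLp _ hfm₀ : Lp ℂ 2 (volume : Measure ℝ)) with hG₀
    set b := (MemLp.toLp _ hbh : Lp ℂ 2 (volume : Measure ℝ)) with hbdef
    set b₀ := (MemLp.toLp _ hb1 : Lp ℂ 2 (volume : Measure ℝ)) with hb₀def
    have hbV : ‖b‖ ≤ 1 * V := by
      refine hbnorm b h 1 zero_le_one ?_ fun x => by rw [one_mul]; exact (hh1 x).trans (hw1 x)
      filter_upwards [hbh.coeFn_toLp] with x hx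
      rw [hx, Complex.real_smul, hvu, mul_assoc]
    have hb₀V : ‖b₀‖ ≤ 1 * V := by
      refine hbnorm b₀ (fun _ => 1) 1 zero_le_one ?_ fun x => by
        rw [one_mul, norm_one]; exact hw1 x
      filter_upwards [hb1.coeFn_toLp] with x hx
      rw [hx, Complex.real_smul, hvu, mul_assoc]
    have hbb : ‖b - b₀‖ ≤ 2 * ‖κ.val‖ ^ η * V := by
      refine hbnorm _ (fun x => h x - 1) _ (by positivity) ?_ hh
      filter_upwards [Lp.coeFn_sub b b₀, hbh.coeFn_toLp, hb1.coeFn_toLp] with x h1 h2 h3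
      rw [h1, Pi.sub_apply, h2, h3, Complex.real_smul, Complex.real_smul, hvu]
      ring
    have hGn : ‖G‖ ≤ 2 * c * V := by
      refine (hcb2 κ' hκ G).trans ?_
      have : G - A κ' G = b := sub_eq_iff_eq_add.2 e1
      rw [this]
      gcongr
      linarith
    have hG₀n : ‖G₀‖ ≤ 2 * c * V := by
      refine (hcb2 ⟨.zero, hzero⟩ (by simpa [SpectralPoint.val] using hk₀) G₀).trans ?_
      have : G₀ - A ⟨.zero, hzero⟩ G₀ = b₀ := sub_eq_iff_eq_add.2 e2
      rw [this]
      gcongr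
      linarith
    -- Apply the lower bound for $1-A_0$ to the difference: its image is $(b-b_0)+(A_\kappa-A_0)G$,
    -- and both terms are $O(|k|^\eta)$.
    have hGG : ‖G - G₀‖ ≤ c * (2 * V + E * M * (2 * c * V)) * ‖κ.val‖ ^ η := by
      refine (hcb (G - G₀)).trans ?_
      have h1 : G - G₀ - A₀ (G - G₀) = (b - b₀) + (A κ' - A₀) G := by
        have h2 : G - A κ' G = b := sub_eq_iff_eq_add.2 e1
        have h3 : G₀ - A₀ G₀ = b₀ := sub_eq_iff_eq_add.2 e2
        rw [← h2, ← h3, map_sub, sub_apply]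
        abel
      rw [h1]
      have h4 : ‖(A κ' - A₀) G‖ ≤ E * (M * ‖κ.val‖ ^ η) * (2 * c * V) :=
        ((A κ' - A₀).le_opNorm G).trans (mul_le_mul (hAsub κ') hGn (norm_nonneg _) (by positivity))
      calc _ ≤ c * (2 * ‖κ.val‖ ^ η * V + E * (M * ‖κ.val‖ ^ η) * (2 * c * V)) := by
            gcongr
            exact (norm_add_le _ _).trans (add_le_add hbb h4)
        _ = _ := by ring
    have hff : MemWeightedLp 2 s₁ fun y => f y - f₀ y := by
      have := MemLp.sub hfm hfm₀
      refine MemLp.ae_eq (Eventually.of_forall fun x => ?_) this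
      simp only [Pi.sub_apply, smul_sub]
    have hffn : (weightedNorm 2 s₁ fun y => f y - f₀ y).toReal = ‖G - G₀‖ := by
      have e : G - G₀ = MemLp.toLp _ hff := by
        refine Lp.ext ?_
        filter_upwards [Lp.coeFn_sub G G₀, hfm.coeFn_toLp, hfm₀.coeFn_toLp, hff.coeFn_toLp]
          with x h1 h2 h3 h4
        rw [h1, Pi.sub_apply, h2, h3, h4, smul_sub]
      rw [e]
      exact (Lp.norm_toLp _ hff).symm
    have hf₀n : (weightedNorm 2 s₁ f₀).toReal = ‖G₀‖ := (Lp.norm_toLp _ hfm₀).symm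
    refine weightedNorm_top_le ?_
    filter_upwards [hm.2, hm₀.2] with x h1 h2
    have e3 : m x - m₀ x = (h x - 1) + conv (modKernel χ κ) (fun y => f y - f₀ y) x +
        conv (fun x => modKernel χ κ x - modKernel χ .zero x) f₀ x := by
      rw [conv_sub_right (hconvi κ (hlt2 hκ) f hfm x) (hconvi κ (hlt2 hκ) f₀ hfm₀ x),
        conv_sub_kernel (hconvi κ (hlt2 hκ) f₀ hfm₀ x) (hconvi .zero hzero f₀ hfm₀ x), h1, h2]
      have h3 : modT χ u κ m x = conv (modKernel χ κ) f x := rfl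
      have h4 : modT χ u .zero m₀ x = conv (modKernel χ .zero) f₀ x := rfl
      rw [h3, h4]
      ring
    have h5 := (norm_conv_le (modKernel χ κ) _ x).trans
      (hDK M _ hM.le (hKκ κ (hlt2 hκ)) _ hff x).2
    have h6 := (norm_conv_le (fun x => modKernel χ κ x - modKernel χ .zero x) f₀ x).trans
      (hDK _ _ (by positivity) (hKd κ (hlt2 hκ)) _ hfm₀ x).2
    rw [hffn] at h5
    rw [hf₀n] at h6
    rw [e3]
    have hwp := (weight_rpow_pos η x).le
    calc _ ≤ 2 * ‖κ.val‖ ^ η * weight x ^ η + D * M * weight x ^ η *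
          (c * (2 * V + E * M * (2 * c * V)) * ‖κ.val‖ ^ η) +
          D * (M * ‖κ.val‖ ^ η) * weight x ^ η * (2 * c * V) := by
          refine (norm_add_le _ _).trans (add_le_add ((norm_add_le _ _).trans
            (add_le_add (hh x) (h5.trans ?_))) (h6.trans ?_)) <;> gcongr
      _ = C * ‖κ.val‖ ^ η * weight x ^ η := by rw [hC]; ring
      _ ≤ _ := mul_le_mul_of_nonneg_left (hwη x) (by positivity)

/-- Interpolation: $\min(a,2)\le2a^\eta$ with $a=\lambda|x|$. This is the closeness of the datum
$e^{i\lambda x}$ to $1$ required by the Hölder estimate. -/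
lemma norm_exp_I_sub_one_le {η lam : ℝ} (h0 : 0 < η) (h1 : η < 1) (hlam : 0 ≤ lam) (x : ℝ) :
    ‖Complex.exp (Complex.I * lam * x) - 1‖ ≤ 2 * lam ^ η * weight x ^ η := by
  set a := lam * |x| with ha
  have ha0 : 0 ≤ a := by positivity
  have hle : ‖Complex.exp (Complex.I * lam * x) - 1‖ ≤ a := by
    have := Real.norm_exp_I_mul_ofReal_sub_one_le (x := lam * x)
    rw [Complex.ofReal_mul, ← mul_assoc] at this
    simpa [abs_mul, abs_of_nonneg hlam] using this
  have hle2 : ‖Complex.exp (Complex.I * lam * x) - 1‖ ≤ 2 := by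
    refine (norm_sub_le _ _).trans ?_
    rw [norm_exp_I_real, norm_one]
    norm_num
  have haη : a ^ η ≤ lam ^ η * weight x ^ η := by
    rw [← Real.mul_rpow hlam (weight_pos x).le]
    refine Real.rpow_le_rpow ha0 ?_ h0.le
    rw [ha]
    gcongr
    unfold weight
    linarith
  have key : ‖Complex.exp (Complex.I * lam * x) - 1‖ ≤ 2 * a ^ η := by
    rcases le_total a 1 with h | h
    · have : a ≤ a ^ η := by
        rcases ha0.eq_or_lt with h2 | h2
        · rw [← h2, Real.zero_rpow h0.ne']
        · simpa using Real.rpow_le_rpow_of_exponent_ge h2 h h1.le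
      linarith
    · have := Real.one_le_rpow h h0.le
      linarith
  linarith

lemma norm_val_ofSide (σ : Side) {lam : ℝ} (hlam : 0 ≤ lam) :
    ‖(SpectralPoint.ofSide σ lam).val‖ = lam := by
  unfold SpectralPoint.ofSide
  split_ifs with h
  · simp [SpectralPoint.val, abs_of_pos h]
  · simp [SpectralPoint.val, le_antisymm (not_lt.1 h) hlam]

end BO

theorem theorem5p9 (s s₁ : ℝ) (hs₁ : 1 / 2 < s₁) (hs : s₁ < s)
    (u : ℝ → ℝ) (hu : BO.MemWeightedLp 2 s u)
    (χ : ℝ → ℂ) (hχ : BO.IsCutoff χ)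
    (hχim : (∫ ξ in (1 : ℝ)..2, χ ξ / (ξ : ℂ)).im ≠ 0) :
    ∃ k₀ : ℝ, 0 < k₀ ∧
      -- the kernels and the convolutions in the two integral equations are well defined
      (∀ κ : BO.SpectralPoint, ‖κ.val‖ < k₀ →
        (∀ x : ℝ, x ≠ 0 → BO.ModKernelConverges χ κ x) ∧
        (∀ φ : ℝ → ℂ, BO.MemWeightedLp ∞ (-(s - s₁)) φ → ∀ x : ℝ,
          Integrable (fun y : ℝ => BO.modKernel χ κ (x - y) * ((u y : ℂ) * φ y)))) ∧
      -- existence and uniqueness of `m_1^0(k)`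
      (∀ κ : BO.SpectralPoint, ‖κ.val‖ < k₀ →
        ∃ m : ℝ → ℂ, BO.IsModM1 χ u (-(s - s₁)) κ m ∧
          ∀ m' : ℝ → ℂ, BO.IsModM1 χ u (-(s - s₁)) κ m' → m' =ᵐ[volume] m) ∧
      -- existence and uniqueness of `m_e^0(λ ± 0i)`
      (∀ (σ : BO.Side) (lam : ℝ), 0 ≤ lam → lam < k₀ →
        ∃ m : ℝ → ℂ, BO.IsModMe χ u (-(s - s₁)) σ lam m ∧
          ∀ m' : ℝ → ℂ, BO.IsModMe χ u (-(s - s₁)) σ lam m' → m' =ᵐ[volume] m) ∧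
      -- the bounds
      ∃ C ε : ℝ, 0 < C ∧ 0 < ε ∧ ε < 1 ∧
        (∀ κ : BO.SpectralPoint, ‖κ.val‖ < k₀ → ∀ m m₀ : ℝ → ℂ,
          BO.IsModM1 χ u (-(s - s₁)) κ m →
          BO.IsModM1 χ u (-(s - s₁)) BO.SpectralPoint.zero m₀ →
          BO.weightedNorm ∞ (-(s - s₁)) (fun x => m x - m₀ x) ≤
            ENNReal.ofReal (C * ‖κ.val‖ ^ ε)) ∧
        (∀ (σ : BO.Side) (lam : ℝ), 0 ≤ lam → lam < k₀ → ∀ m m₀ : ℝ → ℂ,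
          BO.IsModMe χ u (-(s - s₁)) σ lam m →
          BO.IsModM1 χ u (-(s - s₁)) BO.SpectralPoint.zero m₀ →
          BO.weightedNorm ∞ (-(s - s₁)) (fun x => m x - m₀ x) ≤
            ENNReal.ofReal (C * lam ^ ε)) := by
  have him : (BO.logTail χ 0).im ≠ 0 := by simpa [BO.logTail] using hχim
  obtain ⟨k₀, η, C, hk₀, hk₀2, hη, hη1, hC, hconv, hsol⟩ :=
    BO.exists_modSol_bounds hs₁ hs hu hχ him
  -- Both integral equations are instances of $m=h+T^0_\kappa m$ with $|h|\le1$: $h=1$ for $m^0_1$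
  -- and $h=e^{i\lambda x}$ for $m^0_e$. At $\lambda=0$ the latter is the equation for $m^0_1(0)$.
  have hone := fun (κ : BO.SpectralPoint) (hκ : ‖κ.val‖ < k₀) =>
    hsol κ hκ (fun _ => 1) aestronglyMeasurable_const (fun _ => by simp)
  have hexp := fun (σ : BO.Side) (lam : ℝ) (h0 : 0 ≤ lam) (h1 : lam < k₀) =>
    hsol (BO.SpectralPoint.ofSide σ lam) (by rwa [BO.norm_val_ofSide σ h0])
      (fun x => Complex.exp (Complex.I * lam * x)) (by
        apply Continuous.aestronglyMeasurable; fun_prop)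
      (fun x => (BO.norm_exp_I_real lam x).le)
  refine ⟨k₀, hk₀, fun κ hκ => ⟨fun x hx => BO.modKernelConverges hχ (hκ.trans_le hk₀2) hx,
    hconv κ hκ⟩, fun κ hκ => (hone κ hκ).1, fun σ lam h0 h1 => (hexp σ lam h0 h1).1,
    C, η, hC, hη, hη1, fun κ hκ m m₀ hm hm₀ => ?_, fun σ lam h0 h1 m m₀ hm hm₀ => ?_⟩
  · refine (hone κ hκ).2 (fun x => ?_) m m₀ hm hm₀
    rw [sub_self, norm_zero]
    have := BO.weight_rpow_pos η x
    positivity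
  · have h2 := (hexp σ lam h0 h1).2 (fun x => by
      rw [BO.norm_val_ofSide σ h0]
      exact BO.norm_exp_I_sub_one_le hη hη1 h0 x) m m₀ hm hm₀
    rwa [BO.norm_val_ofSide σ h0] at h2
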